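/- Let $n\ge 1$ and let $X=\{1,\dots,n\}\cup\{\overline 1,\dots,\overline n\}$. A Brauer diagram on $X$ is a partition of the disjoint union $X\sqcup X'$ of two copies of $X$ (top row $X$, bottom row $X'$) into two-element blocks. Two such diagrams are multiplied by concatenation: the bottom row of the first is identified with the top row of the second, two vertices of the remaining outer rows lie in one block of the product if and only if they are connected in the resulting picture, and components contained in the middle row are discarded. Let $\mathbf{Br}_n^B$ be the submonoid of all Brauer diagrams on $X$ that are invariant under swapping $k\leftrightarrow\overline k$ (simultaneously in both rows). For $0\le i\le n-1$ define the following elements of $\mathbf{Br}_n^B$. - $\tilde s_i$ is the diagram with blocks $\{v,\pi_i(v)'\}$, $v\in X$, where $\pi_0$ exchanges $1$ and $\overline 1$ and fixes all other points, and, for $i\ge 1$, $\pi_i$ exchanges $i$ with $i+1$ and $\overline i$ with $\overline{i+1}$ and fixes all other points. - $\tilde{\mathtt s}_0$ has the blocks $\{1,\overline 1\}$, $\{1',\overline 1'\}$ and $\{v,v'\}$ for $v\ne 1,\overline 1$. For $i\ge 1$, $\tilde{\mathtt s}_i$ has the blocks $\{i,i+1\}$, $\{\overline i,\overline{i+1}\}$,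 $\{i',(i+1)'\}$, $\{\overline i',\overline{i+1}'\}$ and $\{v,v'\}$ for all other $v$. Let $m_{0,1}=m_{1,0}=4$, let $m_{i,j}=3$ if $|i-j|=1$ and $i,j\ge 1$, and let $m_{i,j}=2$ if $|i-j|\ge 2$. **Theorem.** The monoid $\mathbf{Br}_n^B$ is generated by $\tilde s_i$ and $\tilde{\mathtt s}_i$, $i=0,1,\dots,n-1$, subject to the following defining relations (for all indices in $\{0,\dots,n-1\}$ for which they make sense). That is, the monoid presented by $2n$ abstract generators and these relations is isomorphic to $\mathbf{Br}_n^B$ via the map that sends the abstract generators to the elements $\tilde s_i$ and $\tilde{\mathtt s}_i$. 1. (Singular Artin relations of type $B$.) For all $i\neq j$, with $m=m_{i,j}$ factors on each side and with alternating indices: $\tilde s_i\tilde s_j\tilde s_i\cdots=\tilde s_j\tilde s_i\tilde s_j\cdots$; $\tilde{\mathtt s}_i\tilde s_j\tilde s_i\cdots\tilde s_j\tilde s_i=\tilde s_j\tilde s_i\cdots\tilde s_i\tilde{\mathtt s}_j$ if $m$ is odd; $\tilde{\mathtt s}_i\tilde s_j\tilde s_i\cdots\tilde s_i\tilde s_j=\tilde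 s_j\tilde s_i\cdots\tilde s_j\tilde{\mathtt s}_i$ if $m$ is even; $\tilde{\mathtt s}_i\tilde{\mathtt s}_j=\tilde{\mathtt s}_j\tilde{\mathtt s}_i$ if $m=2$. Moreover, $\tilde{\mathtt s}_i\tilde s_i=\tilde s_i\tilde{\mathtt s}_i$ for all $i$. 2. $\tilde s_i^2=e$ for all $i\ge 0$. 3. (Type $A$ Brauer relations, all indices $\ge 1$.) $\tilde{\mathtt s}_i^2=\tilde{\mathtt s}_i$; $\ \tilde{\mathtt s}_i\tilde s_i=\tilde s_i\tilde{\mathtt s}_i=\tilde{\mathtt s}_i$; $\ \tilde{\mathtt s}_i\tilde{\mathtt s}_{i\pm1}\tilde s_i=\tilde{\mathtt s}_i\tilde s_{i\pm1}$; $\ \tilde s_i\tilde{\mathtt s}_{i\pm1}\tilde{\mathtt s}_i=\tilde s_{i\pm1}\tilde{\mathtt s}_i$. 4. (Additional relations; those involving the index $1$ only if $n\ge2$.) $\tilde{\mathtt s}_0^2=\tilde{\mathtt s}_0$; $\ \tilde{\mathtt s}_1\tilde{\mathtt s}_0\tilde{\mathtt s}_1=\tilde{\mathtt s}_1$; $\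 \tilde{\mathtt s}_1\tilde s_0\tilde{\mathtt s}_1=\tilde{\mathtt s}_1$; $\ \tilde{\mathtt s}_0\tilde{\mathtt s}_1\tilde{\mathtt s}_0=\tilde{\mathtt s}_0\tilde s_1\tilde{\mathtt s}_0$; $\ \tilde s_1\tilde{\mathtt s}_0\tilde s_1\tilde{\mathtt s}_0=\tilde{\mathtt s}_0\tilde s_1\tilde{\mathtt s}_0\tilde s_1=\tilde{\mathtt s}_0\tilde s_1\tilde{\mathtt s}_0$; $\ \tilde{\mathtt s}_1\tilde{\mathtt s}_0=\tilde{\mathtt s}_1\tilde s_1\tilde{\mathtt s}_0\tilde s_1$; $\ \tilde{\mathtt s}_0\tilde{\mathtt s}_1=\tilde s_1\tilde{\mathtt s}_0\tilde s_1\tilde{\mathtt s}_1$; $\ \tilde{\mathtt s}_0\tilde s_0=\tilde s_0\tilde{\mathtt s}_0=\tilde{\mathtt s}_0$. -/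

import Mathlib

/-! ## Brauer diagrams

`X ⊕ X` is the set of vertices of a diagram on `X`: `Sum.inl x` is the vertex `x` in the top row and
`Sum.inr x` is the vertex `x'` in the bottom row. -/

/-- A Brauer diagram on `X`: a partition (equivalence relation) of the top and bottom copies of `X`
all of whose blocks have exactly two elements. -/
@[ext]
structure BrauerDiagram (X : Type*) where
  /-- The equivalence relation whose classes are the blocks. -/
  rel : Setoid (X ⊕ X)
  /-- The block of each vertex consists of that vertex and exactly one other vertex. -/
  pairs : ∀ u, ∃! v, v ≠ u ∧ rel u v

namespace BrauerDiagram

variable {X : Type*}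

/-! ### Concatenation

To concatenate `P` and `Q`, use three rows of vertices `X ⊕ X ⊕ X` (top, middle, bottom), put `P` on
the upper two rows and `Q` on the lower two. -/

/-- The upper two of three rows. -/
def upper : X ⊕ X → X ⊕ X ⊕ X := Sum.map id Sum.inl

/-- The lower two of three rows. -/
def lower : X ⊕ X → X ⊕ X ⊕ X := Sum.inr

/-- The top and bottom of three rows. -/
def outer : X ⊕ X → X ⊕ X ⊕ X := Sum.map id Sum.inr

/-- The connected components of the three-row picture: the equivalence relation generated by `P` on
the upper two rows and by `Q` on the lower two rows. -/
def stack (P Q : Setoid (X ⊕ X)) : Setoid (X ⊕ X ⊕ X) := P.map upper ⊔ Q.map lower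

/-- Concatenation: two outer vertices are in the same block when they are connected in the
three-row picture; components that lie in the middle row are forgotten. -/
def concat (P Q : Setoid (X ⊕ X)) : Setoid (X ⊕ X) := (stack P Q).comap outer

theorem stack_upper {P Q : Setoid (X ⊕ X)} {u v : X ⊕ X} (h : P u v) :
    stack P Q (upper u) (upper v) :=
  (le_sup_left : P.map upper ≤ _) (Setoid.le_comap_map h)

theorem stack_lower {P Q : Setoid (X ⊕ X)} {u v : X ⊕ X} (h : Q u v) :
    stack P Q (lower u) (lower v) :=
  (le_sup_right : Q.map lower ≤ _) (Setoid.le_comap_map h)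

theorem stack_le {P Q : Setoid (X ⊕ X)} {S : Setoid (X ⊕ X ⊕ X)}
    (hP : ∀ u v, P u v → S (upper u) (upper v)) (hQ : ∀ u v, Q u v → S (lower u) (lower v)) :
    stack P Q ≤ S := by
  refine sup_le (Setoid.eqvGen_le ?_) (Setoid.eqvGen_le ?_)
  · rintro _ _ ⟨u, v, h, rfl, rfl⟩
    exact hP u v h
  · rintro _ _ ⟨u, v, h, rfl, rfl⟩
    exact hQ u v h

/-- Two Brauer diagrams are equal as soon as one is contained in the other. -/
theorem ext_of_le {P Q : BrauerDiagram X} (h : P.rel ≤ Q.rel) : P = Q := by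
  apply BrauerDiagram.ext
  refine le_antisymm h ?_
  intro u v huv
  by_cases e : v = u
  · subst e; exact P.rel.refl' _
  · obtain ⟨w, ⟨hw, hr⟩, -⟩ := P.pairs u
    rw [(Q.pairs u).unique ⟨e, huv⟩ ⟨hw, h hr⟩]
    exact hr

/-- The other vertex in the block of `u`. -/
noncomputable def partner (P : BrauerDiagram X) (u : X ⊕ X) : X ⊕ X := (P.pairs u).choose

theorem partner_ne (P : BrauerDiagram X) (u : X ⊕ X) : P.partner u ≠ u :=
  (P.pairs u).choose_spec.1.1

theorem rel_partner (P : BrauerDiagram X) (u : X ⊕ X) : P.rel u (P.partner u) :=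
  (P.pairs u).choose_spec.1.2

theorem eq_or_eq_partner (P : BrauerDiagram X) {u v : X ⊕ X} (h : P.rel u v) :
    v = u ∨ v = P.partner u := by
  by_cases e : v = u
  · exact Or.inl e
  · exact Or.inr ((P.pairs u).unique ⟨e, h⟩ ⟨P.partner_ne u, P.rel_partner u⟩)

theorem partner_involutive (P : BrauerDiagram X) : Function.Involutive P.partner := fun u =>
  ((P.pairs (P.partner u)).unique ⟨P.partner_ne _, P.rel_partner _⟩
    ⟨(P.partner_ne u).symm, P.rel.symm' (P.rel_partner u)⟩)

/-- In a finite set with two involutions that have no common fixed point, the orbit of a point fixed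
by one of them contains exactly one other point that is fixed by one of them. -/
theorem exists_unique_fixed {V : Type*} [Finite V] (a b : Equiv.Perm V)
    (ha : ∀ x, a (a x) = x) (hb : ∀ x, b (b x) = x) (hab : ∀ x, ¬ (a x = x ∧ b x = x))
    (v : V) (hv : b v = v) :
    ∃! w, w ≠ v ∧ (a w = w ∨ b w = w) ∧ ∃ k : ℤ, ((a * b) ^ k) v = w := by
  have hb1 : b⁻¹ = b := by
    ext x
    rw [Equiv.Perm.inv_eq_iff_eq, hb]
  have ha1 : a⁻¹ = a := by
    ext x
    rw [Equiv.Perm.inv_eq_iff_eq, ha]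
  set r := a * b with hr
  have hconj : b * r * b⁻¹ = r⁻¹ := by
    rw [hr, mul_inv_rev, ha1, hb1]
    ext x
    simp [hb]
  have hbk : ∀ k : ℤ, b ((r ^ k) v) = (r ^ (-k)) v := by
    intro k
    have h1 : b * r ^ k * b⁻¹ = r ^ (-k) := by
      rw [← conj_zpow, hconj, inv_zpow, zpow_neg]
    have h2 := congrArg (fun p : Equiv.Perm V => p v) h1
    simpa [hb1, hv] using h2
  have hak : ∀ k : ℤ, a ((r ^ k) v) = (r ^ (1 - k)) v := by
    intro k
    have h1 : a ((r ^ k) v) = r (b ((r ^ k) v)) := by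
      rw [hr]; simp [hb]
    rw [h1, hbk, sub_eq_add_neg, zpow_add, zpow_one]
    rfl
  have hpos : 0 < MulAction.period r v := MulAction.period_pos_of_orderOf_pos (isOfFinOrder_of_finite r).orderOf_pos v
  have hper : ∀ j k : ℤ, (r ^ j) v = (r ^ k) v ↔ ((MulAction.period r v : ℕ) : ℤ) ∣ j - k := by
    intro j k
    rw [← MulAction.zpow_smul_eq_iff_period_dvd, zpow_sub, mul_smul, Equiv.Perm.smul_def,
      Equiv.Perm.smul_def]
    constructor
    · intro h
      rw [← zpow_neg, ← Equiv.Perm.mul_apply, ← zpow_add, ← sub_eq_add_neg] 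
      rw [sub_eq_neg_add, zpow_add, Equiv.Perm.mul_apply, h, ← Equiv.Perm.mul_apply, ← zpow_add]
      simp
    · intro h
      rw [← zpow_neg, ← Equiv.Perm.mul_apply, ← zpow_add] at h
      conv_rhs => rw [← h]
      rw [← Equiv.Perm.mul_apply, ← zpow_add]
      congr 2
      ring
  have h0 : ∀ k : ℤ, (r ^ k) v = v ↔ ((MulAction.period r v : ℕ) : ℤ) ∣ k := by
    intro k
    simpa using hper k 0
  have hbf : ∀ k : ℤ, b ((r ^ k) v) = (r ^ k) v ↔ ((MulAction.period r v : ℕ) : ℤ) ∣ 2 * k := by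
    intro k
    rw [hbk, hper, ← dvd_neg]
    ring_nf
  have haf : ∀ k : ℤ,
      a ((r ^ k) v) = (r ^ k) v ↔ ((MulAction.period r v : ℕ) : ℤ) ∣ 2 * k - 1 := by
    intro k
    rw [hak, hper, ← dvd_neg]
    ring_nf
  generalize MulAction.period r v = m at *
  rcases Nat.even_or_odd' m with ⟨p, hp | hp⟩
  · refine ⟨(r ^ (p : ℤ)) v, ⟨?_, Or.inr ((hbf _).2 ?_), p, rfl⟩, ?_⟩
    · rw [Ne, h0]
      intro h
      have := Int.le_of_dvd (by omega) h
      omega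
    · rw [hp]; push_cast; exact dvd_rfl
    · rintro _ ⟨hne, hf, k, rfl⟩
      rw [Ne, h0] at hne
      rw [hper]
      rcases hf with hf | hf
      · rw [haf] at hf
        obtain ⟨q, hq⟩ := hf
        rw [hp] at hq
        push_cast at hq
        rw [mul_assoc] at hq
        generalize (p : ℤ) * q = z at hq
        omega
      · rw [hbf] at hf
        obtain ⟨q, hq⟩ := hf
        rw [hp] at hq hne ⊢
        push_cast at hq hne ⊢
        rcases Int.even_or_odd' q with ⟨s, hs | hs⟩
        · exact absurd ⟨s, by rw [hs] at hq; linarith⟩ hne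
        · exact ⟨s, by rw [hs] at hq; linarith⟩
  · refine ⟨(r ^ ((p : ℤ) + 1)) v, ⟨?_, Or.inl ((haf _).2 ?_), p + 1, rfl⟩, ?_⟩
    · rw [Ne, h0]
      intro h
      have h1 := Int.le_of_dvd (by omega) h
      have hp0 : p = 0 := by omega
      subst hp0
      refine hab v ⟨?_, hv⟩
      have := (haf 0).2 (by rw [hp]; norm_num)
      simpa using this
    · rw [hp]; push_cast; exact ⟨1, by ring⟩
    · rintro _ ⟨hne, hf, k, rfl⟩
      rw [Ne, h0] at hne
      rw [hper]
      have hcop : IsCoprime ((m : ℕ) : ℤ) 2 := ⟨1, -(p : ℤ), by rw [hp]; push_cast; ring⟩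
      rcases hf with hf | hf
      · rw [haf] at hf
        apply hcop.dvd_of_dvd_mul_left
        have : (2 : ℤ) * (k - (p + 1)) = (2 * k - 1) - (m : ℤ) := by rw [hp]; push_cast; ring
        rw [this]
        exact dvd_sub hf dvd_rfl
      · rw [hbf] at hf
        exact absurd (hcop.dvd_of_dvd_mul_left hf) hne

/-- Concatenation of Brauer diagrams: every outer vertex is connected to exactly one other. -/
theorem concat_pairs [Finite X] (P Q : BrauerDiagram X) (u : X ⊕ X) :
    ∃! v, v ≠ u ∧ concat P.rel Q.rel u v := by
  let e := Equiv.sumAssoc X X X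
  let a : Equiv.Perm (X ⊕ X ⊕ X) :=
    e.permCongr (Equiv.sumCongr P.partner_involutive.toPerm (Equiv.refl X))
  let b : Equiv.Perm (X ⊕ X ⊕ X) := Equiv.sumCongr (Equiv.refl X) Q.partner_involutive.toPerm
  have hup : ∀ x, e (Sum.inl x) = upper x := by rintro (x | x) <;> rfl
  have hau : ∀ x, a (upper x) = upper (P.partner x) := by
    intro x
    rw [← hup, ← hup]
    simp [a]
  have hab' : ∀ y, a (Sum.inr (Sum.inr y)) = Sum.inr (Sum.inr y) := by
    intro y
    have : (Sum.inr (Sum.inr y) : X ⊕ X ⊕ X) = e (Sum.inr y) := rfl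
    rw [this]
    simp [a]
  have hbl : ∀ x, b (lower x) = lower (Q.partner x) := fun x => rfl
  have hbt : ∀ x, b (Sum.inl x) = Sum.inl x := fun x => rfl
  have upper_inj : Function.Injective (upper : X ⊕ X → X ⊕ X ⊕ X) :=
    Function.Injective.sumMap Function.injective_id Sum.inl_injective
  have outer_inj : Function.Injective (outer : X ⊕ X → X ⊕ X ⊕ X) :=
    Function.Injective.sumMap Function.injective_id Sum.inr_injective
  have haune : ∀ x, a (upper x) ≠ upper x := fun x h => P.partner_ne x (upper_inj (by rw [← hau, h]))
  have hblne : ∀ x, b (lower x) ≠ lower x := fun x h =>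
    Q.partner_ne x (Sum.inr_injective ((hbl x).symm.trans h))
  have haa : ∀ x, a (a x) = x := by
    rintro (x | x | x)
    · change a (a (upper (Sum.inl x))) = upper (Sum.inl x)
      rw [hau, hau, P.partner_involutive]
    · change a (a (upper (Sum.inr x))) = upper (Sum.inr x)
      rw [hau, hau, P.partner_involutive]
    · rw [hab', hab']
  have hbb : ∀ x, b (b x) = x := by
    rintro (x | x)
    · rfl
    · change b (b (lower x)) = lower x
      rw [hbl, hbl, Q.partner_involutive]
  have hne : ∀ x, ¬ (a x = x ∧ b x = x) := by
    rintro (x | x) ⟨h1, h2⟩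
    · exact haune (Sum.inl x) h1
    · exact hblne x h2
  have hfix : ∀ x, (a x = x ∨ b x = x) ↔ ∃ w, outer w = x := by
    rintro (x | x | x)
    · exact ⟨fun _ => ⟨Sum.inl x, rfl⟩, fun _ => Or.inr rfl⟩
    · refine ⟨?_, ?_⟩
      · rintro (h | h)
        · exact absurd h (haune (Sum.inr x))
        · exact absurd h (hblne (Sum.inl x))
      · rintro ⟨w | w, h⟩ <;> simp [outer] at h
    · exact ⟨fun _ => ⟨Sum.inr x, rfl⟩, fun _ => Or.inl (hab' x)⟩
  -- the classes of the stacked picture are the orbits of the two involutions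
  have hsa : ∀ x, stack P.rel Q.rel x (a x) := by
    rintro (x | x | x)
    · change stack P.rel Q.rel (upper (Sum.inl x)) (a (upper (Sum.inl x)))
      rw [hau]; exact stack_upper (P.rel_partner _)
    · change stack P.rel Q.rel (upper (Sum.inr x)) (a (upper (Sum.inr x)))
      rw [hau]; exact stack_upper (P.rel_partner _)
    · rw [hab']
  have hsb : ∀ x, stack P.rel Q.rel x (b x) := by
    rintro (x | x)
    · exact Setoid.refl' _ _
    · exact stack_lower (Q.rel_partner x)
  have hsab : ∀ c d : Equiv.Perm (X ⊕ X ⊕ X), (∀ x, stack P.rel Q.rel x (c x)) →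
      (∀ x, stack P.rel Q.rel x (d x)) → ∀ (k : ℤ) x, stack P.rel Q.rel x (((c * d) ^ k) x) := by
    intro c d hc hd k
    have h1 : ∀ x, stack P.rel Q.rel x ((c * d) x) := fun x =>
      Setoid.trans' _ (hd x) (hc (d x))
    have h2 : ∀ x, stack P.rel Q.rel x ((c * d)⁻¹ x) := fun x => by
      have := h1 ((c * d)⁻¹ x)
      rw [← Equiv.Perm.mul_apply, mul_inv_cancel, Equiv.Perm.one_apply] at this
      exact Setoid.symm' _ this
    induction k with
    | zero => intro x; exact Setoid.refl' _ _
    | succ n ih =>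
      intro x
      rw [zpow_add, zpow_one]
      exact Setoid.trans' _ (h1 x) (ih _)
    | pred n ih =>
      intro x
      rw [sub_eq_add_neg, zpow_add, zpow_neg_one]
      exact Setoid.trans' _ (h2 x) (ih _)
  have hb1 : b⁻¹ = b := by
    ext x
    rw [Equiv.Perm.inv_eq_iff_eq, hbb]
  have ha1 : a⁻¹ = a := by
    ext x
    rw [Equiv.Perm.inv_eq_iff_eq, haa]
  -- a class that contains a point fixed by one of the involutions is an orbit of the product
  have horb : ∀ c d : Equiv.Perm (X ⊕ X ⊕ X), (∀ x, c (c x) = x) → (∀ x, d (d x) = x) →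
      c⁻¹ = c → d⁻¹ = d →
      (∀ S : Setoid (X ⊕ X ⊕ X), (∀ x, S x (c x)) → (∀ x, S x (d x)) → stack P.rel Q.rel ≤ S) →
      ∀ v, d v = v → ∀ w, stack P.rel Q.rel v w → ∃ k : ℤ, ((c * d) ^ k) v = w := by
    intro c d hc hd hc1 hd1 hS v hv w hvw
    have hmem : ∀ x, (∃ k : ℤ, ((c * d) ^ k) v = x) → ∃ k : ℤ, ((c * d) ^ k) v = d x := by
      rintro _ ⟨k, rfl⟩
      refine ⟨-k, ?_⟩
      have hconj : d * (c * d) * d⁻¹ = (c * d)⁻¹ := by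
        rw [mul_inv_rev, hc1, hd1]
        ext x
        simp [hd]
      have h1 : d * (c * d) ^ k * d⁻¹ = (c * d) ^ (-k) := by
        rw [← conj_zpow, hconj, inv_zpow, zpow_neg]
      rw [← h1, hd1]
      simp [hv]
    have hmem' : ∀ x, (∃ k : ℤ, ((c * d) ^ k) v = x) → ∃ k : ℤ, ((c * d) ^ k) v = c x := by
      intro x hx
      obtain ⟨k, hk⟩ := hmem x hx
      refine ⟨1 + k, ?_⟩
      rw [zpow_add, zpow_one, Equiv.Perm.mul_apply, hk]
      simp [hd]
    let S : Setoid (X ⊕ X ⊕ X) := Setoid.ker (fun x => ∃ k : ℤ, ((c * d) ^ k) v = x)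
    have hle := hS S (fun x => propext ⟨hmem' x, fun h => by simpa [hc] using hmem' _ h⟩)
      (fun x => propext ⟨hmem x, fun h => by simpa [hd] using hmem _ h⟩)
    have : (∃ k : ℤ, ((c * d) ^ k) v = v) = (∃ k : ℤ, ((c * d) ^ k) v = w) := hle hvw
    rw [← this]
    exact ⟨0, by simp⟩
  have hgen : ∀ S : Setoid (X ⊕ X ⊕ X), (∀ x, S x (a x)) → (∀ x, S x (b x)) →
      stack P.rel Q.rel ≤ S := by
    intro S h1 h2
    apply stack_le
    · intro x y h
      rcases P.eq_or_eq_partner h with rfl | rfl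
      · exact S.refl' _
      · rw [← hau]; exact h1 _
    · intro x y h
      rcases Q.eq_or_eq_partner h with rfl | rfl
      · exact S.refl' _
      · rw [← hbl]; exact h2 _
  have key : ∃! w, w ≠ outer u ∧ (∃ y, outer y = w) ∧ stack P.rel Q.rel (outer u) w := by
    rcases u with x | x
    · have h := exists_unique_fixed a b haa hbb hne (outer (Sum.inl x)) rfl
      refine (existsUnique_congr fun w => ?_).1 h
      rw [hfix]
      refine and_congr_right fun _ => and_congr_right fun _ => ⟨?_, ?_⟩
      · rintro ⟨k, rfl⟩; exact hsab a b hsa hsb k _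
      · exact horb a b haa hbb ha1 hb1 hgen _ rfl w
    · have h := exists_unique_fixed b a hbb haa (fun x h => hne x h.symm) (outer (Sum.inr x))
        (hab' x)
      refine (existsUnique_congr fun w => ?_).1 h
      rw [or_comm, hfix]
      refine and_congr_right fun _ => and_congr_right fun _ => ⟨?_, ?_⟩
      · rintro ⟨k, rfl⟩; exact hsab b a hsb hsa k _
      · exact horb b a hbb haa hb1 ha1 (fun S h1 h2 => hgen S h2 h1) _ (hab' x) w
  obtain ⟨_, ⟨h1, ⟨v, rfl⟩, h3⟩, huniq⟩ := key
  refine ⟨v, ⟨fun h => h1 (by rw [h]), h3⟩, ?_⟩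
  rintro w ⟨hw, hw'⟩
  exact outer_inj (huniq (outer w) ⟨fun h => hw (outer_inj h), ⟨w, rfl⟩, hw'⟩)

/-! ### The Brauer monoid -/

/-- The product of two Brauer diagrams is their concatenation, `P` above `Q`. -/
instance [Finite X] : Mul (BrauerDiagram X) :=
  ⟨fun P Q => ⟨concat P.rel Q.rel, concat_pairs P Q⟩⟩

/-- The identity diagram joins `x` in the top row with `x'` in the bottom row. -/
instance : One (BrauerDiagram X) :=
  ⟨⟨Setoid.ker (Sum.elim id id), by
    rintro (x | x)
    · refine ⟨Sum.inr x, ⟨by simp, rfl⟩, ?_⟩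
      rintro (y | y) ⟨h1, h2⟩
      · exact absurd (congrArg Sum.inl h2.symm) h1
      · exact congrArg Sum.inr h2.symm
    · refine ⟨Sum.inl x, ⟨by simp, rfl⟩, ?_⟩
      rintro (y | y) ⟨h1, h2⟩
      · exact congrArg Sum.inl h2.symm
      · exact absurd (congrArg Sum.inr h2.symm) h1⟩⟩

theorem mul_rel [Finite X] (P Q : BrauerDiagram X) : (P * Q).rel = concat P.rel Q.rel := rfl

theorem one_rel_iff (u v : X ⊕ X) :
    (1 : BrauerDiagram X).rel u v ↔ Sum.elim id id u = Sum.elim id id v := Iff.rfl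

/-- One half of associativity; the other half follows because both sides are Brauer diagrams. -/
theorem concat_assoc_le (P Q R : Setoid (X ⊕ X)) :
    concat P (concat Q R) ≤ concat (concat P Q) R := by
  let K := stack (concat P Q) R
  -- four rows; the invariant of a vertex is the set of vertices of rows 1, 3, 4 connected to it
  let F : X ⊕ X ⊕ X ⊕ X → Set (X ⊕ X ⊕ X) := fun u =>
    {w | (∃ (t : X ⊕ X ⊕ X) (x : X ⊕ X), u = Sum.map id (Sum.map id Sum.inl) t ∧
        stack P Q t (outer x) ∧ K (upper x) w) ∨
      ∃ y, u = Sum.inr (Sum.inr (Sum.inr y)) ∧ K (Sum.inr (Sum.inr y)) w}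
  let e3 : X ⊕ X ⊕ X → X ⊕ X ⊕ X ⊕ X := Sum.map id (Sum.map id Sum.inl)
  have he3 : Function.Injective e3 := Function.Injective.sumMap Function.injective_id
    (Function.Injective.sumMap Function.injective_id Sum.inl_injective)
  have hF3 : ∀ t w, w ∈ F (e3 t) ↔ ∃ x, stack P Q t (outer x) ∧ K (upper x) w := by
    intro t w
    constructor
    · rintro (⟨t', x, h, h1, h2⟩ | ⟨y, h, -⟩)
      · obtain rfl := he3 h
        exact ⟨x, h1, h2⟩
      · rcases t with t | t | t <;> simp [e3] at h
    · rintro ⟨x, h1, h2⟩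
      exact Or.inl ⟨t, x, rfl, h1, h2⟩
  have hFo : ∀ x w, w ∈ F (e3 (outer x)) ↔ K (upper x) w := by
    intro x w
    rw [hF3]
    constructor
    · rintro ⟨y, h1, h2⟩
      exact Setoid.trans' _ (stack_upper h1) h2
    · intro h
      exact ⟨x, Setoid.refl' _ _, h⟩
  have hF4 : ∀ y w, w ∈ F (Sum.inr (Sum.inr (Sum.inr y))) ↔ K (Sum.inr (Sum.inr y)) w := by
    intro y w
    constructor
    · rintro (⟨t, x, h, -, -⟩ | ⟨y', h, h2⟩)
      · rcases t with t | t | t <;> simp at h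
      · simp only [Sum.inr.injEq] at h
        subst h
        exact h2
    · intro h
      exact Or.inr ⟨y, rfl, h⟩
  have hstack : ∀ s t, stack P Q s t → F (e3 s) = F (e3 t) := by
    intro s t h
    ext w
    rw [hF3, hF3]
    exact ⟨fun ⟨x, h1, h2⟩ => ⟨x, Setoid.trans' _ (Setoid.symm' _ h) h1, h2⟩,
      fun ⟨x, h1, h2⟩ => ⟨x, Setoid.trans' _ h h1, h2⟩⟩
  have hlow : ∀ z w, w ∈ F (Sum.inr (Sum.inr z)) ↔ K (lower z) w := by
    rintro (z | z) w
    · exact hFo (Sum.inr z) w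
    · exact hF4 z w
  have hR : ∀ z z', R z z' → F (Sum.inr (Sum.inr z)) = F (Sum.inr (Sum.inr z')) := by
    intro z z' h
    ext w
    rw [hlow, hlow]
    have h' : K (lower z) (lower z') := stack_lower h
    exact ⟨fun h1 => Setoid.trans' _ (Setoid.symm' _ h') h1, fun h1 => Setoid.trans' _ h' h1⟩
  -- rows 2, 3, 4
  have hQR : stack Q R ≤ Setoid.ker (fun s => F (Sum.inr s)) := by
    apply stack_le
    · intro x y h
      have h' := hstack _ _ (stack_lower (P := P) h)
      rcases x with x | x <;> rcases y with y | y <;> exact h'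
    · intro x y h
      exact hR x y h
  -- rows 1, 2, 4
  have hPQR : stack P (concat Q R) ≤
      Setoid.ker (fun s => F (Sum.map id (Sum.map id Sum.inr) s)) := by
    apply stack_le
    · intro x y h
      have h' := hstack _ _ (stack_upper (Q := Q) h)
      rcases x with x | x <;> rcases y with y | y <;> exact h'
    · intro x y h
      have h' := hQR h
      rcases x with x | x <;> rcases y with y | y <;> exact h'
  have hout : ∀ x w, w ∈ F (Sum.map id (Sum.map id Sum.inr) (outer x)) ↔ K (outer x) w := by
    rintro (x | x) w
    · exact hFo (Sum.inl x) w
    · exact hF4 x w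
  intro x y h
  have h' : F (Sum.map id (Sum.map id Sum.inr) (outer x)) =
      F (Sum.map id (Sum.map id Sum.inr) (outer y)) := hPQR h
  have hy := (hout y (outer y)).2 (Setoid.refl' _ _)
  rw [← h', hout] at hy
  exact hy

/-- The Brauer monoid on a finite set `X`. -/
instance [Finite X] : Monoid (BrauerDiagram X) where
  mul_assoc P Q R := (ext_of_le (concat_assoc_le P.rel Q.rel R.rel)).symm
  one_mul P := by
    refine (ext_of_le ?_).symm
    have h : ∀ u, stack (1 : BrauerDiagram X).rel P.rel (outer u) (lower u) := by
      rintro (x | x)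
      · exact stack_upper (u := Sum.inl x) (v := Sum.inr x) rfl
      · exact Setoid.refl' _ _
    intro u v huv
    change stack (1 : BrauerDiagram X).rel P.rel (outer u) (outer v)
    exact Setoid.trans' _ (h u) (Setoid.trans' _ (stack_lower huv) (Setoid.symm' _ (h v)))
  mul_one P := by
    refine (ext_of_le ?_).symm
    have h : ∀ u, stack P.rel (1 : BrauerDiagram X).rel (outer u) (upper u) := by
      rintro (x | x)
      · exact Setoid.refl' _ _
      · exact stack_lower (u := Sum.inr x) (v := Sum.inl x) rfl
    intro u v huv
    change stack P.rel (1 : BrauerDiagram X).rel (outer u) (outer v)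
    exact Setoid.trans' _ (h u) (Setoid.trans' _ (stack_upper huv) (Setoid.symm' _ (h v)))

/-- The Brauer diagram whose blocks are `{u, f u}`, for a fixed-point-free involution `f`. -/
def ofInvolution (f : X ⊕ X → X ⊕ X) (hf : ∀ u, f (f u) = u) (hne : ∀ u, f u ≠ u) :
    BrauerDiagram X where
  rel :=
    { r := fun u v => v = u ∨ v = f u
      iseqv :=
        { refl := fun _ => Or.inl rfl
          symm := by
            rintro u v (rfl | rfl)
            · exact Or.inl rfl
            · exact Or.inr (hf u).symm
          trans := by
            rintro u v w (rfl | rfl) (rfl | rfl)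
            · exact Or.inl rfl
            · exact Or.inr rfl
            · exact Or.inr rfl
            · exact Or.inl (hf u) } }
  pairs u := ⟨f u, ⟨hne u, Or.inr rfl⟩, fun _ h => h.2.resolve_left h.1⟩

theorem ofInvolution_rel_iff (f : X ⊕ X → X ⊕ X) (hf : ∀ u, f (f u) = u) (hne : ∀ u, f u ≠ u)
    (u v : X ⊕ X) : (ofInvolution f hf hne).rel u v ↔ v = u ∨ v = f u := Iff.rfl

end BrauerDiagram

/-! ## The type B Brauer monoid -/

namespace BrauerB

/-- The set `{1, …, n} ∪ {1̄, …, n̄}`: `(k, false)` is the number `k + 1` and `(k, true)` is its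
barred version. -/
abbrev Vertex (n : ℕ) : Type := Fin n × Bool

/-- The swap of `k` and `k̄`. -/
def bar {n : ℕ} (v : Vertex n) : Vertex n := (v.1, !v.2)

/-- The type B Brauer monoid: the Brauer diagrams on `{1, …, n} ∪ {1̄, …, n̄}` that are invariant
under swapping `k` and `k̄` in both rows. -/
def typeB (n : ℕ) : Submonoid (BrauerDiagram (Vertex n)) where
  carrier := {P | ∀ u v, P.rel u v → P.rel (Sum.map bar bar u) (Sum.map bar bar v)}
  one_mem' := by
    rintro (u | u) (v | v) h <;> exact congrArg bar h
  mul_mem' := by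
    intro P Q hP hQ u v h
    have key : BrauerDiagram.stack P.rel Q.rel ≤
        (BrauerDiagram.stack P.rel Q.rel).comap (Sum.map bar (Sum.map bar bar)) := by
      apply BrauerDiagram.stack_le
      · intro x y hxy
        have h' := BrauerDiagram.stack_upper (Q := Q.rel) (hP x y hxy)
        rcases x with x | x <;> rcases y with y | y <;> exact h'
      · intro x y hxy
        exact BrauerDiagram.stack_lower (P := P.rel) (hQ x y hxy)
    have h' := key h
    rcases u with u | u <;> rcases v with v | v <;> exact h'

/-- The `i`-th Coxeter generator as a permutation of the vertices: for `i = 0` it exchanges `1` and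
`1̄`; for `i ≥ 1` it exchanges `i` with `i + 1` and `ī` with the barred `i + 1`. -/
def reflect {n : ℕ} (i : Fin n) (v : Vertex n) : Vertex n :=
  if (i : ℕ) = 0 then (if v.1 = i then bar v else v)
  else (Equiv.swap (⟨i - 1, by omega⟩ : Fin n) i v.1, v.2)

theorem reflect_reflect {n : ℕ} (i : Fin n) (v : Vertex n) : reflect i (reflect i v) = v := by
  obtain ⟨a, b⟩ := v
  by_cases hi : (i : ℕ) = 0
  · by_cases ha : a = i <;> simp [reflect, bar, hi, ha]
  · simp [reflect, hi]

theorem reflect_bar {n : ℕ} (i : Fin n) (v : Vertex n) : reflect i (bar v) = bar (reflect i v) := by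
  obtain ⟨a, b⟩ := v
  by_cases hi : (i : ℕ) = 0
  · by_cases ha : a = i <;> simp [reflect, bar, hi, ha]
  · simp [reflect, bar, hi]

theorem bar_injective {n : ℕ} : Function.Injective (bar : Vertex n → Vertex n) := by
  rintro ⟨a, b⟩ ⟨c, d⟩ h
  simpa [bar] using h

/-- `crossing i` joins `v` in the top row with `reflect i v` in the bottom row, and vice versa. -/
def crossing {n : ℕ} (i : Fin n) : Vertex n ⊕ Vertex n → Vertex n ⊕ Vertex n :=
  Sum.elim (fun v => Sum.inr (reflect i v)) (fun v => Sum.inl (reflect i v))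

/-- `capCup i` joins `v` with `reflect i v` in the same row, when these two are different, and joins
`v` in the top row with `v` in the bottom row otherwise. -/
def capCup {n : ℕ} (i : Fin n) : Vertex n ⊕ Vertex n → Vertex n ⊕ Vertex n :=
  Sum.elim (fun v => if reflect i v = v then Sum.inr v else Sum.inl (reflect i v))
    (fun v => if reflect i v = v then Sum.inl v else Sum.inr (reflect i v))

theorem crossing_crossing {n : ℕ} (i : Fin n) (u : Vertex n ⊕ Vertex n) :
    crossing i (crossing i u) = u := by
  rcases u with u | u <;> simp [crossing, reflect_reflect]

theorem crossing_ne {n : ℕ} (i : Fin n) (u : Vertex n ⊕ Vertex n) : crossing i u ≠ u := by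
  rcases u with u | u <;> simp [crossing]

theorem crossing_bar {n : ℕ} (i : Fin n) (u : Vertex n ⊕ Vertex n) :
    crossing i (Sum.map bar bar u) = Sum.map bar bar (crossing i u) := by
  rcases u with u | u <;> simp [crossing, reflect_bar]

theorem capCup_capCup {n : ℕ} (i : Fin n) (u : Vertex n ⊕ Vertex n) :
    capCup i (capCup i u) = u := by
  rcases u with u | u <;> by_cases h : reflect i u = u <;> simp [capCup, h, reflect_reflect, eq_comm (a := u)]

theorem capCup_ne {n : ℕ} (i : Fin n) (u : Vertex n ⊕ Vertex n) : capCup i u ≠ u := by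
  rcases u with u | u <;> by_cases h : reflect i u = u <;> simp [capCup, h]

theorem capCup_bar {n : ℕ} (i : Fin n) (u : Vertex n ⊕ Vertex n) :
    capCup i (Sum.map bar bar u) = Sum.map bar bar (capCup i u) := by
  rcases u with u | u <;> by_cases h : reflect i u = u <;>
    simp [capCup, reflect_bar, h, bar_injective.eq_iff]

/-- The Coxeter generator of index `i` as an element of the type B Brauer monoid. -/
def sGen {n : ℕ} (i : Fin n) : typeB n :=
  ⟨BrauerDiagram.ofInvolution (crossing i) (crossing_crossing i) (crossing_ne i), by
    rintro u v (rfl | rfl)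
    · exact Or.inl rfl
    · exact Or.inr (crossing_bar i u).symm⟩

/-- The Brauer-type generator of index `i`: for `i = 0` it has the blocks `{1, 1̄}` and `{1', 1̄'}`,
for `i ≥ 1` the blocks `{i, i + 1}`, `{i', (i + 1)'}` and their barred versions; all other
blocks are vertical, `{v, v'}`. -/
def tGen {n : ℕ} (i : Fin n) : typeB n :=
  ⟨BrauerDiagram.ofInvolution (capCup i) (capCup_capCup i) (capCup_ne i), by
    rintro u v (rfl | rfl)
    · exact Or.inl rfl
    · exact Or.inr (capCup_bar i u).symm⟩

end BrauerB

/-! ## Singular Artin relations -/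

namespace SingularArtin

/-- The generators: `s i` is the regular one (`σ_i`) and `t i` the singular one (`τ_i`). -/
inductive Gen (S : Type*) where
  | s (i : S) : Gen S
  | t (i : S) : Gen S

variable {S : Type*}

/-- The regular generator `σ_i` as a word. -/
def σ (i : S) : FreeMonoid (Gen S) := FreeMonoid.of (Gen.s i)

/-- The singular generator `τ_i` as a word. -/
def τ (i : S) : FreeMonoid (Gen S) := FreeMonoid.of (Gen.t i)

/-- The alternating word `σ_i σ_j σ_i ⋯` with `k` factors. -/
def alt : S → S → ℕ → FreeMonoid (Gen S)
  | _, _, 0 => 1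
  | i, j, k + 1 => σ i * alt j i k

/-- The defining relations of the singular Artin monoid of a Coxeter matrix `M` (the value `0` of
`M` stands for `∞`). The alternating words in the relations `mixed_odd` and `mixed_even` have
`M i j` factors in total. -/
inductive Rel (M : CoxeterMatrix S) : FreeMonoid (Gen S) → FreeMonoid (Gen S) → Prop
  | braid (i j : S) (hij : i ≠ j) (hM : M i j ≠ 0) :
      Rel M (alt i j (M i j)) (alt j i (M i j))
  | mixed_odd (i j : S) (hij : i ≠ j) (hM : Odd (M i j)) :
      Rel M (τ i * alt j i (M i j - 1)) (alt j i (M i j - 1) * τ j)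
  | mixed_even (i j : S) (hij : i ≠ j) (hM : M i j ≠ 0) (hE : Even (M i j)) :
      Rel M (τ i * alt j i (M i j - 1)) (alt j i (M i j - 1) * τ i)
  | comm (i j : S) (hM : M i j = 2) : Rel M (τ i * τ j) (τ j * τ i)
  | self (i : S) : Rel M (τ i * σ i) (σ i * τ i)

end SingularArtin

namespace BrauerB

open SingularArtin (σ τ)

/-- The Coxeter matrix of type `B_n` with nodes `0, …, n - 1`: the edge between `0` and `1` is
labelled `4`, the edges between `i` and `i + 1` with `i ≥ 1` are labelled `3`. -/
def coxeterB (n : ℕ) : CoxeterMatrix (Fin n) where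
  M := Matrix.of fun i j =>
    if i = j then 1
    else if (i : ℕ) + 1 = j ∨ (j : ℕ) + 1 = i then
      (if (i : ℕ) = 0 ∨ (j : ℕ) = 0 then 4 else 3)
    else 2
  isSymm := by
    ext i j
    simp only [Matrix.transpose_apply, Matrix.of_apply, eq_comm (a := j) (b := i),
      or_comm (a := (j : ℕ) + 1 = i), or_comm (a := (j : ℕ) = 0)]
  diagonal i := by simp
  off_diagonal i j h := by
    simp only [Matrix.of_apply, h, if_false]
    split_ifs <;> decide

/-- The relations in the presentation of the type B Brauer monoid. -/
inductive Rel (n : ℕ) :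
    FreeMonoid (SingularArtin.Gen (Fin n)) → FreeMonoid (SingularArtin.Gen (Fin n)) → Prop
  /-- the relations of the singular Artin monoid of type B -/
  | artin (u v : FreeMonoid (SingularArtin.Gen (Fin n)))
      (h : SingularArtin.Rel (coxeterB n) u v) : Rel n u v
  /-- the regular generators are involutions -/
  | s_sq (i : Fin n) : Rel n (σ i * σ i) 1
  /- the type A Brauer relations, with all indices positive -/
  | t_sq (i : Fin n) (hi : 0 < (i : ℕ)) : Rel n (τ i * τ i) (τ i)
  | t_s (i : Fin n) (hi : 0 < (i : ℕ)) : Rel n (τ i * σ i) (τ i)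
  | s_t (i : Fin n) (hi : 0 < (i : ℕ)) : Rel n (σ i * τ i) (τ i)
  | t_t_s (i j : Fin n) (hi : 0 < (i : ℕ)) (hj : 0 < (j : ℕ))
      (hij : (j : ℕ) = i + 1 ∨ (i : ℕ) = j + 1) : Rel n (τ i * τ j * σ i) (τ i * σ j)
  | s_t_t (i j : Fin n) (hi : 0 < (i : ℕ)) (hj : 0 < (j : ℕ))
      (hij : (j : ℕ) = i + 1 ∨ (i : ℕ) = j + 1) : Rel n (σ i * τ j * τ i) (σ j * τ i)
  /- the additional relations: `a` is the index `0` and `b` is the index `1` -/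
  | t0_sq (a : Fin n) (ha : (a : ℕ) = 0) : Rel n (τ a * τ a) (τ a)
  | t1_t0_t1 (a b : Fin n) (ha : (a : ℕ) = 0) (hb : (b : ℕ) = 1) :
      Rel n (τ b * τ a * τ b) (τ b)
  | t1_s0_t1 (a b : Fin n) (ha : (a : ℕ) = 0) (hb : (b : ℕ) = 1) :
      Rel n (τ b * σ a * τ b) (τ b)
  | t0_t1_t0 (a b : Fin n) (ha : (a : ℕ) = 0) (hb : (b : ℕ) = 1) :
      Rel n (τ a * τ b * τ a) (τ a * σ b * τ a)
  | s1_t0_s1_t0 (a b : Fin n) (ha : (a : ℕ) = 0) (hb : (b : ℕ) = 1) :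
      Rel n (σ b * τ a * σ b * τ a) (τ a * σ b * τ a)
  | t0_s1_t0_s1 (a b : Fin n) (ha : (a : ℕ) = 0) (hb : (b : ℕ) = 1) :
      Rel n (τ a * σ b * τ a * σ b) (τ a * σ b * τ a)
  | t1_t0 (a b : Fin n) (ha : (a : ℕ) = 0) (hb : (b : ℕ) = 1) :
      Rel n (τ b * τ a) (τ b * σ b * τ a * σ b)
  | t0_t1 (a b : Fin n) (ha : (a : ℕ) = 0) (hb : (b : ℕ) = 1) :
      Rel n (τ a * τ b) (σ b * τ a * σ b * τ b)
  | t0_s0 (a : Fin n) (ha : (a : ℕ) = 0) : Rel n (τ a * σ a) (τ a)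
  | s0_t0 (a : Fin n) (ha : (a : ℕ) = 0) : Rel n (σ a * τ a) (τ a)

end BrauerB

/-!
The isomorphism is the homomorphism `toDiagram` from the presented monoid to the diagrams. All the
work on both sides takes place in one abstract setting, a `CapSystem`: a monoid with a homomorphism
`perm` from the hyperoctahedral group (the permutations of the vertices that commute with `bar`) and
with an element `cap u v` for every pair of vertices, standing for the diagram that joins `u` with `v`
and `bar u` with `bar v` in both rows and is vertical elsewhere. The axioms are the relations between
these elements that hold for diagrams (`diagramCapSystem`), and they imply the relations of the
presentation (`CapSystem.lift_gen_eq`), so that `toDiagram` exists.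

Conversely the presented monoid is a cap system (`presCapSystem`). The map `perm` exists because the
generators `σ i` satisfy the Coxeter relations of type `B`, and these present the hyperoctahedral
group: the submonoid generated by the pairs `(σ i, simple i)` is the graph of a homomorphism
(`IsCoxeterB.hom`), by descent along the cosets of the parabolic subgroups of type `B`. The element
`cap u v` is a conjugate of a generator `τ i`. It does not depend on the conjugating permutation
(`carries_of_apply`), because the pointwise stabilizer of a pair of vertices is generated by
reflections whose images commute with the singular generator; up to conjugation this is the
stabilizer of the last vertices, and there `IsCoxeterB.hom_comm` applies. The axioms then need
checking for one choice of vertices only, where each is a defining relation or follows from a few of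
them.

In every cap system, consider the products `capProd a * perm w * fullProd c`. Here `a` and `c` are
patterns, that is, `bar`-invariant systems of disjoint caps in one row, `w` is a signed permutation
that carries the free vertices of `c` to those of `a`, and `fullProd c` is the product of the caps of
`c`, preceded by the symmetric caps `{v, bar v}` at all vertices of `c`. The symmetric caps absorb
every permutation of the capped vertices (`perm_mul_fullProd`), so that the product depends only on
`a`, `c` and the values of `w` at the free vertices of `c` (`normalForm_eq`). These products are
closed under right multiplication by `perm` and `cap` (`hasForm_mul_perm`, `hasForm_mul_cap`), hence
every element of the presented monoid is one of them (`hasForm_pres`). In the monoid of diagrams, `a`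
and `c` are the horizontal blocks of the two rows and `w` gives the vertical blocks, so that distinct
data give distinct diagrams (`normalForm_injective`) and every diagram arises (`exists_normalForm`).
Therefore `toDiagram` is bijective.
-/

namespace BrauerB

open SingularArtin (σ τ)

/-! ### Signed permutations and their reflections -/

@[simp] theorem bar_bar {n : ℕ} (v : Vertex n) : bar (bar v) = v := by simp [bar]

@[simp] theorem bar_fst {n : ℕ} (v : Vertex n) : (bar v).1 = v.1 := rfl

theorem bar_ne {n : ℕ} (v : Vertex n) : bar v ≠ v := by
  intro h
  have := congrArg Prod.snd h
  simp [bar] at this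

theorem fst_eq_iff {n : ℕ} {u v : Vertex n} : u.1 = v.1 ↔ u = v ∨ u = bar v := by
  obtain ⟨a, b⟩ := u
  obtain ⟨c, d⟩ := v
  constructor
  · rintro rfl
    cases b <;> cases d <;> simp [bar]
  · rintro (h | h)
    · rw [h]
    · rw [h]; rfl

/-- The hyperoctahedral group: the permutations of the vertices that commute with `bar`. -/
def signed (n : ℕ) : Subgroup (Equiv.Perm (Vertex n)) where
  carrier := {w | ∀ v, w (bar v) = bar (w v)}
  mul_mem' := by
    intro a b ha hb v
    rw [Equiv.Perm.mul_apply, hb, ha]; rfl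
  one_mem' := fun _ => rfl
  inv_mem' := by
    intro a ha v
    rw [Equiv.Perm.inv_eq_iff_eq, ha]
    exact congrArg bar (Equiv.apply_symm_apply a v).symm

instance {n : ℕ} : CoeFun (signed n) (fun _ => Vertex n → Vertex n) := ⟨fun w => (w : Equiv.Perm _)⟩

section signed

variable {n : ℕ}

theorem signed_bar (w : signed n) (v : Vertex n) : w (bar v) = bar (w v) := w.2 v

@[simp] theorem signed_mul_apply (w g : signed n) (v : Vertex n) : (w * g) v = w (g v) := rfl

@[simp] theorem signed_one_apply (v : Vertex n) : (1 : signed n) v = v := rfl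

@[simp] theorem signed_inv_apply_self (w : signed n) (v : Vertex n) : w⁻¹ (w v) = v :=
  Equiv.symm_apply_apply _ _

@[simp] theorem signed_apply_inv_self (w : signed n) (v : Vertex n) : w (w⁻¹ v) = v :=
  Equiv.apply_symm_apply _ _

theorem signed_injective (w : signed n) : Function.Injective w :=
  (w : Equiv.Perm (Vertex n)).injective

@[simp] theorem signed_inj (w : signed n) {u v : Vertex n} : w u = w v ↔ u = v :=
  (signed_injective w).eq_iff

theorem signed_ext {w g : signed n} (h : ∀ v, w v = g v) : w = g :=
  Subtype.ext (Equiv.ext h)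

theorem signed_ext_pos {w g : signed n} (h : ∀ k, w (k, false) = g (k, false)) : w = g := by
  apply signed_ext
  rintro ⟨k, b⟩
  cases b
  · exact h k
  · have := congrArg bar (h k)
    rwa [← signed_bar, ← signed_bar] at this

theorem signed_fst_eq_iff (w : signed n) {u v : Vertex n} : (w u).1 = (w v).1 ↔ u.1 = v.1 := by
  rw [fst_eq_iff, fst_eq_iff, ← signed_bar, signed_inj, signed_inj]

/-- The map that exchanges `u` with `v` and `bar u` with `bar v`. -/
def exchFun (u v x : Vertex n) : Vertex n :=
  if x = u then v else if x = v then u else if x = bar u then bar v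
  else if x = bar v then bar u else x

theorem exchFun_exchFun (u v x : Vertex n) : exchFun u v (exchFun u v x) = x := by
  have hu := bar_ne u
  have hv := bar_ne v
  have := bar_bar u
  have := bar_bar v
  unfold exchFun
  grind

theorem exchFun_bar (u v x : Vertex n) : exchFun u v (bar x) = bar (exchFun u v x) := by
  have hu := bar_ne u
  have hv := bar_ne v
  have := bar_bar u
  have := bar_bar v
  have := bar_bar x
  unfold exchFun
  grind

/-- The signed permutation that exchanges `u` with `v` and `bar u` with `bar v`. It is the identity
for `u = v`, a sign change for `v = bar u`, and otherwise a reflection in a long root. -/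
def exch (u v : Vertex n) : signed n :=
  ⟨⟨exchFun u v, exchFun u v, exchFun_exchFun u v, exchFun_exchFun u v⟩, exchFun_bar u v⟩

theorem exch_apply (u v x : Vertex n) : exch u v x = exchFun u v x := rfl

@[simp] theorem exch_left (u v : Vertex n) : exch u v u = v := by simp [exch_apply, exchFun]

@[simp] theorem exch_right (u v : Vertex n) : exch u v v = u := by
  rw [exch_apply, exchFun]
  grind

theorem exch_of_fst_ne {u v x : Vertex n} (h1 : x.1 ≠ u.1) (h2 : x.1 ≠ v.1) :
    exch u v x = x := by
  rw [Ne, fst_eq_iff] at h1 h2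
  rw [exch_apply, exchFun]
  grind

theorem exch_of_ne {u v x : Vertex n} (h1 : x ≠ u) (h2 : x ≠ v) (h3 : x ≠ bar u)
    (h4 : x ≠ bar v) : exch u v x = x := by
  simp [exch_apply, exchFun, *]

theorem exch_symm (u v : Vertex n) : exch u v = exch v u := by
  apply signed_ext
  intro x
  have hu := bar_ne u
  have hv := bar_ne v
  rw [exch_apply, exch_apply, exchFun, exchFun]
  grind

theorem exch_bar (u v : Vertex n) : exch (bar u) (bar v) = exch u v := by
  apply signed_ext
  intro x
  have hu := bar_ne u
  have hv := bar_ne v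
  have := bar_bar u
  have := bar_bar v
  rw [exch_apply, exch_apply, exchFun, exchFun]
  grind

@[simp] theorem exch_self (u : Vertex n) : exch u u = 1 := by
  apply signed_ext
  intro x
  rw [exch_apply, exchFun, signed_one_apply]
  grind

@[simp] theorem exch_mul_self (u v : Vertex n) : exch u v * exch u v = 1 :=
  signed_ext (exchFun_exchFun u v)

@[simp] theorem exch_exch (u v x : Vertex n) : exch u v (exch u v x) = x := exchFun_exchFun u v x

@[simp] theorem exch_inv (u v : Vertex n) : (exch u v)⁻¹ = exch u v :=
  inv_eq_of_mul_eq_one_left (exch_mul_self u v)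

theorem signed_mul_exch (w : signed n) (u v : Vertex n) : w * exch u v = exch (w u) (w v) * w := by
  apply signed_ext
  intro x
  rw [signed_mul_apply, signed_mul_apply, exch_apply, exch_apply, exchFun, exchFun]
  simp only [← signed_bar, signed_inj]
  split_ifs <;> rfl

/-- The hyperoctahedral group acts transitively on the families of vertices in distinct
`bar`-orbits. -/
theorem exists_signed {I : Type*} [Finite I] (f g : I → Vertex n)
    (hf : Function.Injective fun i => (f i).1) (hg : Function.Injective fun i => (g i).1) :
    ∃ w : signed n, ∀ i, w (f i) = g i := by
  classical
  have := Fintype.ofFinite I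
  suffices H : ∀ s : Finset I, ∃ w : signed n, ∀ i ∈ s, w (f i) = g i by
    obtain ⟨w, hw⟩ := H Finset.univ
    exact ⟨w, fun i => hw i (Finset.mem_univ i)⟩
  intro s
  induction s using Finset.induction_on with
  | empty => exact ⟨1, by simp⟩
  | insert j s hj ih =>
    obtain ⟨w, hw⟩ := ih
    refine ⟨exch (w (f j)) (g j) * w, ?_⟩
    intro i hi
    rw [signed_mul_apply]
    rcases Finset.mem_insert.1 hi with rfl | hi
    · exact exch_left _ _
    · have hij : i ≠ j := fun h => hj (h ▸ hi)
      rw [hw i hi]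
      apply exch_of_fst_ne
      · rw [← hw i hi, Ne, signed_fst_eq_iff]
        exact fun h => hij (hf h)
      · exact fun h => hij (hg h)

/-- A signed permutation that fixes every vertex outside `S` is a product of the elements
`exch u v` with `u` and `v` in `S`. -/
theorem signed_induction {C : signed n → Prop} (S : Vertex n → Prop) (one : C 1)
    (mul : ∀ u v h, S u → S v → C h → C (exch u v * h)) (h : signed n)
    (hS : ∀ x, ¬ S x → h x = x) : C h := by
  classical
  obtain ⟨k, hk⟩ : ∃ k, k = (Finset.univ.filter fun x => h x ≠ x).card := ⟨_, rfl⟩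
  induction k using Nat.strong_induction_on generalizing h with
  | _ k ih =>
    by_cases hx : ∃ x, h x ≠ x
    · obtain ⟨x, hx⟩ := hx
      have hSx : S x := by
        by_contra hc
        exact hx (hS x hc)
      have hShx : S (h x) := by
        by_contra hc
        exact hx (signed_injective h (hS _ hc))
      -- composing with the exchange of `h x` and `x` fixes `x` and creates no new moved vertex
      have hfix : ∀ y, h y = y → (exch x (h x) * h) y = y := by
        intro y hy
        rw [signed_mul_apply, hy]
        have h1 : y ≠ x := by rintro rfl; exact hx hy
        have h2 : y ≠ h x := by
          rintro rfl; exact hx (signed_injective h hy)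
        have h3 : y ≠ bar x := by
          rintro rfl
          rw [signed_bar] at hy
          exact hx (bar_injective hy)
        have h4 : y ≠ bar (h x) := by
          rintro rfl
          rw [← signed_bar, signed_inj, signed_bar] at hy
          exact hx (bar_injective hy)
        exact exch_of_ne h1 h2 h3 h4
      have key : C (exch x (h x) * h) := by
        refine ih _ ?_ (exch x (h x) * h) (fun y hy => hfix y (hS y hy)) rfl
        rw [hk]
        apply Finset.card_lt_card
        refine Finset.ssubset_iff_subset_ne.2 ⟨?_, ?_⟩
        · intro y
          simp only [Finset.mem_filter, Finset.mem_univ, true_and]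
          exact fun h1 h2 => h1 (hfix y h2)
        · intro heq
          have : x ∈ Finset.univ.filter fun x => h x ≠ x := by simpa using hx
          rw [← heq, Finset.mem_filter] at this
          apply this.2
          rw [signed_mul_apply, exch_right]
      have := mul x (h x) _ hSx hShx key
      rwa [← mul_assoc, exch_mul_self, one_mul] at this
    · push Not at hx
      rw [signed_ext (g := 1) hx]
      exact one

/-! ### The simple reflections -/

/-- The first of the two vertices that the `i`-th simple reflection exchanges. -/
def lo (i : Fin n) : Vertex n :=
  if (i : ℕ) = 0 then (i, true) else (⟨i - 1, by omega⟩, false)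

/-- The second of the two vertices that the `i`-th simple reflection exchanges. -/
def hi (i : Fin n) : Vertex n := (i, false)

/-- The `i`-th simple reflection of the hyperoctahedral group. -/
def simple (i : Fin n) : signed n := exch (lo i) (hi i)

theorem lo_zero {i : Fin n} (h : (i : ℕ) = 0) : lo i = bar (hi i) := by
  simp [lo, hi, bar, h]

theorem lo_pos {i : Fin n} (h : 0 < (i : ℕ)) : lo i = (⟨i - 1, by omega⟩, false) := by
  simp [lo, h.ne']

theorem lo_ne_hi (i : Fin n) : lo i ≠ hi i := by
  by_cases h : (i : ℕ) = 0
  · rw [lo_zero h]; exact bar_ne _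
  · simp [lo, hi, h, Fin.ext_iff]; omega

theorem simple_apply (i : Fin n) (v : Vertex n) : simple i v = reflect i v := by
  obtain ⟨a, b⟩ := v
  rw [simple, exch_apply, exchFun, reflect]
  by_cases h : (i : ℕ) = 0
  · simp only [lo_zero h, hi, h, if_true, bar]
    cases b <;> by_cases ha : a = i <;> simp [ha]
  · simp only [lo, hi, h, if_false, bar, Equiv.swap_apply_def]
    cases b <;> simp <;> split_ifs <;> simp_all

theorem simple_mul_self (i : Fin n) : simple i * simple i = 1 := exch_mul_self _ _

@[simp] theorem simple_simple (i : Fin n) (v : Vertex n) : simple i (simple i v) = v :=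
  exch_exch _ _ _

@[simp] theorem simple_lo (i : Fin n) : simple i (lo i) = hi i := exch_left _ _

@[simp] theorem simple_hi (i : Fin n) : simple i (hi i) = lo i := exch_right _ _

theorem lo_fst (i : Fin n) : ((lo i).1 : ℕ) = i - 1 := by
  unfold lo; split_ifs with h <;> simp [h]

theorem hi_fst (i : Fin n) : (hi i).1 = i := rfl

/-- The `i`-th simple reflection moves only the indices `i - 1` and `i`. -/
theorem simple_of_ne {i : Fin n} {v : Vertex n} (h1 : (v.1 : ℕ) ≠ i) (h2 : (v.1 : ℕ) + 1 ≠ i) :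
    simple i v = v := by
  by_cases hi0 : (i : ℕ) = 0
  · rw [simple_apply]
    simp [reflect, hi0, Fin.ext_iff]
    intro h; omega
  · refine exch_of_fst_ne ?_ ?_
    · intro h; have := congrArg Fin.val h; rw [lo_fst] at this; omega
    · intro h; have := congrArg Fin.val h; rw [hi_fst] at this; omega

theorem simple_comm {i j : Fin n} (h : (i : ℕ) + 1 < j) :
    simple i * simple j = simple j * simple i := by
  have h1 : simple i (lo j) = lo j := by
    apply simple_of_ne <;> rw [lo_fst] <;> omega
  have h2 : simple i (hi j) = hi j := by
    apply simple_of_ne <;> rw [hi_fst] <;> omega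
  rw [simple, simple, signed_mul_exch, ← simple, ← simple, h1, h2]
  rfl

theorem hi_eq_lo {i j : Fin n} (h : (j : ℕ) = i + 1) : hi i = lo j := by
  rw [lo_pos (by omega), hi]; simp [h]

theorem simple_succ_lo {i j : Fin n} (h0 : 0 < (i : ℕ)) (h : (j : ℕ) = i + 1) :
    simple j (lo i) = lo i := by
  apply simple_of_ne <;> rw [lo_fst] <;> omega

theorem simple_pred_hi {i j : Fin n} (h : (j : ℕ) = i + 1) :
    simple i (hi j) = hi j := by
  apply simple_of_ne <;> rw [hi_fst] <;> omega

theorem simple_mul_simple_mul_simple (i j : Fin n) :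
    simple i * simple j * simple i = exch (simple i (lo j)) (simple i (hi j)) := by
  rw [simple.eq_def j, signed_mul_exch, mul_assoc, simple_mul_self, mul_one]

theorem simple_conj_succ {i j : Fin n} (h : (j : ℕ) = i + 1) :
    simple i * simple j * simple i = exch (lo i) (hi j) := by
  rw [simple_mul_simple_mul_simple, ← hi_eq_lo h, simple_hi, simple_pred_hi h]

theorem simple_conj_pred {i j : Fin n} (h0 : 0 < (i : ℕ)) (h : (j : ℕ) = i + 1) :
    simple j * simple i * simple j = exch (lo i) (hi j) := by
  rw [simple_mul_simple_mul_simple, hi_eq_lo h, simple_lo, simple_succ_lo h0 h]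

theorem simple_braid_three {i j : Fin n} (h0 : 0 < (i : ℕ)) (h : (j : ℕ) = i + 1) :
    simple i * simple j * simple i = simple j * simple i * simple j := by
  rw [simple_conj_succ h, simple_conj_pred h0 h]

theorem simple_braid_four {i j : Fin n} (h0 : (i : ℕ) = 0) (h : (j : ℕ) = 1) :
    simple i * simple j * simple i * simple j = simple j * simple i * simple j * simple i := by
  have hj : (j : ℕ) = i + 1 := by omega
  have e1 := simple_conj_succ hj
  have e2 : simple j * exch (lo i) (hi j) = exch (lo i) (hi j) * simple j := by
    have h1 : simple j (lo i) = bar (hi j) := by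
      rw [lo_zero h0, signed_bar, hi_eq_lo hj, simple_lo]
    have h2 : simple j (hi j) = bar (lo i) := by
      rw [lo_zero h0, bar_bar, hi_eq_lo hj, simple_hi]
    rw [signed_mul_exch, h1, h2, exch_bar, exch_symm]
  rw [e1, ← e2, ← e1]
  simp only [mul_assoc]

end signed

/-! ### The Coxeter presentation of the hyperoctahedral group -/

/-- The relations of the Coxeter group of type `B_n` for the first `n` terms of a sequence of
elements of a monoid. -/
structure IsCoxeterB {K : Type*} [Monoid K] (n : ℕ) (g : ℕ → K) : Prop where
  sq : ∀ i < n, g i * g i = 1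
  comm : ∀ i j, i + 1 < j → j < n → g i * g j = g j * g i
  three : ∀ i, 0 < i → i + 1 < n → g i * g (i + 1) * g i = g (i + 1) * g i * g (i + 1)
  four : 1 < n → g 0 * g 1 * g 0 * g 1 = g 1 * g 0 * g 1 * g 0

/-- The `p`-th letter `|m - p|` of the word `m, m - 1, …, 1, 0, 1, …, m`. -/
def letter (m p : ℕ) : ℕ := (m - p) + (p - m)

/-- The prefix of length `p` of the word `g_m ⋯ g_1 g_0 g_1 ⋯ g_m`; these prefixes represent the
cosets of the subgroup of type `B_m` in the group of type `B_{m+1}`. -/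
def cosetRep {K : Type*} [Monoid K] (g : ℕ → K) (m : ℕ) : ℕ → K
  | 0 => 1
  | p + 1 => cosetRep g m p * g (letter m p)

/-- The submonoid generated by the first `m` terms of a sequence. -/
def firstClosure {K : Type*} [Monoid K] (g : ℕ → K) (m : ℕ) : Submonoid K :=
  Submonoid.closure {x | ∃ i < m, x = g i}

section

variable {K : Type*} [Monoid K] {n : ℕ} {g : ℕ → K}

theorem mem_firstClosure {m i : ℕ} (h : i < m) : g i ∈ firstClosure g m :=
  Submonoid.subset_closure ⟨i, h, rfl⟩

theorem firstClosure_mono {m k : ℕ} (h : m ≤ k) : firstClosure g m ≤ firstClosure g k :=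
  Submonoid.closure_mono fun _ ⟨i, hi, e⟩ => ⟨i, hi.trans_le h, e⟩

/-- A generator that neither lengthens nor shortens the coset representative can be moved through
it. -/
theorem IsCoxeterB.cosetRep_mul_of_ne (hg : IsCoxeterB n g) {m : ℕ} (hm : m < n) (p : ℕ)
    (hp : p ≤ 2 * m + 1) (i : ℕ) (hi : i ≤ m) (h1 : i ≠ letter m p)
    (h2 : p = 0 ∨ i ≠ letter m (p - 1)) :
    ∃ j < m, cosetRep g m p * g i = g j * cosetRep g m p := by
  induction p using Nat.strong_induction_on generalizing i with
  | _ p ih =>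
    match p, hp, h1, h2, ih with
    | 0, _, h1, _, _ =>
      exact ⟨i, by simp only [letter] at h1; omega, by simp [cosetRep]⟩
    | p + 1, hp, h1, h2, ih =>
      simp only [Nat.add_sub_cancel] at h2
      replace h2 := h2.resolve_left (by omega)
      have hl : letter m p ≤ m := by simp only [letter]; omega
      by_cases hfar : i + 1 < letter m p ∨ letter m p + 1 < i
      · obtain ⟨j, hj, e⟩ := ih p (by omega) (by omega) i hi h2
          (by simp only [letter] at *; omega)
        have hc : g (letter m p) * g i = g i * g (letter m p) := by
          rcases hfar with h | h
          · exact (hg.comm _ _ h (by omega)).symm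
          · exact hg.comm _ _ h (by omega)
        refine ⟨j, hj, ?_⟩
        rw [cosetRep, mul_assoc, hc, ← mul_assoc, e, mul_assoc]
      · obtain ⟨q, rfl⟩ : ∃ q, p = q + 1 :=
          ⟨p - 1, by simp only [letter] at *; omega⟩
        have hi' : i = letter m q := by simp only [letter] at *; omega
        by_cases hi0 : i = 0
        · -- the letters of the word next to the middle letter `0` give the relation of length four
          have hq : q = m := by simp only [letter] at *; omega
          obtain ⟨r, rfl⟩ : ∃ r, q = r + 1 := ⟨q - 1, by omega⟩
          have e1 : letter m (r + 1 + 1) = 1 := by simp only [letter]; omega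
          have e0 : letter m (r + 1) = 0 := by simp only [letter]; omega
          have e2 : letter m r = 1 := by simp only [letter]; omega
          obtain ⟨j, hj, e⟩ := ih r (by omega) (by omega) 0 (by omega) (by omega)
            (by simp only [letter] at *; omega)
          refine ⟨j, hj, ?_⟩
          have h4 := hg.four (by omega)
          simp only [cosetRep, e0, e1, e2, hi0]
          simp only [mul_assoc] at h4 ⊢
          rw [← h4, ← mul_assoc, e]
          simp only [mul_assoc]
        · obtain ⟨j, hj, e⟩ := ih q (by omega) (by omega) (letter m (q + 1)) hl
            (by simp only [letter] at *; omega) (by simp only [letter] at *; omega)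
          refine ⟨j, hj, ?_⟩
          have h3 : g i * g (letter m (q + 1)) * g i
              = g (letter m (q + 1)) * g i * g (letter m (q + 1)) := by
            rcases Nat.lt_or_gt_of_ne h2 with h | h
            · have : letter m (q + 1) = i + 1 := by omega
              rw [this]
              exact hg.three i (by omega) (by omega)
            · have h0 : letter m (q + 1) ≠ 0 := by simp only [letter] at *; omega
              have : i = letter m (q + 1) + 1 := by omega
              rw [this]
              exact (hg.three _ (by omega) (by omega)).symm
          rw [cosetRep, cosetRep, ← hi', mul_assoc, mul_assoc, ← mul_assoc (g i), h3, ← mul_assoc,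
            ← mul_assoc, e]
          simp only [mul_assoc]

theorem IsCoxeterB.exists_cosetRep_mul (hg : IsCoxeterB n g) {m : ℕ} (hm : m < n) {p : ℕ}
    (hp : p ≤ 2 * m + 1) {i : ℕ} (hi : i ≤ m) :
    ∃ q ≤ 2 * m + 1, ∃ h ∈ firstClosure g m, cosetRep g m p * g i = h * cosetRep g m q := by
  by_cases h1 : i = letter m p
  · refine ⟨p + 1, by simp only [letter] at h1; omega, 1, one_mem _, ?_⟩
    rw [one_mul, h1]; rfl
  · by_cases h2 : p = 0 ∨ i ≠ letter m (p - 1)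
    · obtain ⟨j, hj, e⟩ := hg.cosetRep_mul_of_ne hm p hp i hi h1 h2
      exact ⟨p, hp, g j, mem_firstClosure hj, e⟩
    · push Not at h2
      obtain ⟨q, rfl⟩ : ∃ q, p = q + 1 := ⟨p - 1, by omega⟩
      refine ⟨q, by omega, 1, one_mem _, ?_⟩
      rw [Nat.add_sub_cancel] at h2
      rw [cosetRep, ← h2.2, mul_assoc, hg.sq i (by omega), mul_one, one_mul]

/-- The prefixes of the word `g_m ⋯ g_1 g_0 g_1 ⋯ g_m` represent all cosets, by the relations
alone. -/
theorem IsCoxeterB.exists_eq_mul_cosetRep (hg : IsCoxeterB n g) {m : ℕ} (hm : m < n) {x : K}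
    (hx : x ∈ firstClosure g (m + 1)) :
    ∃ p ≤ 2 * m + 1, ∃ h ∈ firstClosure g m, x = h * cosetRep g m p := by
  induction hx using Submonoid.closure_induction_right with
  | one => exact ⟨0, by omega, 1, one_mem _, by simp [cosetRep]⟩
  | mul_right x _ y hy ih =>
    obtain ⟨p, hp, h, hh, rfl⟩ := ih
    obtain ⟨i, hi, rfl⟩ := hy
    obtain ⟨q, hq, h', hh', e⟩ := hg.exists_cosetRep_mul hm hp (i := i) (by omega)
    exact ⟨q, hq, h * h', mul_mem hh hh', by rw [mul_assoc, e, mul_assoc]⟩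

theorem cosetRep_mem (m p : ℕ) (hp : p ≤ 2 * m + 1) : cosetRep g m p ∈ firstClosure g (m + 1) := by
  induction p with
  | zero => exact one_mem _
  | succ p ih =>
    refine mul_mem (ih (by omega)) (mem_firstClosure ?_)
    simp only [letter]; omega

theorem IsCoxeterB.exists_inverse (hg : IsCoxeterB n g) {m : ℕ} (hm : m ≤ n) {x : K}
    (hx : x ∈ firstClosure g m) : ∃ y ∈ firstClosure g m, x * y = 1 ∧ y * x = 1 := by
  induction hx using Submonoid.closure_induction with
  | mem x hx =>
    obtain ⟨i, hi, rfl⟩ := hx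
    exact ⟨g i, mem_firstClosure hi, hg.sq i (by omega), hg.sq i (by omega)⟩
  | one => exact ⟨1, one_mem _, one_mul _, one_mul _⟩
  | mul x y _ _ hx hy =>
    obtain ⟨x', hx', h1, h2⟩ := hx
    obtain ⟨y', hy', h3, h4⟩ := hy
    refine ⟨y' * x', mul_mem hy' hx', ?_, ?_⟩
    · rw [mul_assoc, ← mul_assoc y, h3, one_mul, h1]
    · rw [mul_assoc, ← mul_assoc x', h2, one_mul, h4]

end

section graph

variable {M : Type*} [Monoid M] {n : ℕ} {s : ℕ → M}

/-- The simple reflections as a sequence, continued by `1`. -/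
def simpleSeq (n i : ℕ) : signed n := if h : i < n then simple ⟨i, h⟩ else 1

theorem simpleSeq_fin (i : Fin n) : simpleSeq n i = simple i := by simp [simpleSeq]

theorem isCoxeterB_simpleSeq (n : ℕ) : IsCoxeterB n (simpleSeq n) where
  sq i hi := by
    simp only [simpleSeq, hi, dif_pos]
    exact simple_mul_self _
  comm i j hij hj := by
    have hi : i < n := by omega
    simp only [simpleSeq, hi, hj, dif_pos]
    exact simple_comm hij
  three i h0 h := by
    have hi : i < n := by omega
    simp only [simpleSeq, hi, h, dif_pos]
    exact simple_braid_three h0 rfl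
  four h := by
    have h0 : 0 < n := by omega
    simp only [simpleSeq, h0, h, dif_pos]
    exact simple_braid_four rfl rfl

/-- The pairs `(s i, simple i)`; the submonoid that they generate will turn out to be the graph of
a homomorphism from the hyperoctahedral group. -/
def graphSeq (n : ℕ) (s : ℕ → M) (i : ℕ) : M × signed n := (s i, simpleSeq n i)

theorem IsCoxeterB.graphSeq (hs : IsCoxeterB n s) : IsCoxeterB n (graphSeq n s) where
  sq i hi := Prod.ext (hs.sq i hi) ((isCoxeterB_simpleSeq n).sq i hi)
  comm i j h1 h2 := Prod.ext (hs.comm i j h1 h2) ((isCoxeterB_simpleSeq n).comm i j h1 h2)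
  three i h1 h2 := Prod.ext (hs.three i h1 h2) ((isCoxeterB_simpleSeq n).three i h1 h2)
  four h := Prod.ext (hs.four h) ((isCoxeterB_simpleSeq n).four h)

/-- The vertex that the `p`-th coset representative moves to `(m, false)`. -/
def pathVertex {m : ℕ} (hm : m < n) (p : ℕ) : Vertex n :=
  if p ≤ m then (⟨m - p, by omega⟩, false) else (⟨(p - m - 1) % n, Nat.mod_lt _ (by omega)⟩, true)

theorem simpleSeq_pathVertex {m : ℕ} (hm : m < n) {p : ℕ} (hp : p ≤ 2 * m) :
    simpleSeq n (letter m p) (pathVertex hm (p + 1)) = pathVertex hm p := by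
  have hl : letter m p < n := by simp only [letter]; omega
  simp only [simpleSeq, hl, dif_pos, simple_apply, reflect]
  rcases lt_trichotomy p m with h | h | h
  · have h1 : letter m p = m - p := by simp only [letter]; omega
    have h2 : m - p ≠ 0 := by omega
    have h3 : p + 1 ≤ m := by omega
    simp only [h1, h2, pathVertex, h.le, h3, if_true, if_false]
    have : (⟨m - (p + 1), by omega⟩ : Fin n) = ⟨m - p - 1, by omega⟩ := by
      simp only [Fin.mk.injEq]; omega
    rw [this, Equiv.swap_apply_left]
  · subst h
    have h1 : letter p p = 0 := by simp only [letter]; omega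
    simp [h1, pathVertex, bar]
  · have h1 : letter m p = p - m := by simp only [letter]; omega
    have h2 : p - m ≠ 0 := by omega
    have h3 : ¬ p + 1 ≤ m := by omega
    have h4 : ¬ p ≤ m := by omega
    have h5 : p + 1 - m - 1 = p - m := by omega
    have h6 : (p - m) % n = p - m := Nat.mod_eq_of_lt (by omega)
    have h7 : (p - m - 1) % n = p - m - 1 := Nat.mod_eq_of_lt (by omega)
    simp only [h1, h2, pathVertex, h3, h4, if_false, h5, h6, h7]
    rw [Equiv.swap_apply_right]

theorem cosetRep_pathVertex {m : ℕ} (hm : m < n) {p : ℕ} (hp : p ≤ 2 * m + 1) :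
    (cosetRep (graphSeq n s) m p).2 (pathVertex hm p) = (⟨m, hm⟩, false) := by
  induction p with
  | zero => simp [cosetRep, pathVertex]
  | succ p ih =>
    rw [cosetRep, Prod.snd_mul, signed_mul_apply]
    have := simpleSeq_pathVertex hm (p := p) (by omega)
    rw [graphSeq]
    rw [this, ih (by omega)]

theorem pathVertex_surjective {m : ℕ} (hm : m < n) (v : Vertex n) (hv : (v.1 : ℕ) ≤ m) :
    ∃ p ≤ 2 * m + 1, pathVertex hm p = v := by
  obtain ⟨k, b⟩ := v
  cases b
  · refine ⟨m - k, by omega, ?_⟩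
    have h : m - (k : ℕ) ≤ m := by omega
    have h' : m - (m - (k : ℕ)) = k := by simp only at hv; omega
    simp [pathVertex, h']
  · simp only at hv
    refine ⟨m + 1 + k, by omega, ?_⟩
    have h : ¬ m + 1 + (k : ℕ) ≤ m := by omega
    have h' : m + 1 + (k : ℕ) - m - 1 = k := by omega
    simp only [pathVertex, h, h', if_false]
    simp [Nat.mod_eq_of_lt]

theorem firstClosure_fixes {m : ℕ} {x : M × signed n}
    (hx : x ∈ firstClosure (graphSeq n s) m) (v : Vertex n) (hv : m ≤ v.1) : x.2 v = v := by
  induction hx using Submonoid.closure_induction with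
  | mem x hx =>
    obtain ⟨i, hi, rfl⟩ := hx
    have : i < n := by have := v.1.2; omega
    simp only [graphSeq, simpleSeq, this, dif_pos]
    apply simple_of_ne <;> simp only <;> omega
  | one => rfl
  | mul x y _ _ hx hy => rw [Prod.snd_mul, signed_mul_apply, hy, hx]

/-- Descent along the chain of subgroups: an element of the graph that fixes the last vertices lies
in the part of the graph that is generated by the first generators. -/
theorem IsCoxeterB.mem_firstClosure_of_fixes (hs : IsCoxeterB n s) {m k : ℕ} (hk : m + k ≤ n)
    {x : M × signed n} (hx : x ∈ firstClosure (BrauerB.graphSeq n s) (m + k))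
    (hfix : ∀ j : Fin n, m ≤ j → x.2 (j, false) = (j, false)) :
    x ∈ firstClosure (BrauerB.graphSeq n s) m := by
  induction k with
  | zero => exact hx
  | succ k ih =>
    apply ih (by omega)
    have hm : m + k < n := by omega
    obtain ⟨p, hp, h, hh, rfl⟩ := hs.graphSeq.exists_eq_mul_cosetRep hm hx
    have h1 := hfix ⟨m + k, hm⟩ (by simp)
    rw [Prod.snd_mul, signed_mul_apply] at h1
    have h2 : (cosetRep (BrauerB.graphSeq n s) (m + k) p).2 (⟨m + k, hm⟩, false)
        = (⟨m + k, hm⟩, false) := by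
      apply signed_injective h.2
      rw [h1, firstClosure_fixes hh _ (le_refl _)]
    rw [← cosetRep_pathVertex (s := s) hm hp, signed_inj, cosetRep_pathVertex hm hp] at h2
    have h3 : p = 0 := by
      unfold pathVertex at h2
      split_ifs at h2 with h
      · simp at h2; omega
      · simp at h2
    subst h3
    simpa [cosetRep] using hh

/-- The graph is everywhere defined over the signed permutations that fix the vertices from `m`
on. -/
theorem IsCoxeterB.exists_mem_firstClosure (hs : IsCoxeterB n s) {m : ℕ} (hm : m ≤ n) (w : signed n)
    (hfix : ∀ j : Fin n, m ≤ j → w (j, false) = (j, false)) :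
    ∃ x, (x, w) ∈ firstClosure (BrauerB.graphSeq n s) m := by
  induction m generalizing w with
  | zero =>
    have : w = 1 := signed_ext_pos fun k => hfix k (Nat.zero_le _)
    exact ⟨1, this ▸ one_mem _⟩
  | succ m ih =>
    have hm' : m < n := hm
    have key : ∀ v : Vertex n, m + 1 ≤ v.1 → w v = v := by
      rintro ⟨j, b⟩ hj
      cases b
      · exact hfix j hj
      · have := congrArg bar (hfix j hj)
        rwa [← signed_bar] at this
    have hv : ((w (⟨m, hm'⟩, false)).1 : ℕ) ≤ m := by
      by_contra hc
      have h1 := key _ (not_le.1 hc)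
      rw [signed_inj] at h1
      exact hc (congrArg (fun v : Vertex n => (v.1 : ℕ)) h1).le
    -- `w` followed by a suitable coset representative fixes one more vertex
    obtain ⟨p, hp, e⟩ := pathVertex_surjective hm' _ hv
    have hc := cosetRep_mem (g := BrauerB.graphSeq n s) m p hp
    obtain ⟨y, hy, -, hyc⟩ := hs.graphSeq.exists_inverse hm hc
    obtain ⟨x, hx⟩ := ih (by omega) ((cosetRep (BrauerB.graphSeq n s) m p).2 * w) (by
      intro j hj
      rw [signed_mul_apply]
      rcases Nat.eq_or_lt_of_le hj with h | h
      · have : j = ⟨m, hm'⟩ := Fin.ext h.symm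
        rw [this, ← e, cosetRep_pathVertex hm' hp]
      · rw [hfix j h]
        exact firstClosure_fixes hc _ h)
    refine ⟨y.1 * x, ?_⟩
    have := mul_mem hy (firstClosure_mono (Nat.le_succ m) hx)
    convert this using 1
    have h2 := congrArg Prod.snd hyc
    refine Prod.ext rfl ?_
    rw [Prod.snd_mul, ← mul_assoc]
    rw [Prod.snd_mul] at h2
    rw [h2]
    exact (one_mul w).symm

/-- The submonoid generated by the pairs `(s i, simple i)` is single-valued over the hyperoctahedral
group. -/
theorem IsCoxeterB.graph_unique (hs : IsCoxeterB n s) {x y : M} {w : signed n}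
    (hx : (x, w) ∈ firstClosure (BrauerB.graphSeq n s) n)
    (hy : (y, w) ∈ firstClosure (BrauerB.graphSeq n s) n) : x = y := by
  obtain ⟨z, hz, h1, h2⟩ := hs.graphSeq.exists_inverse le_rfl hy
  have h3 : (x, w) * z ∈ firstClosure (BrauerB.graphSeq n s) 0 := by
    refine hs.mem_firstClosure_of_fixes (k := n) (by omega) (by rw [zero_add]; exact mul_mem hx hz) ?_
    intro j _
    have := congrArg Prod.snd h1
    rw [Prod.snd_mul] at this ⊢
    exact congrArg (fun w : signed n => w (j, false)) this
  have h4 : (x, w) * z = 1 := by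
    have : firstClosure (BrauerB.graphSeq n s) 0 = ⊥ := by
      rw [firstClosure, ← Submonoid.closure_empty]
      congr 1
      ext; simp
    rw [this, Submonoid.mem_bot] at h3
    exact h3
  have h5 : (x, w) = (y, w) := by
    calc (x, w) = (x, w) * (z * (y, w)) := by rw [h2, mul_one]
      _ = (y, w) := by rw [← mul_assoc, h4, one_mul]
  exact congrArg Prod.fst h5

theorem IsCoxeterB.exists_graph (hs : IsCoxeterB n s) (w : signed n) :
    ∃ x, (x, w) ∈ firstClosure (BrauerB.graphSeq n s) n :=
  hs.exists_mem_firstClosure le_rfl w fun j hj => absurd j.2 (by omega)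

/-- The homomorphism from the hyperoctahedral group that extends a sequence of elements with the
Coxeter relations of type `B`. -/
noncomputable def IsCoxeterB.hom (hs : IsCoxeterB n s) : signed n →* M where
  toFun w := (hs.exists_graph w).choose
  map_one' := hs.graph_unique (hs.exists_graph 1).choose_spec (one_mem _)
  map_mul' w g := hs.graph_unique (hs.exists_graph (w * g)).choose_spec
    (mul_mem (hs.exists_graph w).choose_spec (hs.exists_graph g).choose_spec)

theorem IsCoxeterB.hom_mem (hs : IsCoxeterB n s) (w : signed n) :
    (hs.hom w, w) ∈ firstClosure (BrauerB.graphSeq n s) n :=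
  (hs.exists_graph w).choose_spec

theorem IsCoxeterB.hom_simple (hs : IsCoxeterB n s) (i : Fin n) : hs.hom (simple i) = s i := by
  refine hs.graph_unique (hs.hom_mem _) ?_
  rw [← simpleSeq_fin]
  exact mem_firstClosure i.2

/-- The image of a signed permutation that fixes the vertices from `m` on commutes with everything
that commutes with the first `m` generators. -/
theorem IsCoxeterB.hom_comm (hs : IsCoxeterB n s) {m : ℕ} (hm : m ≤ n) {w : signed n}
    (hfix : ∀ j : Fin n, m ≤ j → w (j, false) = (j, false)) {t : M}
    (ht : ∀ i < m, s i * t = t * s i) : hs.hom w * t = t * hs.hom w := by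
  have h : (hs.hom w, w) ∈ firstClosure (BrauerB.graphSeq n s) m := by
    refine hs.mem_firstClosure_of_fixes (k := n - m) (by omega) ?_ hfix
    rw [Nat.add_sub_cancel' hm]
    exact hs.hom_mem w
  suffices H : ∀ x ∈ firstClosure (BrauerB.graphSeq n s) m, x.1 * t = t * x.1 from H _ h
  intro x hx
  induction hx using Submonoid.closure_induction with
  | mem x hx =>
    obtain ⟨i, hi, rfl⟩ := hx
    exact ht i hi
  | one => simp
  | mul x y _ _ hx hy => rw [Prod.fst_mul, mul_assoc, hy, ← mul_assoc, hx, mul_assoc]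

/-- The simple reflections generate the hyperoctahedral group. -/
theorem mem_firstClosure_simpleSeq (w : signed n) : w ∈ firstClosure (simpleSeq n) n := by
  obtain ⟨x, hx⟩ := (isCoxeterB_simpleSeq n).exists_graph w
  suffices H : ∀ x ∈ firstClosure (graphSeq n (simpleSeq n)) n, x.2 ∈ firstClosure (simpleSeq n) n
    from H _ hx
  intro x hx
  induction hx using Submonoid.closure_induction with
  | mem x hx =>
    obtain ⟨i, hi, rfl⟩ := hx
    exact mem_firstClosure hi
  | one => exact one_mem _
  | mul x y _ _ hx hy => exact mul_mem hx hy

theorem signed_hom_ext {f g : signed n →* M} (h : ∀ i, f (simple i) = g (simple i)) : f = g := by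
  ext w
  induction mem_firstClosure_simpleSeq w using Submonoid.closure_induction with
  | mem x hx =>
    obtain ⟨i, hi, rfl⟩ := hx
    simp only [simpleSeq, hi, dif_pos, h]
  | one => rw [map_one, map_one]
  | mul x y _ _ hx hy => rw [map_mul, map_mul, hx, hy]

end graph

/-! ### Cap systems -/

/-- The data and the relations on which the structure of the type B Brauer monoid rests: signed
permutations `perm w`, and elements `cap u v` that stand for the diagram with the blocks `{u, v}`,
`{bar u, bar v}` in both rows and vertical blocks elsewhere. For `v = bar u` this is a single
symmetric block, and `cap u u` is `1` by convention. -/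
structure CapSystem (n : ℕ) (M : Type*) [Monoid M] where
  /-- The homomorphism from the hyperoctahedral group. -/
  perm : signed n →* M
  /-- The element that caps `u` with `v` and `bar u` with `bar v`. -/
  cap : Vertex n → Vertex n → M
  perm_mul_cap : ∀ w u v, perm w * cap u v = cap (w u) (w v) * perm w
  cap_self : ∀ u, cap u u = 1
  cap_symm : ∀ u v, cap u v = cap v u
  cap_bar : ∀ u v, cap (bar u) (bar v) = cap u v
  cap_idem : ∀ u v, cap u v * cap u v = cap u v
  perm_exch_mul_cap : ∀ u v, perm (exch u v) * cap u v = cap u v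
  cap_mul_cap : ∀ x y z, x.1 ≠ y.1 → y.1 ≠ z.1 →
    cap x y * cap y z = perm (exch x z) * cap y z
  cap_comm : ∀ x y u v, x.1 ≠ u.1 → x.1 ≠ v.1 → y.1 ≠ u.1 → y.1 ≠ v.1 →
    cap x y * cap u v = cap u v * cap x y
  cap_single_cap : ∀ x y, x.1 ≠ y.1 → cap x y * cap x (bar x) * cap x y = cap x y
  single_cap_single : ∀ x y, x.1 ≠ y.1 →
    cap x (bar x) * cap x y * cap x (bar x) = cap x (bar x) * cap y (bar y)
  single_single_perm : ∀ x y, x.1 ≠ y.1 →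
    cap x (bar x) * cap y (bar y) * perm (exch x y) = cap x (bar x) * cap y (bar y)
  cap_single : ∀ x y, x.1 ≠ y.1 → cap x y * cap x (bar x) = cap x y * cap y (bar y)
  single_cap : ∀ x y, x.1 ≠ y.1 → cap x (bar x) * cap x y = cap y (bar y) * cap x y

namespace CapSystem

variable {n : ℕ} {M : Type*} [Monoid M] (S : CapSystem n M)

theorem cap_mul_perm (w : signed n) (u v : Vertex n) :
    S.cap u v * S.perm w = S.perm w * S.cap (w⁻¹ u) (w⁻¹ v) := by
  rw [perm_mul_cap, signed_apply_inv_self, signed_apply_inv_self]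

theorem cap_mul_perm_exch (u v : Vertex n) : S.cap u v * S.perm (exch u v) = S.cap u v := by
  rw [cap_mul_perm, exch_inv, exch_left, exch_right, cap_symm, perm_exch_mul_cap]

theorem cap_mul_cap' {x y z : Vertex n} (h1 : x.1 ≠ y.1) (h2 : y.1 ≠ z.1) :
    S.cap x y * S.cap y z = S.cap x y * S.perm (exch x z) := by
  have hy : exch x z y = y := exch_of_fst_ne h1.symm h2
  rw [cap_mul_cap _ _ _ _ h1 h2, perm_mul_cap, hy, exch_right, cap_symm]

theorem perm_mul_self {w : signed n} (h : w * w = 1) : S.perm w * S.perm w = 1 := by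
  rw [← map_mul, h, map_one]

/-- The elements that the abstract generators stand for. -/
def gen : SingularArtin.Gen (Fin n) → M
  | .s i => S.perm (simple i)
  | .t i => S.cap (lo i) (hi i)

/-- The alternating products of simple reflections. -/
def _root_.BrauerB.altSimple : Fin n → Fin n → ℕ → signed n
  | _, _, 0 => 1
  | i, j, k + 1 => simple i * altSimple j i k

theorem lift_alt (i j : Fin n) (k : ℕ) :
    FreeMonoid.lift S.gen (SingularArtin.alt i j k) = S.perm (altSimple i j k) := by
  induction k generalizing i j with
  | zero => simp [SingularArtin.alt, altSimple]
  | succ k ih => simp [SingularArtin.alt, altSimple, ih, σ, gen]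

theorem _root_.BrauerB.coxeterB_apply (i j : Fin n) : coxeterB n i j =
    if i = j then 1
    else if (i : ℕ) + 1 = j ∨ (j : ℕ) + 1 = i then
      (if (i : ℕ) = 0 ∨ (j : ℕ) = 0 then 4 else 3)
    else 2 := rfl

theorem _root_.BrauerB.simple_comm_of_ne {i j : Fin n} (h : i ≠ j)
    (h' : ¬ ((i : ℕ) + 1 = j ∨ (j : ℕ) + 1 = i)) : simple i * simple j = simple j * simple i := by
  have : (i : ℕ) ≠ j := fun e => h (Fin.ext e)
  rcases Nat.lt_or_gt_of_ne this with h1 | h1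
  · exact simple_comm (by omega)
  · exact (simple_comm (by omega)).symm

theorem _root_.BrauerB.simple_fixes {i j : Fin n} (h : i ≠ j)
    (h' : ¬ ((i : ℕ) + 1 = j ∨ (j : ℕ) + 1 = i)) :
    simple i (lo j) = lo j ∧ simple i (hi j) = hi j := by
  have : (i : ℕ) ≠ j := fun e => h (Fin.ext e)
  constructor
  · by_cases hj : (j : ℕ) = 0
    · rw [lo_zero hj, signed_bar, simple_of_ne] <;> rw [hi_fst] <;> omega
    · apply simple_of_ne <;> rw [lo_fst] <;> omega
  · apply simple_of_ne <;> rw [hi_fst] <;> omega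

theorem _root_.BrauerB.altSimple_braid {i j : Fin n} (h : i ≠ j) :
    altSimple i j (coxeterB n i j) = altSimple j i (coxeterB n i j) := by
  rw [coxeterB_apply, if_neg h]
  split_ifs with h1 h2
  · have key : ∀ i j : Fin n, (i : ℕ) = 0 → (j : ℕ) = 1 → altSimple i j 4 = altSimple j i 4 := by
      intro i j hi hj
      have := simple_braid_four hi hj
      simpa only [altSimple, mul_one, mul_assoc] using this
    rcases h1 with h1 | h1
    · exact key i j (by omega) (by omega)
    · exact (key j i (by omega) (by omega)).symm
  · have key : ∀ i j : Fin n, 0 < (i : ℕ) → (j : ℕ) = i + 1 → altSimple i j 3 = altSimple j i 3 := by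
      intro i j hi hj
      have := simple_braid_three hi hj
      simpa only [altSimple, mul_one, mul_assoc] using this
    rcases h1 with h1 | h1
    · exact key i j (by omega) (by omega)
    · exact (key j i (by omega) (by omega)).symm
  · simpa only [altSimple, mul_one] using simple_comm_of_ne h h1

theorem cap_mul_perm_of_eq {w : signed n} {u v x y : Vertex n} (h1 : w u = x) (h2 : w v = y) :
    S.cap x y * S.perm w = S.perm w * S.cap u v := by
  rw [perm_mul_cap, h1, h2]

theorem cap_mul_perm_altSimple_odd {i j : Fin n} (hij : i ≠ j) (hM : Odd (coxeterB n i j)) :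
    S.cap (lo i) (hi i) * S.perm (altSimple j i (coxeterB n i j - 1))
      = S.perm (altSimple j i (coxeterB n i j - 1)) * S.cap (lo j) (hi j) := by
  rw [coxeterB_apply, if_neg hij] at hM ⊢
  split_ifs at hM ⊢ with h1 h2
  · exact absurd hM (by decide)
  · rcases h1 with h1 | h1
    · apply cap_mul_perm_of_eq <;> simp only [altSimple, mul_one, signed_mul_apply]
      · rw [← hi_eq_lo h1.symm, simple_hi, simple_succ_lo (by omega) h1.symm]
      · rw [simple_pred_hi h1.symm, simple_hi, ← hi_eq_lo h1.symm]
    · apply cap_mul_perm_of_eq <;> simp only [altSimple, mul_one, signed_mul_apply]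
      · rw [simple_succ_lo (by omega) h1.symm, simple_lo, hi_eq_lo h1.symm]
      · rw [hi_eq_lo h1.symm, simple_lo, simple_pred_hi h1.symm]
  · exact absurd hM (by decide)

theorem cap_mul_perm_altSimple_even {i j : Fin n} (hij : i ≠ j) (hM : Even (coxeterB n i j)) :
    S.cap (lo i) (hi i) * S.perm (altSimple j i (coxeterB n i j - 1))
      = S.perm (altSimple j i (coxeterB n i j - 1)) * S.cap (lo i) (hi i) := by
  rw [coxeterB_apply, if_neg hij] at hM ⊢
  split_ifs at hM ⊢ with h1 h2
  · rcases h1 with h1 | h1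
    · have hi0 : (i : ℕ) = 0 := by omega
      have e : (simple j * (simple i * simple j)) (hi i) = hi i := by
        simp only [signed_mul_apply]
        rw [hi_eq_lo h1.symm, simple_lo, simple_pred_hi h1.symm, simple_hi]
      apply cap_mul_perm_of_eq <;> simp only [altSimple, mul_one]
      · rw [lo_zero hi0, signed_bar, e]
      · exact e
    · have hj0 : (j : ℕ) = 0 := by omega
      have e1 : (simple j * (simple i * simple j)) (lo i) = bar (hi i) := by
        simp only [signed_mul_apply]
        rw [← hi_eq_lo h1.symm, simple_hi, lo_zero hj0, signed_bar, signed_bar, hi_eq_lo h1.symm,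
          simple_lo, simple_pred_hi h1.symm]
      have e2 : (simple j * (simple i * simple j)) (hi i) = bar (lo i) := by
        simp only [signed_mul_apply]
        rw [simple_pred_hi h1.symm, simple_hi, ← hi_eq_lo h1.symm, simple_hi, lo_zero hj0]
      simp only [altSimple, mul_one, Nat.reduceSub]
      rw [perm_mul_cap, e1, e2, cap_bar, cap_symm]
  · exact absurd hM (by decide)
  · have := simple_fixes hij.symm (fun h => h1 h.symm)
    apply cap_mul_perm_of_eq <;> simp only [altSimple, mul_one, Nat.reduceSub]
    · exact this.1
    · exact this.2

theorem cap_comm_of_coxeterB_eq_two {i j : Fin n} (hM : coxeterB n i j = 2) :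
    S.cap (lo i) (hi i) * S.cap (lo j) (hi j) = S.cap (lo j) (hi j) * S.cap (lo i) (hi i) := by
  rw [coxeterB_apply] at hM
  split_ifs at hM with h h1 <;> try omega
  have hne : (i : ℕ) ≠ j := fun e => h (Fin.ext e)
  apply S.cap_comm <;> intro e <;> have e := congrArg Fin.val e <;>
    simp only [lo_fst, hi_fst] at e <;> omega

theorem cap_cap_perm {i j : Fin n} (hi0 : 0 < (i : ℕ)) (hj0 : 0 < (j : ℕ))
    (hij : (j : ℕ) = i + 1 ∨ (i : ℕ) = j + 1) :
    S.cap (lo j) (hi j) * S.cap (lo i) (hi i)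
      = S.perm (simple i * simple j * simple i) * S.cap (lo i) (hi i) ∧
    S.cap (lo i) (hi i) * S.cap (lo j) (hi j)
      = S.cap (lo i) (hi i) * S.perm (simple i * simple j * simple i) := by
  have hne : ∀ {i j : Fin n}, 0 < (i : ℕ) → (j : ℕ) = i + 1 →
      (lo i).1 ≠ (lo j).1 ∧ (lo j).1 ≠ (hi j).1 := by
    intro i j h0 h
    refine ⟨?_, ?_⟩ <;> intro e
    · have e := congrArg Fin.val e
      simp only [lo_fst] at e; omega
    · have e := congrArg Fin.val e
      simp only [lo_fst, hi_fst] at e; omega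
  rcases hij with h | h
  · obtain ⟨h1, h2⟩ := hne hi0 h
    rw [simple_conj_succ h, hi_eq_lo h]
    constructor
    · rw [S.cap_symm (lo j), S.cap_symm (lo i), exch_symm,
        S.cap_mul_cap _ _ _ h2.symm h1.symm]
    · exact S.cap_mul_cap' h1 h2
  · obtain ⟨h1, h2⟩ := hne hj0 h
    rw [simple_conj_pred hj0 h, hi_eq_lo h]
    constructor
    · exact S.cap_mul_cap _ _ _ h1 h2
    · rw [S.cap_symm (lo j), S.cap_symm (lo i), exch_symm]
      exact S.cap_mul_cap' h2.symm h1.symm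

/-- The reflection that exchanges `x` and `y` conjugates the symmetric cap at `x` to the one
at `y`. -/
theorem perm_single_perm (x y : Vertex n) :
    S.perm (exch x y) * S.cap x (bar x) * S.perm (exch x y) = S.cap y (bar y) := by
  rw [perm_mul_cap, mul_assoc, S.perm_mul_self (exch_mul_self x y), mul_one, signed_bar, exch_left]

theorem single_comm {x y : Vertex n} (h : x.1 ≠ y.1) :
    S.cap x (bar x) * S.cap y (bar y) = S.cap y (bar y) * S.cap x (bar x) :=
  S.cap_comm _ _ _ _ h h h h

theorem perm_single_single {x y : Vertex n} (h : x.1 ≠ y.1) :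
    S.perm (exch x y) * (S.cap x (bar x) * S.cap y (bar y))
      = S.cap x (bar x) * S.cap y (bar y) := by
  rw [← mul_assoc, perm_mul_cap, mul_assoc, perm_mul_cap, ← mul_assoc, signed_bar, exch_left,
    signed_bar, exch_right, single_comm _ h.symm, single_single_perm _ _ _ h]

/-- The relations of the presentation hold in every cap system. -/
theorem lift_gen_eq {u v : FreeMonoid (SingularArtin.Gen (Fin n))} (h : Rel n u v) :
    FreeMonoid.lift S.gen u = FreeMonoid.lift S.gen v := by
  have hσ : ∀ i, FreeMonoid.lift S.gen (σ i) = S.perm (simple i) := fun i => by simp [σ, gen]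
  have hτ : ∀ i, FreeMonoid.lift S.gen (τ i) = S.cap (lo i) (hi i) := fun i => by simp [τ, gen]
  -- the configuration of the relations that involve the indices `0` and `1`
  have h01 : ∀ a b : Fin n, (a : ℕ) = 0 → (b : ℕ) = 1 → (hi a).1 ≠ (hi b).1 ∧
      S.cap (lo a) (hi a) = S.cap (hi a) (bar (hi a)) ∧ S.cap (lo b) (hi b) = S.cap (hi a) (hi b) ∧
      simple b = exch (hi a) (hi b) ∧ simple a = exch (hi a) (bar (hi a)) := by
    intro a b ha hb
    refine ⟨?_, ?_, ?_, ?_, ?_⟩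
    · rw [hi_fst, hi_fst, Ne, Fin.ext_iff]; omega
    · rw [lo_zero ha, S.cap_symm]
    · rw [hi_eq_lo (by omega : (b : ℕ) = a + 1)]
    · rw [simple, hi_eq_lo (by omega : (b : ℕ) = a + 1)]
    · rw [simple, lo_zero ha, exch_symm]
  cases h with
  | artin u v h =>
    cases h with
    | braid i j hij hM => rw [lift_alt, lift_alt, altSimple_braid hij]
    | mixed_odd i j hij hM =>
      rw [map_mul, map_mul, lift_alt, hτ, hτ, cap_mul_perm_altSimple_odd _ hij hM]
    | mixed_even i j hij hM hE =>
      rw [map_mul, map_mul, lift_alt, hτ, cap_mul_perm_altSimple_even _ hij hE]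
    | comm i j hM => rw [map_mul, map_mul, hτ, hτ, cap_comm_of_coxeterB_eq_two _ hM]
    | self i => rw [map_mul, map_mul, hσ, hτ, simple, cap_mul_perm_exch, perm_exch_mul_cap]
  | s_sq i => rw [map_mul, hσ, map_one, S.perm_mul_self (simple_mul_self i)]
  | t_sq i => rw [map_mul, hτ, cap_idem]
  | t_s i => rw [map_mul, hσ, hτ, simple, cap_mul_perm_exch]
  | s_t i => rw [map_mul, hσ, hτ, simple, perm_exch_mul_cap]
  | t_t_s i j hi0 hj0 hij =>
    simp only [map_mul, hσ, hτ]
    rw [(S.cap_cap_perm hi0 hj0 hij).2, map_mul, map_mul, mul_assoc, mul_assoc, mul_assoc,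
      S.perm_mul_self (simple_mul_self i), mul_one, ← mul_assoc, simple.eq_def i, cap_mul_perm_exch]
  | s_t_t i j hi0 hj0 hij =>
    simp only [map_mul, hσ, hτ]
    rw [mul_assoc, (S.cap_cap_perm hi0 hj0 hij).1, map_mul, map_mul, ← mul_assoc, ← mul_assoc,
      ← mul_assoc, S.perm_mul_self (simple_mul_self i), one_mul, mul_assoc, simple.eq_def i,
      perm_exch_mul_cap]
  | t0_sq a => rw [map_mul, hτ, cap_idem]
  | t1_t0_t1 a b ha hb =>
    obtain ⟨h, e1, e2, -, -⟩ := h01 a b ha hb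
    simp only [map_mul, hτ, e1, e2]
    exact S.cap_single_cap _ _ h
  | t1_s0_t1 a b ha hb =>
    obtain ⟨h, e1, e2, -, e4⟩ := h01 a b ha hb
    simp only [map_mul, hσ, hτ, e2, e4]
    have hy : exch (hi a) (bar (hi a)) (hi b) = hi b := exch_of_fst_ne h.symm h.symm
    rw [mul_assoc, perm_mul_cap, exch_left, hy, ← mul_assoc,
      S.cap_symm (bar (hi a)),
      S.cap_mul_cap _ _ (bar (hi a)) h h.symm, perm_mul_cap, hy, exch_right, mul_assoc,
      S.perm_mul_self (exch_mul_self _ _), mul_one, cap_symm]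
  | t0_t1_t0 a b ha hb =>
    obtain ⟨h, e1, e2, e3, -⟩ := h01 a b ha hb
    simp only [map_mul, hσ, hτ, e1, e2, e3]
    rw [S.single_cap_single _ _ h, mul_assoc, perm_mul_cap, ← mul_assoc, signed_bar, exch_left,
      single_single_perm _ _ _ h]
  | s1_t0_s1_t0 a b ha hb =>
    obtain ⟨h, e1, e2, e3, -⟩ := h01 a b ha hb
    simp only [map_mul, hσ, hτ, e1, e3]
    rw [perm_single_perm, mul_assoc (S.cap _ _), perm_mul_cap, ← mul_assoc, signed_bar, exch_left,
      single_single_perm _ _ _ h, single_comm _ h]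
  | t0_s1_t0_s1 a b ha hb =>
    obtain ⟨h, e1, e2, e3, -⟩ := h01 a b ha hb
    simp only [map_mul, hσ, hτ, e1, e3]
    rw [mul_assoc (S.cap _ _), perm_mul_cap, ← mul_assoc, signed_bar, exch_left,
      single_single_perm _ _ _ h, single_single_perm _ _ _ h]
  | t1_t0 a b ha hb =>
    obtain ⟨h, e1, e2, e3, -⟩ := h01 a b ha hb
    simp only [map_mul, hσ, hτ, e1, e2, e3]
    rw [mul_assoc, mul_assoc, ← mul_assoc (S.perm _), perm_single_perm, S.cap_single _ _ h]
  | t0_t1 a b ha hb =>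
    obtain ⟨h, e1, e2, e3, -⟩ := h01 a b ha hb
    simp only [map_mul, hσ, hτ, e1, e2, e3]
    rw [perm_single_perm, S.single_cap _ _ h]
  | t0_s0 a ha => rw [map_mul, hσ, hτ, simple, cap_mul_perm_exch]
  | s0_t0 a ha => rw [map_mul, hσ, hτ, simple, perm_exch_mul_cap]

end CapSystem

end BrauerB

namespace BrauerDiagram

/-! ### Paths in concatenated diagrams -/

variable {X : Type*}

/-- Two Brauer diagrams are equal if every vertex has the same partner in both. -/
theorem ext_of_common {P Q : BrauerDiagram X} (h : ∀ u, ∃ v, v ≠ u ∧ P.rel u v ∧ Q.rel u v) :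
    P = Q := by
  apply ext_of_le
  intro u v huv
  obtain ⟨w, hw, hP, hQ⟩ := h u
  by_cases e : v = u
  · subst e; exact Q.rel.refl' _
  · rw [(P.pairs u).unique ⟨e, huv⟩ ⟨hw, hP⟩]
    exact hQ

theorem rel_symm (P : BrauerDiagram X) {u v : X ⊕ X} (h : P.rel u v) : P.rel v u := P.rel.symm' h

variable [Finite X] {P Q : BrauerDiagram X}

theorem mul_rel_top {u v : X} (h : P.rel (.inl u) (.inl v)) : (P * Q).rel (.inl u) (.inl v) :=
  stack_upper (u := .inl u) (v := .inl v) h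

theorem mul_rel_bot {u v : X} (h : Q.rel (.inr u) (.inr v)) : (P * Q).rel (.inr u) (.inr v) :=
  stack_lower (u := .inr u) (v := .inr v) h

theorem mul_rel_through {u v a : X} (h1 : P.rel (.inl u) (.inr a)) (h2 : Q.rel (.inl a) (.inr v)) :
    (P * Q).rel (.inl u) (.inr v) :=
  (stack P.rel Q.rel).trans' (stack_upper h1) (stack_lower h2)

/-- A path from the top row to the top row that visits the lower diagram once. -/
theorem mul_rel_top_three {u v a b : X} (h1 : P.rel (.inl u) (.inr a))
    (h2 : Q.rel (.inl a) (.inl b)) (h3 : P.rel (.inl v) (.inr b)) :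
    (P * Q).rel (.inl u) (.inl v) :=
  (stack P.rel Q.rel).trans' (stack_upper h1) <|
    (stack P.rel Q.rel).trans' (stack_lower h2) (stack_upper (P.rel_symm h3))

/-- A path from the bottom row to the bottom row that visits the upper diagram once. -/
theorem mul_rel_bot_three {u v a b : X} (h1 : Q.rel (.inl a) (.inr u))
    (h2 : P.rel (.inr a) (.inr b)) (h3 : Q.rel (.inl b) (.inr v)) :
    (P * Q).rel (.inr u) (.inr v) :=
  (stack P.rel Q.rel).trans' (stack_lower (Q.rel_symm h1)) <|
    (stack P.rel Q.rel).trans' (stack_upper h2) (stack_lower h3)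

/-- A path from the top row to the bottom row that turns twice. -/
theorem mul_rel_through_four {u v a b c : X} (h1 : P.rel (.inl u) (.inr a))
    (h2 : Q.rel (.inl a) (.inl b)) (h3 : P.rel (.inr b) (.inr c))
    (h4 : Q.rel (.inl c) (.inr v)) : (P * Q).rel (.inl u) (.inr v) :=
  (stack P.rel Q.rel).trans' (stack_upper h1) <|
    (stack P.rel Q.rel).trans' (stack_lower h2) <|
      (stack P.rel Q.rel).trans' (stack_upper h3) (stack_lower h4)

/-- A path from the top row to the top row that visits the lower diagram twice. -/
theorem mul_rel_top_five {u v a b c d : X} (h1 : P.rel (.inl u) (.inr a))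
    (h2 : Q.rel (.inl a) (.inl b)) (h3 : P.rel (.inr b) (.inr c))
    (h4 : Q.rel (.inl c) (.inl d)) (h5 : P.rel (.inl v) (.inr d)) :
    (P * Q).rel (.inl u) (.inl v) :=
  (stack P.rel Q.rel).trans' (stack_upper h1) <|
    (stack P.rel Q.rel).trans' (stack_lower h2) <|
      (stack P.rel Q.rel).trans' (stack_upper h3) <|
        (stack P.rel Q.rel).trans' (stack_lower h4) (stack_upper (P.rel_symm h5))

/-- A path from the bottom row to the bottom row that visits the upper diagram twice. -/
theorem mul_rel_bot_five {u v a b c d : X} (h1 : Q.rel (.inl a) (.inr u))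
    (h2 : P.rel (.inr a) (.inr b)) (h3 : Q.rel (.inl b) (.inl c))
    (h4 : P.rel (.inr c) (.inr d)) (h5 : Q.rel (.inl d) (.inr v)) :
    (P * Q).rel (.inr u) (.inr v) :=
  (stack P.rel Q.rel).trans' (stack_lower (Q.rel_symm h1)) <|
    (stack P.rel Q.rel).trans' (stack_upper h2) <|
      (stack P.rel Q.rel).trans' (stack_lower h3) <|
        (stack P.rel Q.rel).trans' (stack_upper h4) (stack_lower h5)

end BrauerDiagram

namespace BrauerB

open SingularArtin (σ τ)

/-! ### The cap system of diagrams -/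

section

variable {n : ℕ}

/-- The relation of the diagram of an element of the type B Brauer monoid. -/
abbrev drel (P : typeB n) : Setoid (Vertex n ⊕ Vertex n) := (P : BrauerDiagram (Vertex n)).rel

theorem drel_bar (P : typeB n) {u v : Vertex n ⊕ Vertex n} (h : drel P u v) :
    drel P (Sum.map bar bar u) (Sum.map bar bar v) := P.2 u v h

/-- Two diagrams are equal if they have a common block at one vertex of each `bar`-orbit. -/
theorem typeB_ext {P Q : typeB n}
    (h1 : ∀ k, ∃ x : Vertex n, x.1 = k ∧ ∃ v, v ≠ .inl x ∧ drel P (.inl x) v ∧ drel Q (.inl x) v)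
    (h2 : ∀ k, ∃ x : Vertex n, x.1 = k ∧ ∃ v, v ≠ .inr x ∧ drel P (.inr x) v ∧ drel Q (.inr x) v) :
    P = Q := by
  apply Subtype.ext
  apply BrauerDiagram.ext_of_common
  have key : ∀ x : Vertex n ⊕ Vertex n, (∃ v, v ≠ x ∧ drel P x v ∧ drel Q x v) →
      ∃ v, v ≠ Sum.map bar bar x ∧ drel P (Sum.map bar bar x) v ∧ drel Q (Sum.map bar bar x) v := by
    rintro x ⟨v, hv, hP, hQ⟩
    refine ⟨Sum.map bar bar v, ?_, drel_bar P hP, drel_bar Q hQ⟩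
    intro e
    apply hv
    rcases x with x | x <;> rcases v with v | v <;> simp at e <;> rw [bar_injective e]
  rintro (u | u)
  · obtain ⟨x, hx, h⟩ := h1 u.1
    rcases fst_eq_iff.1 hx.symm with rfl | rfl
    · exact h
    · exact key _ h
  · obtain ⟨x, hx, h⟩ := h2 u.1
    rcases fst_eq_iff.1 hx.symm with rfl | rfl
    · exact h
    · exact key _ h

/-- The diagram of a signed permutation joins `w x` in the top row with `x` in the bottom row. -/
def permDiagram (w : signed n) : typeB n :=
  ⟨BrauerDiagram.ofInvolution (Sum.elim (fun x => .inr (w⁻¹ x)) (fun x => .inl (w x)))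
    (by rintro (u | u) <;> simp) (by rintro (u | u) <;> simp), by
    rintro u v (rfl | rfl)
    · exact Or.inl rfl
    · rcases u with u | u
      · exact Or.inr (congrArg Sum.inr (signed_bar w⁻¹ u).symm)
      · exact Or.inr (congrArg Sum.inl (signed_bar w u).symm)⟩

theorem permDiagram_rel (w : signed n) (x : Vertex n) :
    drel (permDiagram w) (.inl (w x)) (.inr x) := Or.inr (by simp)

theorem permDiagram_rel' (w : signed n) {x y : Vertex n} (h : w x = y) :
    drel (permDiagram w) (.inl y) (.inr x) := h ▸ permDiagram_rel w x

/-- The involution of the diagram that caps `u` with `v` and `bar u` with `bar v` in both rows. -/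
def capFun (u v : Vertex n) : Vertex n ⊕ Vertex n → Vertex n ⊕ Vertex n :=
  Sum.elim (fun x => if exch u v x = x then .inr x else .inl (exch u v x))
    (fun x => if exch u v x = x then .inl x else .inr (exch u v x))

/-- The diagram that caps `u` with `v` and `bar u` with `bar v` in both rows; the other blocks are
vertical. -/
def capDiagram (u v : Vertex n) : typeB n :=
  ⟨BrauerDiagram.ofInvolution (capFun u v)
    (by rintro (x | x) <;> by_cases h : exch u v x = x <;> simp [capFun, h, eq_comm (a := x)])
    (by rintro (x | x) <;> by_cases h : exch u v x = x <;> simp [capFun, h]), by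
    rintro x y (rfl | rfl)
    · exact Or.inl rfl
    · rcases x with x | x <;> right <;> by_cases h : exch u v x = x <;>
        simp [capFun, h, signed_bar, bar_injective.eq_iff]⟩

theorem capDiagram_vert {u v x : Vertex n} (h : exch u v x = x) :
    drel (capDiagram u v) (.inl x) (.inr x) := Or.inr (by simp [capFun, h])

theorem capDiagram_top {u v x : Vertex n} (h : exch u v x ≠ x) :
    drel (capDiagram u v) (.inl x) (.inl (exch u v x)) := Or.inr (by simp [capFun, h])

theorem capDiagram_bot {u v x : Vertex n} (h : exch u v x ≠ x) :
    drel (capDiagram u v) (.inr x) (.inr (exch u v x)) := Or.inr (by simp [capFun, h])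

theorem capDiagram_vert' {u v x : Vertex n} (h1 : x.1 ≠ u.1) (h2 : x.1 ≠ v.1) :
    drel (capDiagram u v) (.inl x) (.inr x) := capDiagram_vert (exch_of_fst_ne h1 h2)

theorem capDiagram_top' {u v : Vertex n} (h : u ≠ v) :
    drel (capDiagram u v) (.inl u) (.inl v) := by
  simpa using capDiagram_top (u := u) (v := v) (x := u) (by simpa using h.symm)

theorem capDiagram_bot' {u v : Vertex n} (h : u ≠ v) :
    drel (capDiagram u v) (.inr u) (.inr v) := by
  simpa using capDiagram_bot (u := u) (v := v) (x := u) (by simpa using h.symm)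

open BrauerDiagram

theorem drel_symm {P : typeB n} {u v : Vertex n ⊕ Vertex n} (h : drel P u v) : drel P v u :=
  Setoid.symm' _ h

theorem permDiagram_mul (w g : signed n) :
    permDiagram (w * g) = permDiagram w * permDiagram g := by
  have key : ∀ x, drel (permDiagram w * permDiagram g) (.inl (w (g x))) (.inr x) := fun x =>
    mul_rel_through (permDiagram_rel w (g x)) (permDiagram_rel g x)
  apply typeB_ext
  · intro k
    refine ⟨(k, false), rfl, .inr ((w * g)⁻¹ (k, false)), by simp,
      permDiagram_rel' _ (by rw [signed_apply_inv_self]), ?_⟩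
    convert key ((w * g)⁻¹ (k, false)) using 2
    rw [← signed_mul_apply, signed_apply_inv_self]
  · intro k
    exact ⟨(k, false), rfl, _, by simp, drel_symm (permDiagram_rel _ _), drel_symm (key _)⟩

theorem permDiagram_one : permDiagram (1 : signed n) = 1 := by
  apply typeB_ext <;> intro k
  · exact ⟨(k, false), rfl, .inr (k, false), by simp, permDiagram_rel' _ rfl, rfl⟩
  · exact ⟨(k, false), rfl, .inl (k, false), by simp, drel_symm (permDiagram_rel' _ rfl), rfl⟩

theorem capDiagram_symm (u v : Vertex n) : capDiagram u v = capDiagram v u := by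
  simp only [capDiagram, capFun, exch_symm u v]

theorem capDiagram_bar (u v : Vertex n) : capDiagram (bar u) (bar v) = capDiagram u v := by
  simp only [capDiagram, capFun, exch_bar u v]

theorem capDiagram_self (u : Vertex n) : capDiagram u u = 1 := by
  apply typeB_ext <;> intro k
  · exact ⟨(k, false), rfl, .inr (k, false), by simp, capDiagram_vert (by simp), rfl⟩
  · exact ⟨(k, false), rfl, .inl (k, false), by simp, drel_symm (capDiagram_vert (by simp)), rfl⟩

theorem permDiagram_mul_capDiagram (w : signed n) (u v : Vertex n) :
    permDiagram w * capDiagram u v = capDiagram (w u) (w v) * permDiagram w := by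
  have hw : ∀ x, exch (w u) (w v) (w x) = w (exch u v x) := fun x => by
    rw [← signed_mul_apply, ← signed_mul_exch]; rfl
  have hiff : ∀ x, exch (w u) (w v) (w x) = w x ↔ exch u v x = x := fun x => by
    rw [hw, signed_inj]
  apply typeB_ext <;> intro k
  · obtain ⟨x, hx⟩ : ∃ x, w x = (k, false) := ⟨w⁻¹ (k, false), by simp⟩
    refine ⟨w x, by rw [hx], ?_⟩
    by_cases h : exch u v x = x
    · exact ⟨.inr x, by simp, mul_rel_through (permDiagram_rel _ _) (capDiagram_vert h),
        mul_rel_through (capDiagram_vert ((hiff x).2 h)) (permDiagram_rel _ _)⟩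
    · refine ⟨.inl (w (exch u v x)), by simpa using h,
        mul_rel_top_three (permDiagram_rel _ _) (capDiagram_top h) (permDiagram_rel _ _), ?_⟩
      rw [← hw]
      exact mul_rel_top (capDiagram_top (mt (hiff x).1 h))
  · refine ⟨(k, false), rfl, ?_⟩
    by_cases h : exch u v (k, false) = (k, false)
    · exact ⟨.inl (w (k, false)), by simp,
        drel_symm (mul_rel_through (permDiagram_rel _ _) (capDiagram_vert h)),
        drel_symm (mul_rel_through (capDiagram_vert ((hiff _).2 h)) (permDiagram_rel _ _))⟩
    · refine ⟨.inr (exch u v (k, false)), by simpa using h,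
        mul_rel_bot (capDiagram_bot h), ?_⟩
      refine mul_rel_bot_three (permDiagram_rel _ _) (capDiagram_bot (mt (hiff _).1 h)) ?_
      rw [hw]
      exact permDiagram_rel _ _

theorem capDiagram_idem (u v : Vertex n) : capDiagram u v * capDiagram u v = capDiagram u v := by
  apply typeB_ext <;> intro k <;> refine ⟨(k, false), rfl, ?_⟩ <;>
    by_cases h : exch u v (k, false) = (k, false)
  · exact ⟨.inr (k, false), by simp, mul_rel_through (capDiagram_vert h) (capDiagram_vert h),
      capDiagram_vert h⟩
  · exact ⟨.inl (exch u v (k, false)), by simpa using h, mul_rel_top (capDiagram_top h),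
      capDiagram_top h⟩
  · exact ⟨.inl (k, false), by simp,
      drel_symm (mul_rel_through (capDiagram_vert h) (capDiagram_vert h)),
      drel_symm (capDiagram_vert h)⟩
  · exact ⟨.inr (exch u v (k, false)), by simpa using h, mul_rel_bot (capDiagram_bot h),
      capDiagram_bot h⟩

theorem permDiagram_exch_mul_capDiagram (u v : Vertex n) :
    permDiagram (exch u v) * capDiagram u v = capDiagram u v := by
  have hx : ∀ x, drel (permDiagram (exch u v)) (.inl x) (.inr (exch u v x)) := fun x =>
    permDiagram_rel' _ (exch_exch u v x)
  apply typeB_ext <;> intro k <;> refine ⟨(k, false), rfl, ?_⟩ <;>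
    by_cases h : exch u v (k, false) = (k, false)
  · exact ⟨.inr (k, false), by simp,
      mul_rel_through (permDiagram_rel' _ h) (capDiagram_vert h), capDiagram_vert h⟩
  · refine ⟨.inl (exch u v (k, false)), by simpa using h,
      mul_rel_top_three (hx _) ?_ (permDiagram_rel _ _), capDiagram_top h⟩
    simpa using capDiagram_top (u := u) (v := v) (x := exch u v (k, false))
      (by simpa using Ne.symm h)
  · exact ⟨.inl (k, false), by simp,
      drel_symm (mul_rel_through (permDiagram_rel' _ h) (capDiagram_vert h)),
      drel_symm (capDiagram_vert h)⟩
  · exact ⟨.inr (exch u v (k, false)), by simpa using h, mul_rel_bot (capDiagram_bot h),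
      capDiagram_bot h⟩

theorem capDiagram_mul_capDiagram {x y z : Vertex n} (hxy : x.1 ≠ y.1) (hyz : y.1 ≠ z.1) :
    capDiagram x y * capDiagram y z = permDiagram (exch x z) * capDiagram y z := by
  have nxy : x ≠ y := fun e => hxy (e ▸ rfl)
  have nyz : y ≠ z := fun e => hyz (e ▸ rfl)
  have hy : drel (permDiagram (exch x z)) (.inl y) (.inr y) :=
    permDiagram_rel' _ (exch_of_fst_ne hxy.symm hyz)
  have hx : drel (permDiagram (exch x z)) (.inl x) (.inr z) := permDiagram_rel' _ (exch_right x z)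
  have hz : drel (permDiagram (exch x z)) (.inl z) (.inr x) := permDiagram_rel' _ (exch_left x z)
  have hother : ∀ k, k ≠ x.1 → k ≠ y.1 → k ≠ z.1 →
      drel (capDiagram x y * capDiagram y z) (.inl (k, false)) (.inr (k, false)) ∧
      drel (permDiagram (exch x z) * capDiagram y z) (.inl (k, false)) (.inr (k, false)) :=
    fun k h1 h2 h3 => ⟨mul_rel_through (capDiagram_vert' h1 h2) (capDiagram_vert' h2 h3),
      mul_rel_through (permDiagram_rel' _ (exch_of_fst_ne h1 h3)) (capDiagram_vert' h2 h3)⟩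
  -- the strand from `z` at the top to `x` at the bottom
  have hstrand : x.1 ≠ z.1 →
      drel (capDiagram x y * capDiagram y z) (.inl z) (.inr x) ∧
      drel (permDiagram (exch x z) * capDiagram y z) (.inl z) (.inr x) := fun h =>
    ⟨mul_rel_through_four (capDiagram_vert' h.symm hyz.symm) (drel_symm (capDiagram_top' nyz))
      (drel_symm (capDiagram_bot' nxy)) (capDiagram_vert' hxy h),
      mul_rel_through hz (capDiagram_vert' hxy h)⟩
  have htop : drel (capDiagram x y * capDiagram y z) (.inl x) (.inl y) ∧
      drel (permDiagram (exch x z) * capDiagram y z) (.inl x) (.inl y) :=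
    ⟨mul_rel_top (capDiagram_top' nxy),
      mul_rel_top_three hx (drel_symm (capDiagram_top' nyz)) hy⟩
  apply typeB_ext <;> intro k
  · by_cases h1 : k = x.1
    · exact ⟨x, h1.symm, .inl y, by simpa using nxy.symm, htop⟩
    by_cases h2 : k = y.1
    · exact ⟨y, h2.symm, .inl x, by simpa using nxy, drel_symm htop.1, drel_symm htop.2⟩
    by_cases h3 : k = z.1
    · exact ⟨z, h3.symm, .inr x, by simp, hstrand (h3 ▸ Ne.symm h1)⟩
    exact ⟨(k, false), rfl, .inr (k, false), by simp, hother k h1 h2 h3⟩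
  · by_cases h2 : k = y.1
    · exact ⟨y, h2.symm, .inr z, by simpa using nyz.symm, mul_rel_bot (capDiagram_bot' nyz),
        mul_rel_bot (capDiagram_bot' nyz)⟩
    by_cases h3 : k = z.1
    · exact ⟨z, h3.symm, .inr y, by simpa using nyz, mul_rel_bot (drel_symm (capDiagram_bot' nyz)),
        mul_rel_bot (drel_symm (capDiagram_bot' nyz))⟩
    by_cases h1 : k = x.1
    · have h := hstrand (h1 ▸ h3)
      exact ⟨x, h1.symm, .inl z, by simp, drel_symm h.1, drel_symm h.2⟩
    have h := hother k h1 h2 h3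
    exact ⟨(k, false), rfl, .inl (k, false), by simp, drel_symm h.1, drel_symm h.2⟩

/-- The blocks of a product of two disjoint caps. -/
theorem capDiagram_mul_disjoint {x y u v : Vertex n} (h1 : x.1 ≠ u.1) (h2 : x.1 ≠ v.1)
    (h3 : y.1 ≠ u.1) (h4 : y.1 ≠ v.1) (t : Vertex n) :
    (exch x y t ≠ t → drel (capDiagram x y * capDiagram u v) (.inl t) (.inl (exch x y t)) ∧
      drel (capDiagram x y * capDiagram u v) (.inr t) (.inr (exch x y t))) ∧
    (exch u v t ≠ t → drel (capDiagram x y * capDiagram u v) (.inl t) (.inl (exch u v t)) ∧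
      drel (capDiagram x y * capDiagram u v) (.inr t) (.inr (exch u v t))) ∧
    (exch x y t = t → exch u v t = t →
      drel (capDiagram x y * capDiagram u v) (.inl t) (.inr t)) := by
  have hcomm : exch x y * exch u v = exch u v * exch x y := by
    rw [signed_mul_exch, exch_of_fst_ne h1.symm h3.symm, exch_of_fst_ne h2.symm h4.symm]
  have hc : ∀ t, exch x y (exch u v t) = exch u v (exch x y t) := fun t => by
    rw [← signed_mul_apply, hcomm]; rfl
  have hdis : exch x y t ≠ t → exch u v t = t := by
    intro h
    by_contra h'
    have a1 : t.1 = x.1 ∨ t.1 = y.1 := by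
      by_contra hh
      push Not at hh
      exact h (exch_of_fst_ne hh.1 hh.2)
    have a2 : t.1 = u.1 ∨ t.1 = v.1 := by
      by_contra hh
      push Not at hh
      exact h' (exch_of_fst_ne hh.1 hh.2)
    rcases a1 with e | e <;> rw [e] at a2 <;> rcases a2 with a2 | a2 <;> contradiction
  refine ⟨fun h => ⟨mul_rel_top (capDiagram_top h), ?_⟩, fun h => ⟨?_, mul_rel_bot
    (capDiagram_bot h)⟩, fun h h' => mul_rel_through (capDiagram_vert h) (capDiagram_vert h')⟩
  · have h' := hdis h
    exact mul_rel_bot_three (capDiagram_vert h') (capDiagram_bot h)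
      (capDiagram_vert (by rw [← hc, h']))
  · have h' : exch x y t = t := by
      by_contra hh
      exact h (hdis hh)
    exact mul_rel_top_three (capDiagram_vert h') (capDiagram_top h)
      (capDiagram_vert (by rw [hc, h']))

theorem capDiagram_comm {x y u v : Vertex n} (h1 : x.1 ≠ u.1) (h2 : x.1 ≠ v.1) (h3 : y.1 ≠ u.1)
    (h4 : y.1 ≠ v.1) :
    capDiagram x y * capDiagram u v = capDiagram u v * capDiagram x y := by
  have H := fun t => capDiagram_mul_disjoint h1 h2 h3 h4 t
  have H' := fun t => capDiagram_mul_disjoint h1.symm h3.symm h2.symm h4.symm t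
  apply typeB_ext <;> intro k <;> refine ⟨(k, false), rfl, ?_⟩ <;>
    by_cases h : exch x y (k, false) = (k, false)
  · by_cases h' : exch u v (k, false) = (k, false)
    · exact ⟨.inr (k, false), by simp, (H _).2.2 h h', (H' _).2.2 h' h⟩
    · exact ⟨_, by simpa using h', ((H _).2.1 h').1, ((H' _).1 h').1⟩
  · exact ⟨_, by simpa using h, ((H _).1 h).1, ((H' _).2.1 h).1⟩
  · by_cases h' : exch u v (k, false) = (k, false)
    · exact ⟨.inl (k, false), by simp, drel_symm ((H _).2.2 h h'), drel_symm ((H' _).2.2 h' h)⟩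
    · exact ⟨_, by simpa using h', ((H _).2.1 h').2, ((H' _).1 h').2⟩
  · exact ⟨_, by simpa using h, ((H _).1 h).2, ((H' _).2.1 h).2⟩

section two

variable {x y : Vertex n}

/-- Comparison of diagrams that are vertical outside the indices of `x` and `y`. -/
theorem typeB_ext_of_vert {P Q : typeB n}
    (hP : ∀ z : Vertex n, z.1 ≠ x.1 → z.1 ≠ y.1 → drel P (.inl z) (.inr z))
    (hQ : ∀ z : Vertex n, z.1 ≠ x.1 → z.1 ≠ y.1 → drel Q (.inl z) (.inr z))
    (hx : ∃ v, v ≠ .inl x ∧ drel P (.inl x) v ∧ drel Q (.inl x) v)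
    (hy : ∃ v, v ≠ .inl y ∧ drel P (.inl y) v ∧ drel Q (.inl y) v)
    (hx' : ∃ v, v ≠ .inr x ∧ drel P (.inr x) v ∧ drel Q (.inr x) v)
    (hy' : ∃ v, v ≠ .inr y ∧ drel P (.inr y) v ∧ drel Q (.inr y) v) : P = Q := by
  apply typeB_ext <;> intro k
  · by_cases h1 : k = x.1
    · exact ⟨x, h1.symm, hx⟩
    by_cases h2 : k = y.1
    · exact ⟨y, h2.symm, hy⟩
    exact ⟨(k, false), rfl, .inr (k, false), by simp, hP _ h1 h2, hQ _ h1 h2⟩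
  · by_cases h1 : k = x.1
    · exact ⟨x, h1.symm, hx'⟩
    by_cases h2 : k = y.1
    · exact ⟨y, h2.symm, hy'⟩
    exact ⟨(k, false), rfl, .inl (k, false), by simp, drel_symm (hP _ h1 h2),
      drel_symm (hQ _ h1 h2)⟩

theorem single_mul_single_rel (h : x.1 ≠ y.1) :
    drel (capDiagram x (bar x) * capDiagram y (bar y)) (.inl x) (.inl (bar x)) ∧
    drel (capDiagram x (bar x) * capDiagram y (bar y)) (.inl y) (.inl (bar y)) ∧
    drel (capDiagram x (bar x) * capDiagram y (bar y)) (.inr x) (.inr (bar x)) ∧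
    drel (capDiagram x (bar x) * capDiagram y (bar y)) (.inr y) (.inr (bar y)) :=
  ⟨mul_rel_top (capDiagram_top' (bar_ne x).symm),
    mul_rel_top_three (capDiagram_vert' h.symm h.symm) (capDiagram_top' (bar_ne y).symm)
      (capDiagram_vert' h.symm h.symm),
    mul_rel_bot_three (capDiagram_vert' h h) (capDiagram_bot' (bar_ne x).symm)
      (capDiagram_vert' h h),
    mul_rel_bot (capDiagram_bot' (bar_ne y).symm)⟩

theorem cap_mul_single_rel (h : x.1 ≠ y.1) :
    drel (capDiagram x y * capDiagram x (bar x)) (.inl x) (.inl y) ∧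
    drel (capDiagram x y * capDiagram x (bar x)) (.inr x) (.inr (bar x)) ∧
    drel (capDiagram x y * capDiagram x (bar x)) (.inr y) (.inr (bar y)) := by
  have hne : x ≠ y := fun e => h (e ▸ rfl)
  have hb := drel_bar _ (capDiagram_bot' hne)
  exact ⟨mul_rel_top (capDiagram_top' hne), mul_rel_bot (capDiagram_bot' (bar_ne x).symm),
    mul_rel_bot_five (capDiagram_vert' h.symm h.symm) (drel_symm (capDiagram_bot' hne))
      (capDiagram_top' (bar_ne x).symm) hb (capDiagram_vert' h.symm h.symm)⟩

theorem single_mul_cap_rel (h : x.1 ≠ y.1) :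
    drel (capDiagram x (bar x) * capDiagram x y) (.inr x) (.inr y) ∧
    drel (capDiagram x (bar x) * capDiagram x y) (.inl x) (.inl (bar x)) ∧
    drel (capDiagram x (bar x) * capDiagram x y) (.inl y) (.inl (bar y)) := by
  have hne : x ≠ y := fun e => h (e ▸ rfl)
  have hb := drel_bar _ (capDiagram_top' hne)
  exact ⟨mul_rel_bot (capDiagram_bot' hne), mul_rel_top (capDiagram_top' (bar_ne x).symm),
    mul_rel_top_five (capDiagram_vert' h.symm h.symm) (drel_symm (capDiagram_top' hne))
      (capDiagram_bot' (bar_ne x).symm) hb (capDiagram_vert' h.symm h.symm)⟩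

theorem capDiagram_single (h : x.1 ≠ y.1) :
    capDiagram x y * capDiagram x (bar x) = capDiagram x y * capDiagram y (bar y) := by
  have hne : x ≠ y := fun e => h (e ▸ rfl)
  obtain ⟨a1, a2, a3⟩ := cap_mul_single_rel h
  obtain ⟨b1, b2, b3⟩ := cap_mul_single_rel h.symm
  rw [capDiagram_symm y x] at b1 b2 b3
  refine typeB_ext_of_vert (x := x) (y := y) (fun z h1 h2 => ?_) (fun z h1 h2 => ?_)
    ⟨.inl y, by simpa using hne.symm, a1, drel_symm b1⟩ ⟨.inl x, by simpa using hne,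
    drel_symm a1, b1⟩
    ⟨.inr (bar x), by simpa using bar_ne x, a2, b3⟩ ⟨.inr (bar y), by simpa using bar_ne y, a3, b2⟩
  · exact mul_rel_through (capDiagram_vert' h1 h2) (capDiagram_vert' h1 h1)
  · exact mul_rel_through (capDiagram_vert' h1 h2) (capDiagram_vert' h2 h2)

theorem single_capDiagram (h : x.1 ≠ y.1) :
    capDiagram x (bar x) * capDiagram x y = capDiagram y (bar y) * capDiagram x y := by
  have hne : x ≠ y := fun e => h (e ▸ rfl)
  obtain ⟨a1, a2, a3⟩ := single_mul_cap_rel h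
  obtain ⟨b1, b2, b3⟩ := single_mul_cap_rel h.symm
  rw [capDiagram_symm y x] at b1 b2 b3
  refine typeB_ext_of_vert (x := x) (y := y) (fun z h1 h2 => ?_) (fun z h1 h2 => ?_)
    ⟨.inl (bar x), by simpa using bar_ne x, a2, b3⟩ ⟨.inl (bar y), by simpa using bar_ne y, a3, b2⟩
    ⟨.inr y, by simpa using hne.symm, a1, drel_symm b1⟩ ⟨.inr x, by simpa using hne,
    drel_symm a1, b1⟩
  · exact mul_rel_through (capDiagram_vert' h1 h1) (capDiagram_vert' h1 h2)
  · exact mul_rel_through (capDiagram_vert' h2 h2) (capDiagram_vert' h1 h2)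

theorem capDiagram_single_capDiagram (h : x.1 ≠ y.1) :
    capDiagram x y * capDiagram x (bar x) * capDiagram x y = capDiagram x y := by
  have hne : x ≠ y := fun e => h (e ▸ rfl)
  have ht := capDiagram_top' hne
  have hb := capDiagram_bot' hne
  refine typeB_ext_of_vert (x := x) (y := y) (fun z h1 h2 => ?_) (fun z h1 h2 => ?_)
    ⟨.inl y, by simpa using hne.symm, ?_, ht⟩ ⟨.inl x, by simpa using hne, ?_, drel_symm ht⟩
    ⟨.inr y, by simpa using hne.symm, mul_rel_bot hb, hb⟩
    ⟨.inr x, by simpa using hne, mul_rel_bot (drel_symm hb), drel_symm hb⟩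
  · exact mul_rel_through (mul_rel_through (capDiagram_vert' h1 h2) (capDiagram_vert' h1 h1))
      (capDiagram_vert' h1 h2)
  · exact capDiagram_vert' h1 h2
  · exact mul_rel_top (mul_rel_top ht)
  · exact mul_rel_top (mul_rel_top (drel_symm ht))

theorem single_capDiagram_single (h : x.1 ≠ y.1) :
    capDiagram x (bar x) * capDiagram x y * capDiagram x (bar x)
      = capDiagram x (bar x) * capDiagram y (bar y) := by
  have hne : x ≠ y := fun e => h (e ▸ rfl)
  obtain ⟨a1, a2, a3⟩ := single_mul_cap_rel h
  obtain ⟨b1, b2, b3, b4⟩ := single_mul_single_rel h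
  refine typeB_ext_of_vert (x := x) (y := y) (fun z h1 h2 => ?_) (fun z h1 h2 => ?_)
    ⟨_, by simpa using bar_ne x, mul_rel_top a2, b1⟩
    ⟨_, by simpa using bar_ne y, mul_rel_top a3, b2⟩
    ⟨_, by simpa using bar_ne x, mul_rel_bot (capDiagram_bot' (bar_ne x).symm), b3⟩
    ⟨_, by simpa using bar_ne y, ?_, b4⟩
  · exact mul_rel_through (mul_rel_through (capDiagram_vert' h1 h1) (capDiagram_vert' h1 h2))
      (capDiagram_vert' h1 h1)
  · exact mul_rel_through (capDiagram_vert' h1 h1) (capDiagram_vert' h2 h2)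
  · exact mul_rel_bot_five (capDiagram_vert' h.symm h.symm) (drel_symm a1)
      (capDiagram_top' (bar_ne x).symm) (drel_bar (capDiagram x (bar x) * capDiagram x y) a1)
      (capDiagram_vert' h.symm h.symm)

theorem single_single_permDiagram (h : x.1 ≠ y.1) :
    capDiagram x (bar x) * capDiagram y (bar y) * permDiagram (exch x y)
      = capDiagram x (bar x) * capDiagram y (bar y) := by
  obtain ⟨b1, b2, b3, b4⟩ := single_mul_single_rel h
  have vert : ∀ z : Vertex n, z.1 ≠ x.1 → z.1 ≠ y.1 →
      drel (capDiagram x (bar x) * capDiagram y (bar y)) (.inl z) (.inr z) := fun z h1 h2 =>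
    mul_rel_through (capDiagram_vert' h1 h1) (capDiagram_vert' h2 h2)
  refine typeB_ext_of_vert (x := x) (y := y) (fun z h1 h2 => ?_) vert
    ⟨_, by simpa using bar_ne x, mul_rel_top b1, b1⟩
    ⟨_, by simpa using bar_ne y, mul_rel_top b2, b2⟩
    ⟨_, by simpa using bar_ne x, ?_, b3⟩ ⟨_, by simpa using bar_ne y, ?_, b4⟩
  · exact mul_rel_through (vert z h1 h2) (permDiagram_rel' _ (exch_of_fst_ne h1 h2))
  · exact mul_rel_bot_three (permDiagram_rel' _ (exch_left x y)) b4
      (permDiagram_rel' _ (by rw [signed_bar, exch_left]))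
  · exact mul_rel_bot_three (permDiagram_rel' _ (exch_right x y)) b3
      (permDiagram_rel' _ (by rw [signed_bar, exch_right]))

end two

/-- The cap system of the type B Brauer monoid. -/
def diagramCapSystem (n : ℕ) : CapSystem n (typeB n) where
  perm := ⟨⟨permDiagram, permDiagram_one⟩, permDiagram_mul⟩
  cap := capDiagram
  perm_mul_cap := permDiagram_mul_capDiagram
  cap_self := capDiagram_self
  cap_symm := capDiagram_symm
  cap_bar := capDiagram_bar
  cap_idem := capDiagram_idem
  perm_exch_mul_cap := permDiagram_exch_mul_capDiagram
  cap_mul_cap _ _ _ := capDiagram_mul_capDiagram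
  cap_comm _ _ _ _ := capDiagram_comm
  cap_single_cap _ _ := capDiagram_single_capDiagram
  single_cap_single _ _ := single_capDiagram_single
  single_single_perm _ _ := single_single_permDiagram
  cap_single _ _ := capDiagram_single
  single_cap _ _ := single_capDiagram

theorem diagramCapSystem_gen_s (i : Fin n) : (diagramCapSystem n).gen (.s i) = sGen i := by
  have key : ∀ v, drel (sGen i) (.inl (simple i v)) (.inr v) := fun v =>
    Or.inr (by simp [crossing, simple_apply, reflect_reflect])
  apply typeB_ext <;> intro k
  · refine ⟨simple i (simple i (k, false)), by simp, .inr (simple i (k, false)), by simp,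
      permDiagram_rel _ _, key _⟩
  · exact ⟨(k, false), rfl, _, by simp, drel_symm (permDiagram_rel _ _), drel_symm (key _)⟩

theorem diagramCapSystem_gen_t (i : Fin n) : (diagramCapSystem n).gen (.t i) = tGen i := by
  change capDiagram (lo i) (hi i) = tGen i
  have : capFun (lo i) (hi i) = capCup i := by
    funext u
    rcases u with u | u <;> simp only [capFun, capCup, ← simple_apply] <;> rfl
  simp only [capDiagram, tGen, this]

end

/-! ### The cap system of the presented monoid -/

section presented

variable {n : ℕ}

theorem exists_signed_pair {x y u v : Vertex n} (h : x.1 ≠ y.1) (h' : u.1 ≠ v.1) :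
    ∃ w : signed n, w x = u ∧ w y = v := by
  obtain ⟨w, hw⟩ := exists_signed (I := Bool) (fun b => bif b then x else y)
    (fun b => bif b then u else v)
    (by rintro (_ | _) (_ | _) e <;> simp at e ⊢ <;> first | exact h e | exact h e.symm)
    (by rintro (_ | _) (_ | _) e <;> simp at e ⊢ <;> first | exact h' e | exact h' e.symm)
  exact ⟨w, hw true, hw false⟩

theorem exists_signed_hi {m : ℕ} (hm : m ≤ n) (f : Fin m → Vertex n)
    (hf : Function.Injective fun i => (f i).1) :
    ∃ w : signed n, ∀ i : Fin m, w (hi (Fin.castLE hm i)) = f i :=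
  exists_signed (fun i => hi (Fin.castLE hm i)) f (fun _ _ h => Fin.castLE_injective hm h) hf

variable (n) in
/-- The monoid with the presentation of the type B Brauer monoid. -/
abbrev Pres : Type := PresentedMonoid (Rel n)

/-- The class of the abstract generator `σ i`. -/
def ps (i : Fin n) : Pres n := PresentedMonoid.mk (Rel n) (σ i)

/-- The class of the abstract generator `τ i`. -/
def pt (i : Fin n) : Pres n := PresentedMonoid.mk (Rel n) (τ i)

theorem ps_braid {i j : Fin n} (hij : i ≠ j) :
    PresentedMonoid.mk (Rel n) (SingularArtin.alt i j (coxeterB n i j))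
      = PresentedMonoid.mk (Rel n) (SingularArtin.alt j i (coxeterB n i j)) := by
  refine PresentedMonoid.mk_eq_mk_of_rel (Rel.artin _ _ (SingularArtin.Rel.braid i j hij ?_))
  rw [coxeterB_apply]
  split_ifs <;> decide

/-- The classes of the generators `σ i` as a sequence, continued by `1`. -/
def psSeq (n i : ℕ) : Pres n := if h : i < n then ps ⟨i, h⟩ else 1

theorem psSeq_fin (i : Fin n) : psSeq n i = ps i := by simp [psSeq]

theorem isCoxeterB_psSeq (n : ℕ) : IsCoxeterB n (psSeq n) where
  sq i hi := by
    simp only [psSeq, hi, dif_pos]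
    exact PresentedMonoid.mk_eq_mk_of_rel (Rel.s_sq _)
  comm i j hij hj := by
    have hi : i < n := by omega
    simp only [psSeq, hi, hj, dif_pos]
    have h := ps_braid (i := ⟨i, hi⟩) (j := ⟨j, hj⟩) (by simp; omega)
    rw [coxeterB_apply, if_neg (by simp; omega), if_neg (by simp; omega)] at h
    simp only [SingularArtin.alt, mul_one, map_mul] at h
    exact h
  three i h0 h := by
    have hi : i < n := by omega
    simp only [psSeq, hi, h, dif_pos]
    have h := ps_braid (i := ⟨i, hi⟩) (j := ⟨i + 1, h⟩) (by simp)
    rw [coxeterB_apply, if_neg (by simp), if_pos (by simp), if_neg (by simp; omega)] at h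
    simp only [SingularArtin.alt, mul_one, map_mul, mul_assoc] at h ⊢
    exact h
  four h := by
    have h0 : 0 < n := by omega
    simp only [psSeq, h0, h, dif_pos]
    have h := ps_braid (i := ⟨0, h0⟩) (j := ⟨1, h⟩) (by simp)
    rw [coxeterB_apply, if_neg (by simp), if_pos (by simp), if_pos (by simp)] at h
    simp only [SingularArtin.alt, mul_one, map_mul, mul_assoc] at h ⊢
    exact h

variable (n) in
/-- The homomorphism from the hyperoctahedral group to the presented monoid. -/
noncomputable def pperm : signed n →* Pres n := (isCoxeterB_psSeq n).hom

theorem pperm_simple (i : Fin n) : pperm n (simple i) = ps i := by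
  rw [pperm, IsCoxeterB.hom_simple, psSeq_fin]

theorem pperm_mul_inv (w : signed n) : pperm n w * pperm n w⁻¹ = 1 := by
  rw [← map_mul, mul_inv_cancel, map_one]

theorem pperm_inv_mul (w : signed n) : pperm n w⁻¹ * pperm n w = 1 := by
  rw [← map_mul, inv_mul_cancel, map_one]

theorem pt_mixed_odd {i j : Fin n} (hi : 0 < (i : ℕ)) (hj : 0 < (j : ℕ))
    (hij : (j : ℕ) = i + 1 ∨ (i : ℕ) = j + 1) :
    pt i * pperm n (simple j * simple i) = pperm n (simple j * simple i) * pt j := by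
  have hM : coxeterB n i j = 3 := by
    rw [coxeterB_apply, if_neg (by simp [Fin.ext_iff]; omega), if_pos (by omega),
      if_neg (by omega)]
  have h := PresentedMonoid.mk_eq_mk_of_rel (Rel.artin _ _
    (SingularArtin.Rel.mixed_odd (M := coxeterB n) i j (by rintro rfl; omega)
      (by rw [hM]; decide)))
  rw [hM, map_mul, map_mul] at h
  rw [map_mul, pperm_simple, pperm_simple]
  simp only [Nat.reduceSub, SingularArtin.alt, mul_one, map_mul] at h
  exact h

theorem pt_mixed_two {i j : Fin n} (hij : (i : ℕ) + 1 < j ∨ (j : ℕ) + 1 < i) :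
    pt i * pperm n (simple j) = pperm n (simple j) * pt i := by
  have hM : coxeterB n i j = 2 := by
    rw [coxeterB_apply, if_neg (by simp [Fin.ext_iff]; omega), if_neg (by omega)]
  have h := PresentedMonoid.mk_eq_mk_of_rel (Rel.artin _ _
    (SingularArtin.Rel.mixed_even (M := coxeterB n) i j (by rintro rfl; omega)
      (by rw [hM]; decide) (by rw [hM]; decide)))
  rw [hM, map_mul, map_mul] at h
  rw [pperm_simple]
  simp only [Nat.reduceSub, SingularArtin.alt, mul_one] at h
  exact h

theorem pt_comm {i j : Fin n} (hij : (i : ℕ) + 1 < j) : pt i * pt j = pt j * pt i := by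
  have hM : coxeterB n i j = 2 := by
    rw [coxeterB_apply, if_neg (by simp [Fin.ext_iff]; omega), if_neg (by omega)]
  exact PresentedMonoid.mk_eq_mk_of_rel (Rel.artin _ _ (SingularArtin.Rel.comm i j hM))

theorem pt_mixed_four {i j : Fin n} (hij : (i : ℕ) = 0 ∧ (j : ℕ) = 1 ∨ (i : ℕ) = 1 ∧ (j : ℕ) = 0) :
    pt i * pperm n (simple j * simple i * simple j)
      = pperm n (simple j * simple i * simple j) * pt i := by
  have hM : coxeterB n i j = 4 := by
    rw [coxeterB_apply, if_neg (by simp [Fin.ext_iff]; omega), if_pos (by omega),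
      if_pos (by omega)]
  have h := PresentedMonoid.mk_eq_mk_of_rel (Rel.artin _ _
    (SingularArtin.Rel.mixed_even (M := coxeterB n) i j (by rintro rfl; omega)
      (by rw [hM]; decide) (by rw [hM]; decide)))
  rw [hM, map_mul, map_mul] at h
  rw [map_mul, map_mul, pperm_simple, pperm_simple]
  simp only [Nat.reduceSub, SingularArtin.alt, mul_one, map_mul, mul_assoc] at h ⊢
  exact h

theorem pt_self (i : Fin n) : pt i * pperm n (simple i) = pperm n (simple i) * pt i := by
  rw [pperm_simple]
  exact PresentedMonoid.mk_eq_mk_of_rel (Rel.artin _ _ (SingularArtin.Rel.self i))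

theorem pt_idem (i : Fin n) : pt i * pt i = pt i := by
  by_cases h : (i : ℕ) = 0
  · exact PresentedMonoid.mk_eq_mk_of_rel (Rel.t0_sq i h)
  · exact PresentedMonoid.mk_eq_mk_of_rel (Rel.t_sq i (by omega))

theorem simple_mul_pt (i : Fin n) : pperm n (simple i) * pt i = pt i := by
  rw [pperm_simple]
  by_cases h : (i : ℕ) = 0
  · exact PresentedMonoid.mk_eq_mk_of_rel (Rel.s0_t0 i h)
  · exact PresentedMonoid.mk_eq_mk_of_rel (Rel.s_t i (by omega))

/-- `g` carries the pair of vertices exchanged by the `i`-th reflection to the one of the `j`-th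
reflection, and its image in the presented monoid conjugates `pt i` to `pt j`. -/
def Carries (g : signed n) (i j : Fin n) : Prop :=
  g (lo i) = lo j ∧ g (hi i) = hi j ∧ pperm n g * pt i = pt j * pperm n g

theorem Carries.trans {g h : signed n} {i j k : Fin n} (hg : Carries g i j) (hh : Carries h j k) :
    Carries (h * g) i k := by
  refine ⟨?_, ?_, ?_⟩
  · rw [signed_mul_apply, hg.1, hh.1]
  · rw [signed_mul_apply, hg.2.1, hh.2.1]
  · rw [map_mul, mul_assoc, hg.2.2, ← mul_assoc, hh.2.2, mul_assoc]

theorem pperm_inv_intertwines {g : signed n} {x y : Pres n}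
    (h : pperm n g * x = y * pperm n g) : pperm n g⁻¹ * y = x * pperm n g⁻¹ := by
  calc pperm n g⁻¹ * y = pperm n g⁻¹ * (y * pperm n g) * pperm n g⁻¹ := by
        rw [mul_assoc, mul_assoc, pperm_mul_inv, mul_one]
    _ = x * pperm n g⁻¹ := by rw [← h, ← mul_assoc, pperm_inv_mul, one_mul]

theorem Carries.inv {g : signed n} {i j : Fin n} (hg : Carries g i j) : Carries g⁻¹ j i := by
  refine ⟨?_, ?_, pperm_inv_intertwines hg.2.2⟩
  · rw [← hg.1, signed_inv_apply_self]
  · rw [← hg.2.1, signed_inv_apply_self]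

theorem carries_succ {i j : Fin n} (h0 : 0 < (i : ℕ)) (h : (j : ℕ) = i + 1) :
    Carries (simple i * simple j) i j := by
  refine ⟨?_, ?_, (pt_mixed_odd (by omega) h0 (Or.inr h)).symm⟩
  · rw [signed_mul_apply, simple_succ_lo h0 h, simple_lo, hi_eq_lo h]
  · rw [signed_mul_apply, hi_eq_lo h, simple_lo, simple_pred_hi h]

theorem exists_carries_of_le {i j : Fin n} (h0 : 0 < (i : ℕ)) (h : i ≤ j) :
    ∃ g, Carries g i j := by
  obtain ⟨k, hk⟩ : ∃ k, (j : ℕ) = i + k := ⟨j - i, by have := Fin.le_def.1 h; omega⟩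
  induction k generalizing j with
  | zero =>
    obtain rfl : j = i := Fin.ext hk
    exact ⟨1, rfl, rfl, by simp⟩
  | succ k ih =>
    have hj := j.2
    obtain ⟨g, hg⟩ := ih (j := ⟨i + k, by omega⟩) (Fin.le_def.2 (by simp)) rfl
    exact ⟨_, hg.trans (carries_succ (by simp; omega) (by simp only; omega))⟩

theorem exists_carries {i j : Fin n} (hi0 : 0 < (i : ℕ)) (hj0 : 0 < (j : ℕ)) :
    ∃ g, Carries g i j := by
  rcases le_total i j with h | h
  · exact exists_carries_of_le hi0 h
  · obtain ⟨g, hg⟩ := exists_carries_of_le hj0 h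
    exact ⟨_, hg.inv⟩

/-- For positive indices it suffices to consider the last one: the stabilizer of its two vertices
is generated by reflections that commute with the last singular generator by definition. -/
theorem carries_of_pos {g : signed n} {i j : Fin n} (hi0 : 0 < (i : ℕ)) (hj0 : 0 < (j : ℕ))
    (h1 : g (lo i) = lo j) (h2 : g (hi i) = hi j) : Carries g i j := by
  obtain ⟨L, hL⟩ : ∃ L : Fin n, (L : ℕ) + 1 = n := ⟨⟨n - 1, by omega⟩, by simp; omega⟩
  have hL0 : 0 < (L : ℕ) := by omega
  obtain ⟨a, ha⟩ := exists_carries hi0 hL0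
  obtain ⟨b, hb⟩ := exists_carries hj0 hL0
  have hc1 : (b * g * a⁻¹) (lo L) = lo L := by
    rw [signed_mul_apply, ha.inv.1, signed_mul_apply, h1, hb.1]
  have hc2 : (b * g * a⁻¹) (hi L) = hi L := by
    rw [signed_mul_apply, ha.inv.2.1, signed_mul_apply, h2, hb.2.1]
  have hc : Carries (b * g * a⁻¹) L L := by
    refine ⟨hc1, hc2, (isCoxeterB_psSeq n).hom_comm (m := n - 2) (by omega) ?_ ?_⟩
    · intro k hk
      have hk' : k = L ∨ (k : ℕ) + 1 = L := by
        have := k.2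
        by_cases e : (k : ℕ) = L
        · exact Or.inl (Fin.ext e)
        · right; omega
      rcases hk' with rfl | e
      · exact hc2
      · have e' : lo L = (k, false) := by
          rw [lo_pos hL0]
          exact Prod.ext (Fin.ext (by simp only; omega)) rfl
        rwa [e'] at hc1
    · intro k hk
      have hk' : k < n := by omega
      have := pt_mixed_two (i := L) (j := ⟨k, hk'⟩) (Or.inr (by simp only; omega))
      rw [pperm_simple] at this
      simp only [psSeq, hk', dif_pos]
      exact this.symm
  have := (ha.trans hc).trans hb.inv
  convert this using 1
  group

/-- The index `0`: the stabilizer of its two vertices is again a group of type `B`, generated by the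
reflection `simple 1 * simple 0 * simple 1` and the `simple k` with `k ≥ 2`. A cyclic shift of the
indices makes it the stabilizer of the last vertex, so that the Coxeter presentation applies. -/
theorem carries_zero {g : signed n} {i : Fin n} (hi0 : (i : ℕ) = 0) (h : g (hi i) = hi i) :
    Carries g i i := by
  refine ⟨by rw [lo_zero hi0, signed_bar, h], h, ?_⟩
  obtain ⟨L, hL⟩ : ∃ L : Fin n, (L : ℕ) + 1 = n := ⟨⟨n - 1, by omega⟩, by simp; omega⟩
  have hi' : i = ⟨0, by omega⟩ := Fin.ext hi0
  -- a signed permutation that shifts all indices cyclically, so that `i` becomes the last one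
  obtain ⟨x, hx⟩ := exists_signed (I := Fin n) (fun k => hi k)
    (fun k => hi (if (k : ℕ) = 0 then L else ⟨k - 1, by omega⟩))
    (fun a b h => h) (by
      intro a b h
      simp only [hi_fst] at h
      have ha := a.2
      have hb := b.2
      split_ifs at h with h1 h2 h2
      · exact Fin.ext (by omega)
      · have := congrArg Fin.val h; simp only at this; omega
      · have := congrArg Fin.val h; simp only at this; omega
      · have := congrArg Fin.val h; simp only at this; exact Fin.ext (by omega))
  have hxi : x (hi i) = hi L := by rw [hx, if_pos hi0]
  have hxs : ∀ a b : Fin n, (b : ℕ) = a + 1 → x (hi b) = hi a := by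
    intro a b hab
    rw [hx, if_neg (by omega)]
    congr 1
    exact Fin.ext (by simp only; omega)
  have key := (isCoxeterB_psSeq n).hom_comm (m := n - 1) (by omega) (w := x * g * x⁻¹)
    (t := pperm n x * pt i * pperm n x⁻¹) (by
      intro k hk
      obtain rfl : k = L := Fin.ext (by omega)
      change (x * g * x⁻¹) (hi k) = hi k
      rw [← hxi, signed_mul_apply, signed_inv_apply_self, signed_mul_apply, h]) (by
      intro k hk
      have hk' : k < n := by omega
      have hk1 : k + 1 < n := by omega
      simp only [psSeq, hk', dif_pos]
      rw [← pperm_simple]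
      have e1 : simple ⟨k, hk'⟩ * x = x * exch (x⁻¹ (lo ⟨k, hk'⟩)) (x⁻¹ (hi ⟨k, hk'⟩)) := by
        rw [signed_mul_exch, signed_apply_inv_self, signed_apply_inv_self, simple]
      have e2 : x⁻¹ (hi ⟨k, hk'⟩) = hi ⟨k + 1, hk1⟩ := by
        rw [← hxs ⟨k, hk'⟩ ⟨k + 1, hk1⟩ rfl, signed_inv_apply_self]
      have e3 : pperm n (exch (x⁻¹ (lo ⟨k, hk'⟩)) (x⁻¹ (hi ⟨k, hk'⟩))) * pt i
          = pt i * pperm n (exch (x⁻¹ (lo ⟨k, hk'⟩)) (x⁻¹ (hi ⟨k, hk'⟩))) := by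
        rcases Nat.eq_zero_or_pos k with h0 | h0
        · subst h0
          rw [lo_zero (i := ⟨0, hk'⟩) rfl, signed_bar, e2]
          have : exch (bar (hi ⟨0 + 1, hk1⟩)) (hi ⟨0 + 1, hk1⟩)
              = simple ⟨1, hk1⟩ * simple i * simple ⟨1, hk1⟩ := by
            rw [simple_mul_simple_mul_simple, lo_zero hi0, signed_bar,
              hi_eq_lo (i := i) (j := ⟨1, hk1⟩) (by simp [hi0]), simple_lo]
          rw [this]
          exact (pt_mixed_four (Or.inl ⟨hi0, rfl⟩)).symm
        · have e4 : x⁻¹ (lo ⟨k, hk'⟩) = lo ⟨k + 1, hk1⟩ := by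
            rw [← hi_eq_lo (i := ⟨k - 1, by omega⟩) (j := ⟨k, hk'⟩) (by simp only; omega),
              ← hi_eq_lo (i := ⟨k, hk'⟩) (j := ⟨k + 1, hk1⟩) rfl,
              ← hxs ⟨k - 1, by omega⟩ ⟨k, hk'⟩ (by simp only; omega), signed_inv_apply_self]
          rw [e2, e4]
          exact (pt_mixed_two (Or.inl (by simp only; omega))).symm
      have e5 : pperm n x⁻¹ * pperm n (simple ⟨k, hk'⟩)
          = pperm n (exch (x⁻¹ (lo ⟨k, hk'⟩)) (x⁻¹ (hi ⟨k, hk'⟩))) * pperm n x⁻¹ := by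
        rw [← map_mul, ← map_mul]
        congr 1
        rw [inv_mul_eq_iff_eq_mul, ← mul_assoc, ← e1, mul_assoc, mul_inv_cancel, mul_one]
      rw [← mul_assoc, ← mul_assoc, ← map_mul, e1, map_mul, mul_assoc (pperm n x), e3,
        mul_assoc, mul_assoc, mul_assoc, mul_assoc, e5])
  change pperm n (x * g * x⁻¹) * _ = _ * pperm n (x * g * x⁻¹) at key
  have h3 : pperm n x⁻¹ * (pperm n (x * g * x⁻¹) * (pperm n x * pt i * pperm n x⁻¹)) * pperm n x
      = pperm n g * pt i := by
    have : pperm n x⁻¹ * (pperm n (x * g * x⁻¹) * (pperm n x * pt i * pperm n x⁻¹)) * pperm n x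
        = pperm n (x⁻¹ * (x * g * x⁻¹) * x) * pt i * (pperm n x⁻¹ * pperm n x) := by
      simp only [map_mul, mul_assoc]
    rw [this, pperm_inv_mul, mul_one]
    congr 2
    group
  have h4 : pperm n x⁻¹ * (pperm n x * pt i * pperm n x⁻¹ * pperm n (x * g * x⁻¹)) * pperm n x
      = pt i * pperm n g := by
    have : pperm n x⁻¹ * (pperm n x * pt i * pperm n x⁻¹ * pperm n (x * g * x⁻¹)) * pperm n x
        = pperm n x⁻¹ * pperm n x * pt i * pperm n (x⁻¹ * (x * g * x⁻¹) * x) := by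
      simp only [map_mul, mul_assoc]
    rw [this, pperm_inv_mul, one_mul]
    congr 2
    group
  rw [← h3, key, h4]

theorem lo_eq_bar_hi_iff (i : Fin n) : lo i = bar (hi i) ↔ (i : ℕ) = 0 := by
  refine ⟨fun h => ?_, lo_zero⟩
  have h1 := congrArg (fun v : Vertex n => (v.1 : ℕ)) h
  simp only [bar_fst, lo_fst, hi_fst] at h1
  omega

/-- The singular generators are well defined on pairs of vertices. -/
theorem carries_of_apply {g : signed n} {i j : Fin n} (h1 : g (lo i) = lo j)
    (h2 : g (hi i) = hi j) : Carries g i j := by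
  by_cases hi0 : (i : ℕ) = 0
  · have hj0 : (j : ℕ) = 0 := by
      rw [← lo_eq_bar_hi_iff, ← h1, ← h2, lo_zero hi0, signed_bar]
    obtain rfl : i = j := Fin.ext (hi0.trans hj0.symm)
    exact carries_zero hi0 h2
  · have hj0 : (j : ℕ) ≠ 0 := by
      rwa [Ne, ← lo_eq_bar_hi_iff, ← h1, ← h2, ← signed_bar, signed_inj, lo_eq_bar_hi_iff]
    exact carries_of_pos (by omega) (by omega) h1 h2

open Classical in
/-- The element of the presented monoid that caps `u` with `v`: a conjugate of a singular generator,
or `1` if `u = v`. -/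
noncomputable def pcap (u v : Vertex n) : Pres n :=
  if h : ∃ p : signed n × Fin n, p.1 (lo p.2) = u ∧ p.1 (hi p.2) = v then
    pperm n h.choose.1 * pt h.choose.2 * pperm n h.choose.1⁻¹
  else 1

theorem pcap_apply (w : signed n) (i : Fin n) :
    pcap (w (lo i)) (w (hi i)) = pperm n w * pt i * pperm n w⁻¹ := by
  have h : ∃ p : signed n × Fin n, p.1 (lo p.2) = w (lo i) ∧ p.1 (hi p.2) = w (hi i) :=
    ⟨(w, i), rfl, rfl⟩
  rw [pcap, dif_pos h]
  obtain ⟨h1, h2⟩ := h.choose_spec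
  generalize h.choose = p at *
  have hc : Carries (w⁻¹ * p.1) p.2 i := carries_of_apply
    (by rw [signed_mul_apply, h1, signed_inv_apply_self])
    (by rw [signed_mul_apply, h2, signed_inv_apply_self])
  have h3 := hc.2.2
  rw [map_mul] at h3
  calc pperm n p.1 * pt p.2 * pperm n p.1⁻¹
      = pperm n w * (pperm n w⁻¹ * pperm n p.1 * pt p.2) * pperm n p.1⁻¹ := by
        rw [mul_assoc (pperm n w⁻¹), ← mul_assoc (pperm n w), pperm_mul_inv, one_mul]
    _ = pperm n w * pt i * pperm n w⁻¹ := by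
        rw [h3, ← mul_assoc, ← mul_assoc, mul_assoc _ (pperm n p.1), pperm_mul_inv, mul_one]

theorem pcap_lo_hi (i : Fin n) : pcap (lo i) (hi i) = pt i := by
  simpa using pcap_apply (1 : signed n) i

theorem pcap_self (u : Vertex n) : pcap u u = 1 := by
  rw [pcap, dif_neg]
  rintro ⟨p, h1, h2⟩
  rw [← h2, signed_inj] at h1
  exact lo_ne_hi _ h1

theorem exists_apply_lo_hi {u v : Vertex n} (h : u ≠ v) :
    ∃ (w : signed n) (i : Fin n), w (lo i) = u ∧ w (hi i) = v := by
  have hn : 0 < n := by have := u.1.2; omega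
  by_cases h1 : u.1 = v.1
  · obtain rfl := (fst_eq_iff.1 h1).resolve_left h
    obtain ⟨w, hw⟩ := exists_signed (I := Unit) (fun _ => hi (⟨0, hn⟩ : Fin n)) (fun _ => v)
      (fun _ _ _ => rfl) (fun _ _ _ => rfl)
    exact ⟨w, ⟨0, hn⟩, by rw [lo_zero rfl, signed_bar, hw ()], hw ()⟩
  · have hn1 : 1 < n := by
      have h2 : (u.1 : ℕ) ≠ v.1 := fun e => h1 (Fin.ext e)
      have := u.1.2
      have := v.1.2
      omega
    obtain ⟨w, hw⟩ := exists_signed_pair (x := lo (⟨1, hn1⟩ : Fin n)) (y := hi ⟨1, hn1⟩)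
      (by rw [lo_pos (by simp)]; simp [hi]) h1
    exact ⟨w, _, hw⟩

theorem pperm_mul_pcap (w : signed n) (u v : Vertex n) :
    pperm n w * pcap u v = pcap (w u) (w v) * pperm n w := by
  rcases eq_or_ne u v with rfl | h
  · rw [pcap_self, pcap_self, mul_one, one_mul]
  · obtain ⟨g, i, rfl, rfl⟩ := exists_apply_lo_hi h
    rw [← signed_mul_apply, ← signed_mul_apply, pcap_apply, pcap_apply, mul_inv_rev, map_mul,
      map_mul, mul_assoc _ _ (pperm n w), mul_assoc _ _ (pperm n w), pperm_inv_mul, mul_one]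
    simp only [mul_assoc]

theorem pcap_symm (u v : Vertex n) : pcap u v = pcap v u := by
  rcases eq_or_ne u v with rfl | h
  · rfl
  · obtain ⟨g, i, rfl, rfl⟩ := exists_apply_lo_hi h
    have h1 := pcap_apply (g * simple i) i
    simp only [signed_mul_apply, simple_lo, simple_hi] at h1
    rw [h1, pcap_apply, mul_inv_rev, map_mul, map_mul, mul_assoc (pperm n g) (pperm n (simple i)),
      ← pt_self, ← mul_assoc (pperm n g), ← mul_assoc, mul_assoc (pperm n g * pt i), pperm_mul_inv,
      mul_one]

/-- The change of both signs in a pair of vertices commutes with the singular generator. -/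
theorem exists_bar_comm (i : Fin n) : ∃ b : signed n, b (lo i) = bar (lo i) ∧
    b (hi i) = bar (hi i) ∧ pperm n b * pt i = pt i * pperm n b := by
  by_cases hi0 : (i : ℕ) = 0
  · exact ⟨simple i, by rw [simple_lo, lo_zero hi0, bar_bar], by rw [simple_hi, lo_zero hi0],
      (pt_self i).symm⟩
  · have h1 : 1 < n := by omega
    let p : Fin n := ⟨0, by omega⟩
    let q : Fin n := ⟨1, h1⟩
    have hpq : hi p = lo q := hi_eq_lo rfl
    obtain ⟨g, hg⟩ := exists_carries (i := q) (j := i) (by simp [q]) (by omega)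
    have e1 : (simple q * (simple p * simple q * simple p)) (lo q) = bar (lo q) := by
      simp only [signed_mul_apply]
      rw [← hpq, simple_hi, lo_zero rfl, signed_bar, signed_bar, signed_bar, hpq, simple_lo,
        simple_pred_hi (i := p) (j := q) rfl, simple_hi]
    have e2 : (simple q * (simple p * simple q * simple p)) (hi q) = bar (hi q) := by
      simp only [signed_mul_apply]
      rw [simple_pred_hi (i := p) (j := q) rfl, simple_hi, ← hpq, simple_hi, lo_zero rfl,
        signed_bar, hpq, simple_lo]
    have e3 : pperm n (simple q * (simple p * simple q * simple p)) * pt q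
        = pt q * pperm n (simple q * (simple p * simple q * simple p)) := by
      rw [map_mul, mul_assoc, ← pt_mixed_four (Or.inr ⟨rfl, rfl⟩), ← mul_assoc, ← pt_self,
        mul_assoc]
    generalize simple q * (simple p * simple q * simple p) = b at e1 e2 e3
    refine ⟨g * b * g⁻¹, ?_, ?_, ?_⟩
    · rw [signed_mul_apply, hg.inv.1, signed_mul_apply, e1, signed_bar, hg.1]
    · rw [signed_mul_apply, hg.inv.2.1, signed_mul_apply, e2, signed_bar, hg.2.1]
    · rw [map_mul, map_mul, mul_assoc, hg.inv.2.2, ← mul_assoc, mul_assoc (pperm n g), e3,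
        ← mul_assoc, hg.2.2]
      simp only [mul_assoc]

theorem pcap_bar (u v : Vertex n) : pcap (bar u) (bar v) = pcap u v := by
  rcases eq_or_ne u v with rfl | h
  · rw [pcap_self, pcap_self]
  · obtain ⟨g, i, rfl, rfl⟩ := exists_apply_lo_hi h
    obtain ⟨b, h1, h2, h3⟩ := exists_bar_comm i
    rw [← signed_bar, ← signed_bar, ← h1, ← h2, ← signed_mul_apply, ← signed_mul_apply,
      pcap_apply, pcap_apply, mul_inv_rev, map_mul, map_mul, mul_assoc (pperm n g), h3,
      ← mul_assoc (pperm n g), ← mul_assoc, mul_assoc (pperm n g * pt i), pperm_mul_inv, mul_one]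

/-- Conjugation by the image of a signed permutation. -/
noncomputable def pconj (w : signed n) : Pres n →* Pres n where
  toFun x := pperm n w * x * pperm n w⁻¹
  map_one' := by rw [mul_one, pperm_mul_inv]
  map_mul' x y := by
    simp only [mul_assoc]
    rw [← mul_assoc (pperm n w⁻¹), pperm_inv_mul, one_mul]

theorem pconj_pcap (w : signed n) (u v : Vertex n) : pconj w (pcap u v) = pcap (w u) (w v) := by
  change pperm n w * pcap u v * pperm n w⁻¹ = _
  rw [pperm_mul_pcap, mul_assoc, pperm_mul_inv, mul_one]

theorem pconj_exch (w : signed n) (u v : Vertex n) :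
    pconj w (pperm n (exch u v)) = pperm n (exch (w u) (w v)) := by
  change pperm n w * pperm n (exch u v) * pperm n w⁻¹ = _
  rw [← map_mul, signed_mul_exch, map_mul, mul_assoc, pperm_mul_inv, mul_one]

theorem pcap_idem (u v : Vertex n) : pcap u v * pcap u v = pcap u v := by
  rcases eq_or_ne u v with rfl | h
  · rw [pcap_self, mul_one]
  · obtain ⟨g, i, rfl, rfl⟩ := exists_apply_lo_hi h
    rw [← pconj_pcap, ← map_mul, pcap_lo_hi, pt_idem]

theorem pperm_exch_mul_pcap (u v : Vertex n) : pperm n (exch u v) * pcap u v = pcap u v := by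
  rcases eq_or_ne u v with rfl | h
  · rw [exch_self, map_one, one_mul]
  · obtain ⟨g, i, rfl, rfl⟩ := exists_apply_lo_hi h
    rw [← pconj_pcap, ← pconj_exch, ← map_mul, pcap_lo_hi, ← simple, simple_mul_pt]

section two

/-- Statements about two vertices in distinct orbits may be checked at the vertices `1` and `2`. -/
theorem two_vertices_induction {C : Vertex n → Vertex n → Prop}
    (hC : ∀ (w : signed n) x y, C x y → C (w x) (w y))
    (base : ∀ a b : Fin n, (a : ℕ) = 0 → (b : ℕ) = 1 → C (hi a) (hi b)) {x y : Vertex n}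
    (h : x.1 ≠ y.1) : C x y := by
  have hn1 : 1 < n := by
    have h2 : (x.1 : ℕ) ≠ y.1 := fun e => h (Fin.ext e)
    have := x.1.2
    have := y.1.2
    omega
  obtain ⟨w, rfl, rfl⟩ := exists_signed_pair (x := hi (⟨0, by omega⟩ : Fin n))
    (y := hi ⟨1, hn1⟩) (by simp [hi]) h
  exact hC w _ _ (base _ _ rfl rfl)

variable {a b : Fin n} (ha : (a : ℕ) = 0) (hb : (b : ℕ) = 1)

include ha in
theorem pcap_zero : pcap (hi a) (bar (hi a)) = pt a := by
  rw [pcap_symm, ← lo_zero ha, pcap_lo_hi]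

include ha hb in
theorem pcap_one : pcap (hi a) (hi b) = pt b := by
  rw [hi_eq_lo (by omega : (b : ℕ) = a + 1), pcap_lo_hi]

include ha hb in
theorem exch_one : exch (hi a) (hi b) = simple b := by
  rw [hi_eq_lo (by omega : (b : ℕ) = a + 1), simple]

include ha hb in
theorem pcap_one_bar : pcap (hi b) (bar (hi b)) = ps b * pt a * ps b := by
  have h : simple b (hi a) = hi b := by
    rw [hi_eq_lo (by omega : (b : ℕ) = a + 1), simple_lo]
  rw [← pcap_zero ha, ← pperm_simple, pperm_mul_pcap, signed_bar, h, mul_assoc, ← map_mul,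
    simple_mul_self, map_one, mul_one]

theorem ps_mul_self (i : Fin n) : ps i * ps i = 1 :=
  PresentedMonoid.mk_eq_mk_of_rel (Rel.s_sq i)

end two

theorem pcap_single_pcap {x y : Vertex n} (h : x.1 ≠ y.1) :
    pcap x y * pcap x (bar x) * pcap x y = pcap x y := by
  refine two_vertices_induction (C := fun x y => pcap x y * pcap x (bar x) * pcap x y = pcap x y)
    (fun w x y h => ?_) (fun a b ha hb => ?_) h
  · simpa only [map_mul, pconj_pcap, signed_bar] using congrArg (pconj w) h
  · rw [pcap_zero ha, pcap_one ha hb]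
    exact PresentedMonoid.mk_eq_mk_of_rel (Rel.t1_t0_t1 a b ha hb)

theorem single_single_aux {a b : Fin n} (ha : (a : ℕ) = 0) (hb : (b : ℕ) = 1) :
    pt a * ps b * pt a = pt a * (ps b * pt a * ps b) ∧
    ps b * pt a * ps b * pt a = pt a * (ps b * pt a * ps b) ∧
    pt a * (ps b * pt a * ps b) * ps b = pt a * (ps b * pt a * ps b) := by
  have h1 : pt a * ps b * pt a * ps b = pt a * ps b * pt a :=
    PresentedMonoid.mk_eq_mk_of_rel (Rel.t0_s1_t0_s1 a b ha hb)
  have h2 : ps b * pt a * ps b * pt a = pt a * ps b * pt a :=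
    PresentedMonoid.mk_eq_mk_of_rel (Rel.s1_t0_s1_t0 a b ha hb)
  refine ⟨?_, ?_, ?_⟩
  · rw [← mul_assoc, ← mul_assoc, h1]
  · rw [h2, ← mul_assoc, ← mul_assoc, h1]
  · rw [← mul_assoc, ← mul_assoc, h1, h1]

theorem single_pcap_single {x y : Vertex n} (h : x.1 ≠ y.1) :
    pcap x (bar x) * pcap x y * pcap x (bar x) = pcap x (bar x) * pcap y (bar y) := by
  refine two_vertices_induction
    (C := fun x y => pcap x (bar x) * pcap x y * pcap x (bar x) = pcap x (bar x) * pcap y (bar y))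
    (fun w x y h => ?_) (fun a b ha hb => ?_) h
  · simpa only [map_mul, pconj_pcap, signed_bar] using congrArg (pconj w) h
  · rw [pcap_zero ha, pcap_one ha hb, pcap_one_bar ha hb, ← (single_single_aux ha hb).1]
    exact PresentedMonoid.mk_eq_mk_of_rel (Rel.t0_t1_t0 a b ha hb)

theorem single_single_comm {x y : Vertex n} (h : x.1 ≠ y.1) :
    pcap x (bar x) * pcap y (bar y) = pcap y (bar y) * pcap x (bar x) := by
  refine two_vertices_induction
    (C := fun x y => pcap x (bar x) * pcap y (bar y) = pcap y (bar y) * pcap x (bar x))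
    (fun w x y h => ?_) (fun a b ha hb => ?_) h
  · simpa only [map_mul, pconj_pcap, signed_bar] using congrArg (pconj w) h
  · rw [pcap_zero ha, pcap_one_bar ha hb, ← (single_single_aux ha hb).2.1]

theorem single_single_pperm {x y : Vertex n} (h : x.1 ≠ y.1) :
    pcap x (bar x) * pcap y (bar y) * pperm n (exch x y) = pcap x (bar x) * pcap y (bar y) := by
  refine two_vertices_induction (C := fun x y =>
    pcap x (bar x) * pcap y (bar y) * pperm n (exch x y) = pcap x (bar x) * pcap y (bar y))
    (fun w x y h => ?_) (fun a b ha hb => ?_) h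
  · simpa only [map_mul, pconj_pcap, pconj_exch, signed_bar] using congrArg (pconj w) h
  · rw [pcap_zero ha, pcap_one_bar ha hb, exch_one ha hb, pperm_simple]
    exact (single_single_aux ha hb).2.2

theorem pcap_single {x y : Vertex n} (h : x.1 ≠ y.1) :
    pcap x y * pcap x (bar x) = pcap x y * pcap y (bar y) := by
  refine two_vertices_induction
    (C := fun x y => pcap x y * pcap x (bar x) = pcap x y * pcap y (bar y))
    (fun w x y h => ?_) (fun a b ha hb => ?_) h
  · simpa only [map_mul, pconj_pcap, signed_bar] using congrArg (pconj w) h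
  · rw [pcap_zero ha, pcap_one ha hb, pcap_one_bar ha hb, ← mul_assoc, ← mul_assoc]
    exact PresentedMonoid.mk_eq_mk_of_rel (Rel.t1_t0 a b ha hb)

theorem single_pcap {x y : Vertex n} (h : x.1 ≠ y.1) :
    pcap x (bar x) * pcap x y = pcap y (bar y) * pcap x y := by
  refine two_vertices_induction
    (C := fun x y => pcap x (bar x) * pcap x y = pcap y (bar y) * pcap x y)
    (fun w x y h => ?_) (fun a b ha hb => ?_) h
  · simpa only [map_mul, pconj_pcap, signed_bar] using congrArg (pconj w) h
  · rw [pcap_zero ha, pcap_one ha hb, pcap_one_bar ha hb]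
    exact PresentedMonoid.mk_eq_mk_of_rel (Rel.t0_t1 a b ha hb)

/-- The case `z = bar x` of the relation between caps with a common vertex: it comes from the
relation `τ₁ σ₀ τ₁ = τ₁`. -/
theorem pcap_mul_pcap_bar {x y : Vertex n} (h : x.1 ≠ y.1) :
    pcap x y * pcap y (bar x) = pperm n (exch x (bar x)) * pcap y (bar x) := by
  refine two_vertices_induction
    (C := fun x y => pcap x y * pcap y (bar x) = pperm n (exch x (bar x)) * pcap y (bar x))
    (fun w x y h => ?_) (fun a b ha hb => ?_) h
  · simpa only [map_mul, pconj_pcap, pconj_exch, signed_bar] using congrArg (pconj w) h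
  · have h1 : pt b * ps a * pt b = pt b :=
      PresentedMonoid.mk_eq_mk_of_rel (Rel.t1_s0_t1 a b ha hb)
    have e : exch (hi a) (bar (hi a)) = simple a := by rw [simple, lo_zero ha, exch_symm]
    have e2 : pcap (hi b) (bar (hi a)) = ps a * pt b * ps a := by
      have h3 : simple a (hi b) = hi b := simple_pred_hi (by omega)
      rw [pcap_symm, ← pcap_one ha hb, ← pperm_simple, pperm_mul_pcap, simple_hi, h3, lo_zero ha,
        mul_assoc, ← map_mul, simple_mul_self, map_one, mul_one]
    rw [e, e2, pperm_simple, pcap_one ha hb, ← mul_assoc, ← mul_assoc, h1, ← mul_assoc,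
      ← mul_assoc, ps_mul_self, one_mul]

/-- The relation between caps with a common vertex. For three vertices in distinct orbits it is
carried over from the type A Brauer relations at the indices `1` and `2`. -/
theorem pcap_mul_pcap (x y z : Vertex n) (hxy : x.1 ≠ y.1) (hyz : y.1 ≠ z.1) :
    pcap x y * pcap y z = pperm n (exch x z) * pcap y z := by
  by_cases hxz : x.1 = z.1
  · rcases fst_eq_iff.1 hxz.symm with rfl | rfl
    · rw [pcap_symm y, pcap_idem, exch_self, map_one, one_mul]
    · exact pcap_mul_pcap_bar hxy
  · have hn : 3 ≤ n := by
      have : Function.Injective ![x.1, y.1, z.1] := by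
        intro i j h
        fin_cases i <;> fin_cases j <;> simp_all [eq_comm]
      simpa using Fintype.card_le_of_injective _ this
    obtain ⟨w, hw⟩ := exists_signed_hi hn ![x, y, z] (by
      intro i j h
      fin_cases i <;> fin_cases j <;> simp_all [eq_comm])
    have h0 := hw 0
    have h1 := hw 1
    have h2 := hw 2
    simp only [Matrix.cons_val] at h0 h1 h2
    set a := Fin.castLE hn 0 with ha
    set b := Fin.castLE hn 1 with hb
    set c := Fin.castLE hn 2 with hc
    have ha0 : (a : ℕ) = 0 := rfl
    have hb1 : (b : ℕ) = 1 := rfl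
    have hc2 : (c : ℕ) = 2 := rfl
    have key : pt b * pt c = pperm n (exch (hi a) (hi c)) * pt c := by
      have e1 : pt b * pt c * ps b = pt b * ps c :=
        PresentedMonoid.mk_eq_mk_of_rel (Rel.t_t_s b c (by omega) (by omega) (by omega))
      have e2 := pt_mixed_odd (i := b) (j := c) (by omega) (by omega) (by omega)
      calc pt b * pt c = pt b * pt c * ps b * ps b := by rw [mul_assoc _ (ps b), ps_mul_self, mul_one]
        _ = pt b * pperm n (simple c * simple b) := by
          rw [e1, map_mul, pperm_simple, pperm_simple, mul_assoc]
        _ = pperm n (simple c * simple b) * (pperm n (simple c) * pt c) := by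
          rw [e2, simple_mul_pt]
        _ = pperm n (exch (hi a) (hi c)) * pt c := by
          rw [← mul_assoc, ← map_mul, simple_conj_pred (i := b) (j := c) (by omega) (by omega),
            hi_eq_lo (i := a) (j := b) (by omega)]
    have h3 : pcap (hi b) (hi c) = pt c := by
      rw [hi_eq_lo (by omega : (c : ℕ) = b + 1), pcap_lo_hi]
    rw [← pcap_one ha0 hb1, ← h3] at key
    have := congrArg (pconj w) key
    simpa only [map_mul, pconj_pcap, pconj_exch, h0, h1, h2] using this

theorem pcap_comm_single_pair {x u v : Vertex n} (h1 : x.1 ≠ u.1) (h2 : x.1 ≠ v.1)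
    (huv : u.1 ≠ v.1) : pcap x (bar x) * pcap u v = pcap u v * pcap x (bar x) := by
  have hn : 3 ≤ n := by
    have : Function.Injective ![x.1, u.1, v.1] := by
      intro i j h
      fin_cases i <;> fin_cases j <;> simp_all [eq_comm]
    simpa using Fintype.card_le_of_injective _ this
  obtain ⟨w, hw⟩ := exists_signed_hi hn ![x, u, v] (by
    intro i j h
    fin_cases i <;> fin_cases j <;> simp_all [eq_comm])
  have e0 := hw 0
  have e1 := hw 1
  have e2 := hw 2
  simp only [Matrix.cons_val] at e0 e1 e2
  have key := pt_comm (i := Fin.castLE hn 0) (j := Fin.castLE hn 2) (by simp)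
  rw [← pcap_zero (a := Fin.castLE hn 0) rfl, ← pcap_lo_hi,
    ← hi_eq_lo (i := Fin.castLE hn 1) rfl] at key
  have := congrArg (pconj w) key
  simpa only [map_mul, pconj_pcap, signed_bar, e0, e1, e2] using this

theorem pcap_comm_pair_pair {x y u v : Vertex n} (h1 : x.1 ≠ u.1) (h2 : x.1 ≠ v.1)
    (h3 : y.1 ≠ u.1) (h4 : y.1 ≠ v.1) (hxy : x.1 ≠ y.1) (huv : u.1 ≠ v.1) :
    pcap x y * pcap u v = pcap u v * pcap x y := by
  have hn : 4 ≤ n := by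
    have : Function.Injective ![x.1, y.1, u.1, v.1] := by
      intro i j h
      fin_cases i <;> fin_cases j <;> simp_all [eq_comm]
    simpa using Fintype.card_le_of_injective _ this
  obtain ⟨w, hw⟩ := exists_signed_hi hn ![x, y, u, v] (by
    intro i j h
    fin_cases i <;> fin_cases j <;> simp_all [eq_comm])
  have e0 := hw 0
  have e1 := hw 1
  have e2 := hw 2
  have e3 := hw 3
  simp only [Matrix.cons_val] at e0 e1 e2 e3
  have key := pt_comm (i := Fin.castLE hn 1) (j := Fin.castLE hn 3) (by simp)
  rw [← pcap_lo_hi, ← pcap_lo_hi, ← hi_eq_lo (i := Fin.castLE hn 0) rfl,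
    ← hi_eq_lo (i := Fin.castLE hn 2) rfl] at key
  have := congrArg (pconj w) key
  simpa only [map_mul, pconj_pcap, e0, e1, e2, e3] using this

theorem pcap_comm (x y u v : Vertex n) (h1 : x.1 ≠ u.1) (h2 : x.1 ≠ v.1)
    (h3 : y.1 ≠ u.1) (h4 : y.1 ≠ v.1) : pcap x y * pcap u v = pcap u v * pcap x y := by
  by_cases hxy : x.1 = y.1
  · rcases fst_eq_iff.1 hxy.symm with rfl | rfl
    · rw [pcap_self, mul_one, one_mul]
    by_cases huv : u.1 = v.1
    · rcases fst_eq_iff.1 huv.symm with rfl | rfl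
      · rw [pcap_self, mul_one, one_mul]
      exact single_single_comm h1
    · exact pcap_comm_single_pair h1 h2 huv
  · by_cases huv : u.1 = v.1
    · rcases fst_eq_iff.1 huv.symm with rfl | rfl
      · rw [pcap_self, mul_one, one_mul]
      exact (pcap_comm_single_pair h1.symm h3.symm hxy).symm
    · exact pcap_comm_pair_pair h1 h2 h3 h4 hxy huv

variable (n) in
/-- The cap system of the presented monoid. -/
noncomputable def presCapSystem : CapSystem n (Pres n) where
  perm := pperm n
  cap := pcap
  perm_mul_cap := pperm_mul_pcap
  cap_self := pcap_self
  cap_symm := pcap_symm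
  cap_bar := pcap_bar
  cap_idem := pcap_idem
  perm_exch_mul_cap := pperm_exch_mul_pcap
  cap_mul_cap := pcap_mul_pcap
  cap_comm := pcap_comm
  cap_single_cap _ _ := pcap_single_pcap
  single_cap_single _ _ := single_pcap_single
  single_single_perm _ _ := single_single_pperm
  cap_single _ _ := pcap_single
  single_cap _ _ := single_pcap

end presented

/-! ### Products of commuting idempotents -/

section idempotents

variable {M : Type*} [Monoid M]

theorem mul_list_prod_of_mem {L : List M} (hi : ∀ x ∈ L, x * x = x)
    (hc : ∀ x ∈ L, ∀ y ∈ L, Commute x y) {x : M} (hx : x ∈ L) : x * L.prod = L.prod := by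
  induction L with
  | nil => simp at hx
  | cons y L ih =>
    rw [List.prod_cons]
    rcases List.mem_cons.1 hx with rfl | h
    · rw [← mul_assoc, hi x hx]
    · rw [← mul_assoc, (hc x hx y List.mem_cons_self).eq, mul_assoc,
        ih (fun z hz => hi z (List.mem_cons_of_mem _ hz))
          (fun z hz t ht => hc z (List.mem_cons_of_mem _ hz) t (List.mem_cons_of_mem _ ht)) h]

theorem list_prod_mul_of_forall {L : List M} {p : M} (h : ∀ x ∈ L, x * p = p) : L.prod * p = p := by
  induction L with
  | nil => simp
  | cons y L ih =>
    rw [List.prod_cons, mul_assoc, ih fun x hx => h x (List.mem_cons_of_mem _ hx),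
      h y List.mem_cons_self]

/-- A product of commuting idempotents depends only on the set of its nontrivial factors. -/
theorem list_prod_eq_of_mem {L K : List M} (hi : ∀ x ∈ L ++ K, x * x = x)
    (hc : ∀ x ∈ L ++ K, ∀ y ∈ L ++ K, Commute x y) (hLK : ∀ x ∈ L, x = 1 ∨ x ∈ K)
    (hKL : ∀ x ∈ K, x = 1 ∨ x ∈ L) : L.prod = K.prod := by
  have h1 : L.prod * K.prod = K.prod := list_prod_mul_of_forall fun x hx => by
    rcases hLK x hx with rfl | h
    · exact one_mul _
    · exact mul_list_prod_of_mem (fun y hy => hi y (List.mem_append_right _ hy))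
        (fun y hy z hz => hc y (List.mem_append_right _ hy) z (List.mem_append_right _ hz)) h
  have h2 : K.prod * L.prod = L.prod := list_prod_mul_of_forall fun x hx => by
    rcases hKL x hx with rfl | h
    · exact one_mul _
    · exact mul_list_prod_of_mem (fun y hy => hi y (List.mem_append_left _ hy))
        (fun y hy z hz => hc y (List.mem_append_left _ hy) z (List.mem_append_left _ hz)) h
  have h3 : Commute L.prod K.prod :=
    Commute.list_prod_left _ _ fun x hx => Commute.list_prod_right _ _ fun y hy =>
      hc x (List.mem_append_left _ hx) y (List.mem_append_right _ hy)
  rw [← h2, ← h3.eq, h1]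

end idempotents

/-! ### Patterns of caps -/

/-- A pattern of caps in one row: an involution of the vertices that commutes with `bar`. The fixed
vertices are the free ones, and every other vertex is capped with its image. -/
structure IsPattern {n : ℕ} (c : Vertex n → Vertex n) : Prop where
  invol : ∀ v, c (c v) = v
  map_bar : ∀ v, c (bar v) = bar (c v)

section pattern

variable {n : ℕ} {c : Vertex n → Vertex n}

theorem isPattern_id : IsPattern (id : Vertex n → Vertex n) := ⟨fun _ => rfl, fun _ => rfl⟩

theorem IsPattern.injective (hc : IsPattern c) : Function.Injective c :=
  Function.Involutive.injective hc.invol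

/-- The pattern with the same free vertices in which every other vertex is capped with its bar. -/
def singles (c : Vertex n → Vertex n) (v : Vertex n) : Vertex n := if c v = v then v else bar v

theorem singles_eq_self_iff {v : Vertex n} : singles c v = v ↔ c v = v := by
  unfold singles
  split_ifs with h
  · simp [h]
  · simp [h, bar_ne]

theorem singles_of_ne {v : Vertex n} (h : c v ≠ v) : singles c v = bar v := if_neg h

theorem IsPattern.bar_eq_self_iff (hc : IsPattern c) {v : Vertex n} :
    c (bar v) = bar v ↔ c v = v := by rw [hc.map_bar, bar_injective.eq_iff]

theorem IsPattern.singles (hc : IsPattern c) : IsPattern (singles c) where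
  invol v := by
    by_cases h : c v = v
    · have : BrauerB.singles c v = v := singles_eq_self_iff.2 h
      rw [this, this]
    · rw [singles_of_ne h, singles_of_ne (mt hc.bar_eq_self_iff.1 h), bar_bar]
  map_bar v := by
    by_cases h : c v = v
    · rw [singles_eq_self_iff.2 h, singles_eq_self_iff.2 (hc.bar_eq_self_iff.2 h)]
    · rw [singles_of_ne h, singles_of_ne (mt hc.bar_eq_self_iff.1 h)]

/-- The pattern in which two free vertices `x` and `y` have been capped, together with their
bars. -/
def extend (c : Vertex n → Vertex n) (x y v : Vertex n) : Vertex n := exch x y (c v)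

theorem IsPattern.fst_eq_of_free (hc : IsPattern c) {x v : Vertex n} (hx : c x = x)
    (h : (c v).1 = x.1) : c v = v := by
  rcases fst_eq_iff.1 h with h | h
  · have : v = x := hc.injective (h.trans hx.symm)
    rw [this, hx]
  · have hb := hc.bar_eq_self_iff.2 hx
    have : v = bar x := hc.injective (h.trans hb.symm)
    rw [this, hb]

theorem IsPattern.free_of_fst_eq (hc : IsPattern c) {x v : Vertex n} (hx : c x = x)
    (h : v.1 = x.1) : c v = v := by
  rcases fst_eq_iff.1 h with rfl | rfl
  · exact hx
  · exact hc.bar_eq_self_iff.2 hx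

theorem IsPattern.extend_of_ne (hc : IsPattern c) {x y v : Vertex n} (hx : c x = x) (hy : c y = y)
    (h1 : v.1 ≠ x.1) (h2 : v.1 ≠ y.1) : extend c x y v = c v := by
  refine exch_of_fst_ne (fun h => ?_) (fun h => ?_)
  · rw [hc.fst_eq_of_free hx h] at h; exact h1 h
  · rw [hc.fst_eq_of_free hy h] at h; exact h2 h

theorem IsPattern.extend_of_eq (hc : IsPattern c) {x y v : Vertex n} (hx : c x = x) (hy : c y = y)
    (h : v.1 = x.1 ∨ v.1 = y.1) : extend c x y v = exch x y v := by
  unfold extend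
  rcases h with h | h
  · rw [hc.free_of_fst_eq hx h]
  · rw [hc.free_of_fst_eq hy h]

theorem exch_ne_self {x y v : Vertex n} (hxy : x ≠ y) (h : v.1 = x.1 ∨ v.1 = y.1) :
    exch x y v ≠ v := by
  rcases h with h | h <;> rcases fst_eq_iff.1 h with rfl | rfl
  · rw [exch_left]; exact hxy.symm
  · rw [signed_bar, exch_left]; exact fun h => hxy.symm (bar_injective h)
  · rw [exch_right]; exact hxy
  · rw [signed_bar, exch_right]; exact fun h => hxy (bar_injective h)

theorem exch_fst {x y v : Vertex n} (h : v.1 = x.1 ∨ v.1 = y.1) :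
    (exch x y v).1 = x.1 ∨ (exch x y v).1 = y.1 := by
  rcases h with h | h <;> rcases fst_eq_iff.1 h with rfl | rfl <;> simp [signed_bar]

theorem IsPattern.extend (hc : IsPattern c) {x y : Vertex n} (hx : c x = x) (hy : c y = y) :
    IsPattern (extend c x y) where
  invol v := by
    by_cases h : v.1 = x.1 ∨ v.1 = y.1
    · rw [hc.extend_of_eq hx hy h, hc.extend_of_eq hx hy (exch_fst h), exch_exch]
    · push Not at h
      rw [hc.extend_of_ne hx hy h.1 h.2, hc.extend_of_ne hx hy, hc.invol]
      · intro h'; rw [hc.fst_eq_of_free hx h'] at h'; exact h.1 h'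
      · intro h'; rw [hc.fst_eq_of_free hy h'] at h'; exact h.2 h'
  map_bar v := by rw [BrauerB.extend, hc.map_bar, signed_bar]; rfl

theorem IsPattern.extend_eq_self_iff (hc : IsPattern c) {x y v : Vertex n} (hx : c x = x)
    (hy : c y = y) (hxy : x ≠ y) :
    BrauerB.extend c x y v = v ↔ c v = v ∧ v.1 ≠ x.1 ∧ v.1 ≠ y.1 := by
  by_cases h : v.1 = x.1 ∨ v.1 = y.1
  · rw [hc.extend_of_eq hx hy h]
    exact ⟨fun e => absurd e (exch_ne_self hxy h), fun e => by tauto⟩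
  · push Not at h
    rw [hc.extend_of_ne hx hy h.1 h.2]
    tauto

/-- A pattern is obtained from a smaller one by capping a non-free vertex with its image. -/
theorem IsPattern.exists_eq_extend (hc : IsPattern c) (x : Vertex n) :
    ∃ d, IsPattern d ∧ d x = x ∧ d (c x) = c x ∧ c = BrauerB.extend d x (c x) ∧
      ∀ v, c v = v → d v = v := by
  have hfst : ∀ v, ((c v).1 = x.1 ∨ (c v).1 = (c x).1) ↔ (v.1 = x.1 ∨ v.1 = (c x).1) := by
    intro v
    have key : ∀ u v : Vertex n, (c v).1 = u.1 → v.1 = (c u).1 := by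
      intro u v h
      rcases fst_eq_iff.1 h with h | h
      · rw [← h, hc.invol]
      · rw [← bar_bar (c u), ← hc.map_bar, ← h, hc.invol]; rfl
    constructor
    · rintro (h | h)
      · exact Or.inr (key _ _ h)
      · have := key _ _ h
        rw [hc.invol] at this
        exact Or.inl this
    · rintro (h | h)
      · right
        rcases fst_eq_iff.1 h with rfl | rfl
        · rfl
        · rw [hc.map_bar]; rfl
      · left
        rcases fst_eq_iff.1 h with rfl | rfl
        · rw [hc.invol]
        · rw [hc.map_bar, hc.invol]; rfl
  let d : Vertex n → Vertex n := fun v => if v.1 = x.1 ∨ v.1 = (c x).1 then v else c v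
  have hd : IsPattern d := by
    refine ⟨fun v => ?_, fun v => ?_⟩
    · by_cases h : v.1 = x.1 ∨ v.1 = (c x).1
      · simp [d, h]
      · have h' := mt (hfst v).1 h
        simp only [d, if_neg h, if_neg h', hc.invol]
    · by_cases h : v.1 = x.1 ∨ v.1 = (c x).1
      · have h' : (bar v).1 = x.1 ∨ (bar v).1 = (c x).1 := h
        simp only [d, if_pos h, if_pos h']
      · have h' : ¬ ((bar v).1 = x.1 ∨ (bar v).1 = (c x).1) := h
        simp only [d, if_neg h, if_neg h', hc.map_bar]
  have h1 : d x = x := by simp [d]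
  have h2 : d (c x) = c x := by simp [d]
  refine ⟨d, hd, h1, h2, ?_, ?_⟩
  · funext v
    by_cases h : v.1 = x.1 ∨ v.1 = (c x).1
    · rw [hd.extend_of_eq h1 h2 h]
      rcases h with h | h <;> rcases fst_eq_iff.1 h with rfl | rfl
      · rw [exch_left]
      · rw [signed_bar, exch_left, hc.map_bar]
      · rw [exch_right, hc.invol]
      · rw [signed_bar, exch_right, hc.map_bar, hc.invol]
    · have h' := h
      push Not at h'
      rw [hd.extend_of_ne h1 h2 h'.1 h'.2]
      simp only [d, if_neg h]
  · intro v hv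
    simp only [d, hv, ite_self]

/-- The pattern `c` carried along a signed permutation. -/
def conjPattern (w : signed n) (c : Vertex n → Vertex n) (v : Vertex n) : Vertex n := w (c (w⁻¹ v))

theorem conjPattern_apply (w : signed n) (c : Vertex n → Vertex n) (v : Vertex n) :
    conjPattern w c (w v) = w (c v) := by simp [conjPattern]

theorem IsPattern.conj (hc : IsPattern c) (w : signed n) : IsPattern (conjPattern w c) :=
  ⟨fun v => by simp [conjPattern, hc.invol],
    fun v => by rw [conjPattern, signed_bar, hc.map_bar, signed_bar]; rfl⟩

theorem singles_conj (w : signed n) (c : Vertex n → Vertex n) :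
    singles (conjPattern w c) = conjPattern w (singles c) := by
  funext v
  obtain ⟨u, rfl⟩ : ∃ u, w u = v := ⟨w⁻¹ v, by simp⟩
  rw [conjPattern_apply, singles, singles, conjPattern_apply]
  simp only [signed_inj]
  split_ifs
  · rfl
  · rw [signed_bar]

end pattern

/-! ### Normal forms -/

namespace CapSystem

variable {n : ℕ} {M : Type*} [Monoid M] (S : CapSystem n M) {c : Vertex n → Vertex n}

/-- The product of the caps of a pattern. -/
noncomputable def capProd (c : Vertex n → Vertex n) : M :=
  ((Finset.univ : Finset (Vertex n)).toList.map fun v => S.cap v (c v)).prod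

theorem mem_caps {x : M} :
    x ∈ ((Finset.univ : Finset (Vertex n)).toList.map fun v => S.cap v (c v))
      ↔ ∃ v, S.cap v (c v) = x := by
  simp

/-- A cap between free vertices commutes with the caps of the pattern. -/
theorem cap_comm_of_free (hc : IsPattern c) {x y : Vertex n} (hx : c x = x) (hy : c y = y)
    (v : Vertex n) : Commute (S.cap x y) (S.cap v (c v)) := by
  by_cases h : c v = v
  · rw [h, S.cap_self]; exact Commute.one_right _
  · have hv : ∀ z, c z = z → z.1 ≠ v.1 := fun z hz e => h (hc.free_of_fst_eq hz e.symm)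
    have hv' : ∀ z, c z = z → z.1 ≠ (c v).1 := fun z hz e =>
      h (hc.fst_eq_of_free hz e.symm)
    exact S.cap_comm _ _ _ _ (hv x hx) (hv' x hx) (hv y hy) (hv' y hy)

theorem cap_comm_of_pattern (hc : IsPattern c) (u v : Vertex n) :
    Commute (S.cap u (c u)) (S.cap v (c v)) := by
  by_cases h1 : u.1 = v.1
  · rcases fst_eq_iff.1 h1 with rfl | rfl
    · exact Commute.refl _
    · rw [hc.map_bar, S.cap_bar]
  by_cases h2 : u.1 = (c v).1
  · rcases fst_eq_iff.1 h2 with rfl | rfl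
    · rw [hc.invol, S.cap_symm]
    · rw [hc.map_bar, hc.invol, S.cap_bar, S.cap_symm]
  have key : ∀ z, (c u).1 = z.1 → u.1 = (c z).1 := fun z h => by
    rcases fst_eq_iff.1 h with h | h
    · rw [← h, hc.invol]
    · rw [← bar_bar (c z), ← hc.map_bar, ← h, hc.invol]; rfl
  refine S.cap_comm _ _ _ _ h1 h2 (fun h => h2 (key _ h)) (fun h => h1 ?_)
  have := key _ h
  rwa [hc.invol] at this

theorem cap_mul_capProd (hc : IsPattern c) (v : Vertex n) :
    S.cap v (c v) * S.capProd c = S.capProd c := by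
  refine mul_list_prod_of_mem ?_ ?_ (S.mem_caps.2 ⟨v, rfl⟩)
  · intro x hx
    obtain ⟨u, rfl⟩ := S.mem_caps.1 hx
    exact S.cap_idem _ _
  · intro x hx y hy
    obtain ⟨u, rfl⟩ := S.mem_caps.1 hx
    obtain ⟨t, rfl⟩ := S.mem_caps.1 hy
    exact S.cap_comm_of_pattern hc _ _

theorem commute_cap_capProd (hc : IsPattern c) {x y : Vertex n} (hx : c x = x) (hy : c y = y) :
    Commute (S.cap x y) (S.capProd c) :=
  Commute.list_prod_right _ _ fun z hz => by
    obtain ⟨u, rfl⟩ := S.mem_caps.1 hz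
    exact S.cap_comm_of_free hc hx hy u

theorem capProd_mul_cap (hc : IsPattern c) (v : Vertex n) :
    S.capProd c * S.cap v (c v) = S.capProd c := by
  have : Commute (S.capProd c) (S.cap v (c v)) := Commute.list_prod_left _ _ fun z hz => by
    obtain ⟨u, rfl⟩ := S.mem_caps.1 hz
    exact S.cap_comm_of_pattern hc u v
  rw [this.eq, S.cap_mul_capProd hc]

theorem capProd_id : S.capProd id = 1 :=
  List.prod_eq_one fun x hx => by
    obtain ⟨v, rfl⟩ := S.mem_caps.1 hx
    exact S.cap_self v

/-- The factors of the product of a pattern are those of a list of commuting idempotents. -/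
theorem capProd_eq_list_prod (hc : IsPattern c) {K : List M} (h1 : ∀ v, S.cap v (c v) = 1 ∨
    S.cap v (c v) ∈ K) (h2 : ∀ x ∈ K, ∃ v, S.cap v (c v) = x ∨ x = 1) : S.capProd c = K.prod := by
  have hK : ∀ x ∈ K, x = 1 ∨ ∃ v, S.cap v (c v) = x := fun x hx => by
    obtain ⟨v, h | h⟩ := h2 x hx
    · exact Or.inr ⟨v, h⟩
    · exact Or.inl h
  have hall : ∀ x ∈ ((Finset.univ : Finset (Vertex n)).toList.map fun v => S.cap v (c v)) ++ K,
      x = 1 ∨ ∃ v, S.cap v (c v) = x := fun x hx => by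
    rcases List.mem_append.1 hx with h | h
    · exact Or.inr (S.mem_caps.1 h)
    · exact hK x h
  refine list_prod_eq_of_mem ?_ ?_ ?_ ?_
  · intro x hx
    rcases hall x hx with rfl | ⟨v, rfl⟩
    · exact one_mul 1
    · exact S.cap_idem _ _
  · intro x hx y hy
    rcases hall x hx with rfl | ⟨v, rfl⟩
    · exact Commute.one_left _
    rcases hall y hy with rfl | ⟨u, rfl⟩
    · exact Commute.one_right _
    exact S.cap_comm_of_pattern hc _ _
  · intro x hx
    obtain ⟨v, rfl⟩ := S.mem_caps.1 hx
    exact h1 v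
  · intro x hx
    rcases hK x hx with h | h
    · exact Or.inl h
    · exact Or.inr (S.mem_caps.2 h)

theorem cap_exch_eq {x y v : Vertex n} (h : v.1 = x.1 ∨ v.1 = y.1) :
    S.cap v (exch x y v) = S.cap x y := by
  rcases h with h | h <;> rcases fst_eq_iff.1 h with rfl | rfl
  · rw [exch_left]
  · rw [signed_bar, exch_left, S.cap_bar]
  · rw [exch_right, S.cap_symm]
  · rw [signed_bar, exch_right, S.cap_bar, S.cap_symm]

theorem capProd_extend (hc : IsPattern c) {x y : Vertex n} (hx : c x = x) (hy : c y = y) :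
    S.capProd (extend c x y) = S.capProd c * S.cap x y := by
  rw [S.capProd_eq_list_prod (hc.extend hx hy)
    (K := ((Finset.univ : Finset (Vertex n)).toList.map fun v => S.cap v (c v)) ++ [S.cap x y])]
  · rw [List.prod_append, List.prod_singleton]; rfl
  · intro v
    right
    rw [List.mem_append]
    by_cases h : v.1 = x.1 ∨ v.1 = y.1
    · right
      rw [hc.extend_of_eq hx hy h, S.cap_exch_eq h]
      exact List.mem_singleton_self _
    · left
      push Not at h
      rw [hc.extend_of_ne hx hy h.1 h.2]
      exact S.mem_caps.2 ⟨v, rfl⟩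
  · intro z hz
    rcases List.mem_append.1 hz with h | h
    · obtain ⟨v, rfl⟩ := S.mem_caps.1 h
      refine ⟨v, ?_⟩
      by_cases h : v.1 = x.1 ∨ v.1 = y.1
      · right
        rcases h with h | h
        · rw [hc.free_of_fst_eq hx h, S.cap_self]
        · rw [hc.free_of_fst_eq hy h, S.cap_self]
      · push Not at h
        rw [hc.extend_of_ne hx hy h.1 h.2]
        exact Or.inl rfl
    · rw [List.mem_singleton.1 h]
      exact ⟨x, Or.inl (by rw [hc.extend_of_eq hx hy (Or.inl rfl), S.cap_exch_eq (Or.inl rfl)])⟩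

theorem singles_extend (hc : IsPattern c) {x y : Vertex n} (hx : c x = x) (hy : c y = y)
    (hxy : x ≠ y) (v : Vertex n) :
    singles (extend c x y) v = if v.1 = x.1 ∨ v.1 = y.1 then bar v else singles c v := by
  by_cases h : v.1 = x.1 ∨ v.1 = y.1
  · rw [if_pos h, singles_of_ne]
    rw [hc.extend_of_eq hx hy h]
    exact exch_ne_self hxy h
  · rw [if_neg h]
    push Not at h
    rw [singles, singles, hc.extend_of_ne hx hy h.1 h.2]

theorem cap_bar_self {u v : Vertex n} (h : u.1 = v.1) : S.cap u (bar u) = S.cap v (bar v) := by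
  rcases fst_eq_iff.1 h with rfl | rfl
  · rfl
  · rw [bar_bar, S.cap_symm]

theorem capProd_singles_extend (hc : IsPattern c) {x y : Vertex n} (hx : c x = x) (hy : c y = y)
    (hxy : x ≠ y) : S.capProd (singles (extend c x y))
      = S.capProd (singles c) * (S.cap x (bar x) * S.cap y (bar y)) := by
  rw [S.capProd_eq_list_prod (hc.extend hx hy).singles
    (K := ((Finset.univ : Finset (Vertex n)).toList.map fun v => S.cap v (singles c v))
      ++ [S.cap x (bar x), S.cap y (bar y)])]
  · rw [List.prod_append]
    simp only [List.prod_cons, List.prod_nil, mul_one]; rfl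
  · intro v
    right
    rw [List.mem_append, singles_extend hc hx hy hxy]
    split_ifs with h
    · right
      rcases h with h | h <;> rw [S.cap_bar_self h] <;> simp
    · exact Or.inl (S.mem_caps.2 ⟨v, rfl⟩)
  · intro z hz
    rcases List.mem_append.1 hz with h | h
    · obtain ⟨v, rfl⟩ := S.mem_caps.1 h
      refine ⟨v, ?_⟩
      rw [singles_extend hc hx hy hxy]
      split_ifs with h
      · right
        rcases h with h | h
        · rw [singles_eq_self_iff.2 (hc.free_of_fst_eq hx h), S.cap_self]
        · rw [singles_eq_self_iff.2 (hc.free_of_fst_eq hy h), S.cap_self]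
      · exact Or.inl rfl
    · simp only [List.mem_cons, List.not_mem_nil, or_false] at h
      rcases h with rfl | rfl
      · exact ⟨x, Or.inl (by rw [singles_extend hc hx hy hxy, if_pos (Or.inl rfl)])⟩
      · exact ⟨y, Or.inl (by rw [singles_extend hc hx hy hxy, if_pos (Or.inr rfl)])⟩

theorem perm_mul_capProd (w : signed n) (hc : IsPattern c) :
    S.perm w * S.capProd c = S.capProd (conjPattern w c) * S.perm w := by
  have h1 : ∀ L : List (Vertex n), S.perm w * (L.map fun v => S.cap v (c v)).prod
      = (L.map fun v => S.cap (w v) (w (c v))).prod * S.perm w := by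
    intro L
    induction L with
    | nil => simp
    | cons v L ih =>
      rw [List.map_cons, List.map_cons, List.prod_cons, List.prod_cons, ← mul_assoc, perm_mul_cap,
        mul_assoc, ih, mul_assoc]
  rw [capProd, h1]
  congr 1
  refine (S.capProd_eq_list_prod (hc.conj w) ?_ ?_).symm
  · intro v
    right
    rw [List.mem_map]
    refine ⟨w⁻¹ v, by simp, ?_⟩
    rw [signed_apply_inv_self]; rfl
  · intro x hx
    rw [List.mem_map] at hx
    obtain ⟨v, -, rfl⟩ := hx
    exact ⟨w v, Or.inl (by rw [conjPattern_apply])⟩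

/-- The product of the caps of a pattern, preceded by the symmetric caps at all of its vertices. -/
noncomputable def fullProd (c : Vertex n → Vertex n) : M := S.capProd (singles c) * S.capProd c

theorem commute_cap_fullProd (hc : IsPattern c) {x y : Vertex n} (hx : c x = x) (hy : c y = y) :
    Commute (S.cap x y) (S.fullProd c) :=
  (S.commute_cap_capProd hc.singles (singles_eq_self_iff.2 hx)
    (singles_eq_self_iff.2 hy)).mul_right (S.commute_cap_capProd hc hx hy)

theorem fullProd_extend (hc : IsPattern c) {x y : Vertex n} (hx : c x = x) (hy : c y = y)
    (hxy : x ≠ y) : S.fullProd (extend c x y)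
      = S.fullProd c * (S.cap x (bar x) * S.cap y (bar y) * S.cap x y) := by
  have hf : ∀ z, c z = z → Commute (S.cap z (bar z)) (S.capProd c) := fun z hz =>
    S.commute_cap_capProd hc hz (hc.bar_eq_self_iff.2 hz)
  have h := ((hf x hx).mul_left (hf y hy)).eq
  rw [fullProd, fullProd, S.capProd_extend hc hx hy, S.capProd_singles_extend hc hx hy hxy,
    mul_assoc, ← mul_assoc (S.cap x (bar x) * S.cap y (bar y)), h]
  simp only [mul_assoc]

theorem fullProd_mul_perm (hc : IsPattern c) (w : signed n) :
    S.fullProd c * S.perm w = S.perm w * S.fullProd (conjPattern w⁻¹ c) := by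
  have h : conjPattern w (conjPattern w⁻¹ c) = c := by
    funext v; simp [conjPattern]
  rw [fullProd, fullProd, mul_assoc, ← mul_assoc (S.perm w),
    S.perm_mul_capProd w (hc.conj w⁻¹).singles, mul_assoc _ (S.perm w),
    S.perm_mul_capProd w (hc.conj w⁻¹), ← singles_conj, h]

/-- Permutations of the vertices of a pattern are absorbed by its symmetric caps. -/
theorem perm_mul_fullProd (hc : IsPattern c) (g : signed n) (hg : ∀ v, c v = v → g v = v) :
    S.perm g * S.fullProd c = S.fullProd c := by
  suffices H : S.perm g * S.capProd (singles c) = S.capProd (singles c) by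
    rw [fullProd, ← mul_assoc, H]
  have habs : ∀ u, c u ≠ u → S.cap u (bar u) * S.capProd (singles c) = S.capProd (singles c) := by
    intro u hu
    have := S.cap_mul_capProd hc.singles u
    rwa [singles_of_ne hu] at this
  refine signed_induction (C := fun g => S.perm g * S.capProd (singles c) = S.capProd (singles c))
    (fun v => c v ≠ v) (by rw [map_one, one_mul]) ?_ g (fun v hv => hg v (not_not.1 hv))
  intro u v h hu hv ih
  rw [map_mul, mul_assoc, ih]
  by_cases huv : u.1 = v.1
  · rcases fst_eq_iff.1 huv.symm with rfl | rfl
    · rw [exch_self, map_one, one_mul]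
    · rw [← habs u hu, ← mul_assoc, S.perm_exch_mul_cap]
  · have e : S.capProd (singles c)
        = S.cap u (bar u) * S.cap v (bar v) * S.capProd (singles c) := by
      rw [mul_assoc, habs v hv, habs u hu]
    rw [e, ← mul_assoc, S.perm_single_single huv]

/-- The normal form with top pattern `a`, bottom pattern `c`, and a strand from `w v` in the top row
to `v` in the bottom row for every vertex `v` that is free in `c`. -/
noncomputable def normalForm (a : Vertex n → Vertex n) (w : signed n) (c : Vertex n → Vertex n) : M :=
  S.capProd a * S.perm w * S.fullProd c

/-- The data of a normal form: `w` carries the free vertices of `c` to those of `a`. -/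
structure _root_.BrauerB.IsFormData (a : Vertex n → Vertex n) (w : signed n)
    (c : Vertex n → Vertex n) : Prop where
  top : IsPattern a
  bot : IsPattern c
  free_iff : ∀ v, a (w v) = w v ↔ c v = v

variable {a : Vertex n → Vertex n} {w : signed n}

/-- A normal form depends only on the strands, not on the extension `w` of the strands to a signed
permutation. -/
theorem normalForm_eq (h : IsFormData a w c) {g : signed n} (hg : ∀ v, c v = v → w v = g v) :
    S.normalForm a w c = S.normalForm a g c := by
  have e : g = w * (w⁻¹ * g) := by group
  have h1 : S.perm (w⁻¹ * g) * S.fullProd c = S.fullProd c :=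
    S.perm_mul_fullProd h.bot _ fun v hv => by
      rw [signed_mul_apply, ← hg v hv, signed_inv_apply_self]
  rw [normalForm, normalForm, e, map_mul, ← mul_assoc,
    mul_assoc (S.capProd a * S.perm w) _ (S.fullProd c), h1]

/-- The elements that have a normal form. -/
def HasForm (x : M) : Prop := ∃ a w c, IsFormData a w c ∧ x = S.normalForm a w c

theorem hasForm_one : S.HasForm 1 :=
  ⟨id, 1, id, ⟨isPattern_id, isPattern_id, fun _ => Iff.rfl⟩, by
    have : singles (id : Vertex n → Vertex n) = id := by
      funext v; exact singles_eq_self_iff.2 rfl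
    rw [normalForm, fullProd, this, S.capProd_id, map_one, one_mul, one_mul]⟩

theorem hasForm_mul_perm {x : M} (hx : S.HasForm x) (g : signed n) : S.HasForm (x * S.perm g) := by
  obtain ⟨a, w, c, h, rfl⟩ := hx
  refine ⟨a, w * g, conjPattern g⁻¹ c, ⟨h.top, h.bot.conj _, fun v => ?_⟩, ?_⟩
  · rw [signed_mul_apply, h.free_iff]
    simp only [conjPattern, inv_inv]
    conv_rhs => rw [← signed_inj g, signed_apply_inv_self]
  · rw [normalForm, normalForm, mul_assoc, S.fullProd_mul_perm h.bot, map_mul]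
    simp only [mul_assoc]

theorem single_idem (x : Vertex n) : S.cap x (bar x) * S.cap x (bar x) = S.cap x (bar x) :=
  S.cap_idem _ _

theorem cap_single_single_cap {x y : Vertex n} (hxy : x ≠ y) :
    S.cap x y * (S.cap x (bar x) * S.cap y (bar y) * S.cap x y) = S.cap x y := by
  by_cases h : x.1 = y.1
  · obtain rfl := (fst_eq_iff.1 h.symm).resolve_left hxy.symm
    rw [bar_bar, S.cap_symm (bar x), S.cap_idem, S.cap_idem, S.cap_idem]
  · rw [mul_assoc, ← S.single_cap _ _ h, ← mul_assoc (S.cap x (bar x)), S.single_idem,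
      ← mul_assoc, S.cap_single_cap _ _ h]

/-- Capping two free vertices. -/
theorem hasForm_mul_cap_free (h : IsFormData a w c) {x y : Vertex n} (hx : c x = x) (hy : c y = y)
    (hxy : x ≠ y) : S.HasForm (S.normalForm a w c * S.cap x y) := by
  have hx' := (h.free_iff x).2 hx
  have hy' := (h.free_iff y).2 hy
  have hxy' : w x ≠ w y := fun e => hxy (signed_injective w e)
  refine ⟨extend a (w x) (w y), w, extend c x y,
    ⟨h.top.extend hx' hy', h.bot.extend hx hy, fun v => ?_⟩, ?_⟩
  · rw [h.top.extend_eq_self_iff hx' hy' hxy', h.bot.extend_eq_self_iff hx hy hxy, h.free_iff,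
      Ne, Ne, signed_fst_eq_iff, signed_fst_eq_iff]
  · have hcomm := (S.commute_cap_fullProd h.bot hx hy).eq
    calc S.normalForm a w c * S.cap x y
        = S.capProd a * S.perm w * (S.fullProd c * S.cap x y) := by
          rw [normalForm, mul_assoc]
      _ = S.capProd a * S.perm w * (S.cap x y * S.fullProd c
            * (S.cap x (bar x) * S.cap y (bar y) * S.cap x y)) := by
          rw [hcomm, mul_assoc (S.fullProd c), S.cap_single_single_cap hxy]
      _ = S.normalForm (extend a (w x) (w y)) w (extend c x y) := by
          rw [normalForm, S.capProd_extend h.top hx' hy', S.fullProd_extend h.bot hx hy hxy,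
            mul_assoc (S.capProd a), mul_assoc (S.capProd a), ← S.perm_mul_cap]
          simp only [mul_assoc]

/-- Splitting a pair of caps into symmetric caps. -/
theorem hasForm_mul_cap_split (h : IsFormData a w c) {x : Vertex n} (hx : (c x).1 ≠ x.1) :
    S.HasForm (S.normalForm a w c * S.cap x (bar x)) := by
  obtain ⟨d, hd, hdx, hdy, hcd, -⟩ := h.bot.exists_eq_extend x
  generalize hy : c x = y at *
  subst hcd
  have hxy : x ≠ y := fun e => hx (by rw [e])
  have hxb := hd.bar_eq_self_iff.2 hdx
  have hd1 := hd.extend hdx hxb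
  have hy1 : extend d x (bar x) y = y := by rw [hd.extend_of_ne hdx hxb hx hx, hdy]
  have hyb1 := hd1.bar_eq_self_iff.2 hy1
  refine ⟨a, w, extend (extend d x (bar x)) y (bar y),
    ⟨h.top, hd1.extend hy1 hyb1, fun v => ?_⟩, ?_⟩
  · rw [h.free_iff, hd1.extend_eq_self_iff hy1 hyb1 (bar_ne y).symm,
      hd.extend_eq_self_iff hdx hdy hxy, hd.extend_eq_self_iff hdx hxb (bar_ne x).symm]
    simp only [bar_fst]
    tauto
  · have hne : x.1 ≠ y.1 := hx.symm
    have e1 : S.cap x (bar x) * S.cap y (bar y) * S.cap x y * S.cap x (bar x)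
        = S.cap x (bar x) * S.cap y (bar y) := by
      rw [S.single_comm hne, mul_assoc, mul_assoc, ← mul_assoc (S.cap x (bar x)),
        S.single_cap_single _ _ hne, S.single_comm hne, ← mul_assoc, S.single_idem]
    have e2 : ∀ z, S.cap z (bar z) * S.cap (bar z) (bar (bar z)) * S.cap z (bar z)
        = S.cap z (bar z) := fun z => by
      rw [bar_bar, S.cap_symm (bar z), S.single_idem, S.single_idem]
    rw [normalForm, normalForm, S.fullProd_extend hd hdx hdy hxy,
      S.fullProd_extend hd1 hy1 hyb1 (bar_ne y).symm,
      S.fullProd_extend hd hdx hxb (bar_ne x).symm, e2, e2, mul_assoc, mul_assoc (S.fullProd d),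
      mul_assoc (S.fullProd d), e1]

/-- Moving the end of a pair of caps. -/
theorem hasForm_mul_cap_move (h : IsFormData a w c) {x y : Vertex n} (hx : (c x).1 ≠ x.1)
    (hxy : x.1 ≠ y.1) : S.HasForm (S.normalForm a w c * S.cap x y) := by
  have e : S.fullProd c * S.cap x y = S.fullProd c * S.perm (exch (c x) y) := by
    have h1 : S.fullProd c = S.fullProd c * S.cap (c x) x := by
      rw [fullProd, mul_assoc, S.cap_symm, S.capProd_mul_cap h.bot]
    rw [h1, mul_assoc, S.cap_mul_cap' hx hxy, ← mul_assoc]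
  have : S.normalForm a w c * S.cap x y = S.normalForm a w c * S.perm (exch (c x) y) := by
    rw [normalForm, mul_assoc, e, ← mul_assoc]
  rw [this]
  exact S.hasForm_mul_perm ⟨a, w, c, h, rfl⟩ _

theorem single_single_cap {x y : Vertex n} (h : x.1 ≠ y.1) :
    S.cap x (bar x) * S.cap y (bar y) * S.cap x y = S.cap x (bar x) * S.cap x y := by
  rw [mul_assoc, ← S.single_cap _ _ h, ← mul_assoc, S.single_idem]

/-- Capping a symmetric cap with a free vertex. -/
theorem hasForm_mul_cap_single (h : IsFormData a w c) {x y : Vertex n} (hx : c x = bar x)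
    (hy : c y = y) : S.HasForm (S.normalForm a w c * S.cap x y) := by
  obtain ⟨d, hd, hdx, hdb, hcd, hfree⟩ := h.bot.exists_eq_extend x
  rw [hx] at hdb hcd
  have hdy := hfree y hy
  have hne : x.1 ≠ y.1 := fun e => bar_ne x (hx ▸ h.bot.free_of_fst_eq hy e)
  have hxy : x ≠ y := fun e => hne (by rw [e])
  have hy' := (h.free_iff y).2 hy
  have hyb' := h.top.bar_eq_self_iff.2 hy'
  refine ⟨extend a (w y) (bar (w y)), w, extend d x y,
    ⟨h.top.extend hy' hyb', hd.extend hdx hdy, fun v => ?_⟩, ?_⟩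
  · rw [h.top.extend_eq_self_iff hy' hyb' (bar_ne _).symm, h.free_iff, hcd,
      hd.extend_eq_self_iff hdx hdb (bar_ne _).symm, hd.extend_eq_self_iff hdx hdy hxy]
    simp only [bar_fst, Ne, signed_fst_eq_iff]
    tauto
  · have hcomm := (S.commute_cap_fullProd hd hdy (hd.bar_eq_self_iff.2 hdy)).eq
    have e1 : S.cap x (bar x) * S.cap (bar x) (bar (bar x)) * S.cap x (bar x)
        = S.cap x (bar x) := by
      rw [bar_bar, S.cap_symm (bar x), S.single_idem, S.single_idem]
    have e2 : S.cap y (bar y) * (S.cap x (bar x) * S.cap x y) = S.cap x (bar x) * S.cap x y := by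
      rw [S.single_cap _ _ hne, ← mul_assoc, S.single_idem]
    have e3 : S.fullProd c = S.fullProd d * S.cap x (bar x) := by
      rw [hcd, S.fullProd_extend hd hdx hdb (bar_ne x).symm, e1]
    rw [normalForm, normalForm, e3, S.capProd_extend h.top hy' hyb',
      S.fullProd_extend hd hdx hdy hxy, S.single_single_cap hne, mul_assoc (S.capProd a) _ (S.perm w),
      ← signed_bar, ← S.perm_mul_cap, mul_assoc, mul_assoc, mul_assoc, mul_assoc, mul_assoc,
      ← mul_assoc (S.cap y _), hcomm, mul_assoc, e2]

/-- Capping two symmetric caps. -/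
theorem hasForm_mul_cap_singles (h : IsFormData a w c) {x y : Vertex n} (hx : c x = bar x)
    (hy : c y = bar y) (hne : x.1 ≠ y.1) : S.HasForm (S.normalForm a w c * S.cap x y) := by
  have hxy : x ≠ y := fun e => hne (by rw [e])
  obtain ⟨d, hd, hdx, hdb, hcd, -⟩ := h.bot.exists_eq_extend x
  rw [hx] at hdb hcd
  have hdy : d y = bar y := by
    rw [← hy, hcd, hd.extend_of_ne hdx hdb hne.symm hne.symm]
  obtain ⟨f, hf, hfy, hfb, hdf, hfree⟩ := hd.exists_eq_extend y
  rw [hdy] at hfb hdf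
  have hfx := hfree x hdx
  refine ⟨a, w, extend f x y, ⟨h.top, hf.extend hfx hfy, fun v => ?_⟩, ?_⟩
  · rw [h.free_iff, hcd, hd.extend_eq_self_iff hdx hdb (bar_ne _).symm, hdf,
      hf.extend_eq_self_iff hfy hfb (bar_ne _).symm, hf.extend_eq_self_iff hfx hfy hxy]
    simp only [bar_fst]
    tauto
  · have e1 : ∀ z, S.cap z (bar z) * S.cap (bar z) (bar (bar z)) * S.cap z (bar z)
        = S.cap z (bar z) := fun z => by
      rw [bar_bar, S.cap_symm (bar z), S.single_idem, S.single_idem]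
    have e2 : S.fullProd c = S.fullProd f * S.cap y (bar y) * S.cap x (bar x) := by
      rw [hcd, S.fullProd_extend hd hdx hdb (bar_ne x).symm, e1, hdf,
        S.fullProd_extend hf hfy hfb (bar_ne y).symm, e1]
    rw [normalForm, normalForm, e2, S.fullProd_extend hf hfx hfy hxy, S.single_comm hne]
    simp only [mul_assoc]

theorem hasForm_mul_cap {z : M} (hz : S.HasForm z) (x y : Vertex n) :
    S.HasForm (z * S.cap x y) := by
  obtain ⟨a, w, c, h, rfl⟩ := hz
  by_cases hxy : x.1 = y.1
  · rcases fst_eq_iff.1 hxy.symm with rfl | rfl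
    · rw [S.cap_self, mul_one]
      exact ⟨a, w, c, h, rfl⟩
    by_cases hx : (c x).1 = x.1
    · rcases fst_eq_iff.1 hx with hx | hx
      · exact S.hasForm_mul_cap_free h hx (h.bot.bar_eq_self_iff.2 hx) (bar_ne x).symm
      · refine ⟨a, w, c, h, ?_⟩
        rw [normalForm, fullProd, mul_assoc, mul_assoc _ (S.capProd c), ← hx,
          S.capProd_mul_cap h.bot]
    · exact S.hasForm_mul_cap_split h hx
  by_cases hx : (c x).1 = x.1
  · by_cases hy : (c y).1 = y.1
    · rcases fst_eq_iff.1 hx with hx | hx <;> rcases fst_eq_iff.1 hy with hy | hy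
      · exact S.hasForm_mul_cap_free h hx hy fun e => hxy (by rw [e])
      · rw [S.cap_symm]
        exact S.hasForm_mul_cap_single h hy hx
      · exact S.hasForm_mul_cap_single h hx hy
      · exact S.hasForm_mul_cap_singles h hx hy hxy
    · rw [S.cap_symm]
      exact S.hasForm_mul_cap_move h hy fun e => hxy e.symm
  · exact S.hasForm_mul_cap_move h hx hxy

end CapSystem

/-! ### Normal forms of diagrams -/

section diagrams

open BrauerDiagram

variable {n : ℕ} {a c : Vertex n → Vertex n} {w : signed n}

theorem capProd_vert (hc : IsPattern c) {v : Vertex n} (hv : c v = v) :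
    drel ((diagramCapSystem n).capProd c) (.inl v) (.inr v) := by
  have H : ∀ L : List (Vertex n),
      drel ((L.map fun u => (diagramCapSystem n).cap u (c u)).prod) (.inl v) (.inr v) := by
    intro L
    induction L with
    | nil => exact (rfl : drel (1 : typeB n) (.inl v) (.inr v))
    | cons u L ih =>
      rw [List.map_cons, List.prod_cons]
      refine mul_rel_through (capDiagram_vert ?_) ih
      by_cases hu : c u = u
      · rw [hu, exch_self, signed_one_apply]
      · exact exch_of_fst_ne (fun e => hu (hc.free_of_fst_eq hv e.symm))
          (fun e => hu (hc.fst_eq_of_free hv e.symm))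
  exact H _

theorem normalForm_top (h : IsFormData a w c) {v : Vertex n} (hv : a v ≠ v) :
    drel ((diagramCapSystem n).normalForm a w c) (.inl v) (.inl (a v)) := by
  refine mul_rel_top (mul_rel_top ?_)
  rw [← CapSystem.cap_mul_capProd _ h.top v]
  exact mul_rel_top (capDiagram_top' hv.symm)

theorem normalForm_bot (h : IsFormData a w c) {v : Vertex n} (hv : c v ≠ v) :
    drel ((diagramCapSystem n).normalForm a w c) (.inr v) (.inr (c v)) := by
  refine mul_rel_bot (mul_rel_bot ?_)
  rw [← CapSystem.capProd_mul_cap _ h.bot v]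
  exact mul_rel_bot (capDiagram_bot' hv.symm)

theorem normalForm_through (h : IsFormData a w c) {v : Vertex n} (hv : c v = v) :
    drel ((diagramCapSystem n).normalForm a w c) (.inl (w v)) (.inr v) :=
  mul_rel_through (mul_rel_through (capProd_vert h.top ((h.free_iff v).2 hv)) (permDiagram_rel w v))
    (mul_rel_through (capProd_vert h.bot.singles (singles_eq_self_iff.2 hv))
      (capProd_vert h.bot hv))

theorem drel_unique {P : typeB n} {u v v' : Vertex n ⊕ Vertex n} (h : drel P u v) (h' : drel P u v')
    (hv : v ≠ u) (hv' : v' ≠ u) : v = v' :=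
  (P.1.pairs u).unique ⟨hv, h⟩ ⟨hv', h'⟩

/-- The diagram of a normal form determines its patterns and its strands. -/
theorem normalForm_injective {a' c' : Vertex n → Vertex n} {w' : signed n} (h : IsFormData a w c)
    (h' : IsFormData a' w' c')
    (e : (diagramCapSystem n).normalForm a w c = (diagramCapSystem n).normalForm a' w' c') :
    a = a' ∧ c = c' ∧ ∀ v, c v = v → w v = w' v := by
  have through : ∀ {a c : Vertex n → Vertex n} {w : signed n}, IsFormData a w c → ∀ v, a v = v →
      drel ((diagramCapSystem n).normalForm a w c) (.inl v) (.inr (w⁻¹ v)) := by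
    intro a c w h v hv
    have hv' : c (w⁻¹ v) = w⁻¹ v := by
      rw [← h.free_iff, signed_apply_inv_self, hv]
    simpa using normalForm_through h hv'
  refine ⟨?_, ?_, ?_⟩
  · funext v
    by_cases hv : a v = v <;> by_cases hv' : a' v = v
    · rw [hv, hv']
    · have h1 := normalForm_top h' hv'
      rw [← e] at h1
      exact absurd (drel_unique (through h v hv) h1 (by simp) (by simpa using hv')) (by simp)
    · have h1 := normalForm_top h hv
      rw [e] at h1
      exact absurd (drel_unique h1 (through h' v hv') (by simpa using hv) (by simp)) (by simp)
    · have h1 := normalForm_top h' hv'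
      rw [← e] at h1
      exact Sum.inl_injective
        (drel_unique (normalForm_top h hv) h1 (by simpa using hv) (by simpa using hv'))
  · funext v
    by_cases hv : c v = v <;> by_cases hv' : c' v = v
    · rw [hv, hv']
    · have h1 := normalForm_bot h' hv'
      rw [← e] at h1
      exact absurd (drel_unique (drel_symm (normalForm_through h hv)) h1 (by simp)
        (by simpa using hv')) (by simp)
    · have h1 := normalForm_bot h hv
      rw [e] at h1
      exact absurd (drel_unique h1 (drel_symm (normalForm_through h' hv')) (by simpa using hv)
        (by simp)) (by simp)
    · have h1 := normalForm_bot h' hv'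
      rw [← e] at h1
      exact Sum.inr_injective
        (drel_unique (normalForm_bot h hv) h1 (by simpa using hv) (by simpa using hv'))
  · intro v hv
    by_cases hv' : c' v = v
    · have h1 := normalForm_through h' hv'
      rw [← e] at h1
      exact Sum.inl_injective
        (drel_unique (drel_symm (normalForm_through h hv)) (drel_symm h1) (by simp) (by simp))
    · have h1 := normalForm_bot h' hv'
      rw [← e] at h1
      exact absurd (drel_unique (drel_symm (normalForm_through h hv)) h1 (by simp)
        (by simpa using hv')) (by simp)

theorem partner_bar (P : typeB n) (u : Vertex n ⊕ Vertex n) :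
    P.1.partner (Sum.map bar bar u) = Sum.map bar bar (P.1.partner u) := by
  refine drel_unique (P := P) (P.1.rel_partner _) (drel_bar P (P.1.rel_partner u))
    (P.1.partner_ne _) fun e => P.1.partner_ne u ?_
  rcases u with u | u <;> rcases h : P.1.partner _ with v | v <;> rw [h] at e <;> simp at e <;>
    rw [bar_injective e]

/-- Every diagram is a normal form. -/
theorem exists_normalForm (P : typeB n) :
    ∃ a w c, IsFormData a w c ∧ P = (diagramCapSystem n).normalForm a w c := by
  have hinv := P.1.partner_involutive
  let a : Vertex n → Vertex n := fun v => Sum.elim id (fun _ => v) (P.1.partner (.inl v))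
  let c : Vertex n → Vertex n := fun v => Sum.elim (fun _ => v) id (P.1.partner (.inr v))
  have ha : ∀ v, a v ≠ v → P.1.partner (.inl v) = .inl (a v) := by
    intro v hv
    rcases h : P.1.partner (.inl v) with u | u
    · simp [a, h]
    · simp [a, h] at hv
  have ha' : ∀ v, a v = v → ∃ u, P.1.partner (.inl v) = .inr u := by
    intro v hv
    rcases h : P.1.partner (.inl v) with u | u
    · simp only [a, h, Sum.elim_inl, id] at hv
      exact absurd (hv ▸ h) (P.1.partner_ne _)
    · exact ⟨u, rfl⟩
  have hc : ∀ v, c v ≠ v → P.1.partner (.inr v) = .inr (c v) := by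
    intro v hv
    rcases h : P.1.partner (.inr v) with u | u
    · simp [c, h] at hv
    · simp [c, h]
  have hc' : ∀ v, c v = v → ∃ u, P.1.partner (.inr v) = .inl u := by
    intro v hv
    rcases h : P.1.partner (.inr v) with u | u
    · exact ⟨u, rfl⟩
    · simp only [c, h, Sum.elim_inr, id] at hv
      exact absurd (hv ▸ h) (P.1.partner_ne _)
  have pa : IsPattern a := by
    refine ⟨fun v => ?_, fun v => ?_⟩
    · by_cases hv : a v = v
      · rw [hv, hv]
      · have h1 := hinv (.inl v)
        rw [ha v hv] at h1
        change Sum.elim id (fun _ => a v) (P.1.partner (.inl (a v))) = v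
        rw [h1]; rfl
    · have h1 : P.1.partner (.inl (bar v)) = _ := partner_bar P (.inl v)
      change Sum.elim id (fun _ => bar v) (P.1.partner (.inl (bar v))) = _
      rw [h1]
      rcases h : P.1.partner (.inl v) with u | u <;> simp [a, h]
  have pc : IsPattern c := by
    refine ⟨fun v => ?_, fun v => ?_⟩
    · by_cases hv : c v = v
      · rw [hv, hv]
      · have h1 := hinv (.inr v)
        rw [hc v hv] at h1
        change Sum.elim (fun _ => c v) id (P.1.partner (.inr (c v))) = v
        rw [h1]; rfl
    · have h1 : P.1.partner (.inr (bar v)) = _ := partner_bar P (.inr v)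
      change Sum.elim (fun _ => bar v) id (P.1.partner (.inr (bar v))) = _
      rw [h1]
      rcases h : P.1.partner (.inr v) with u | u <;> simp [c, h]
  -- the strands, as a map from the free vertices of the bottom row to the top row
  let g : Vertex n → Vertex n := fun v => Sum.elim id (fun _ => v) (P.1.partner (.inr v))
  have hg : ∀ v, c v = v → P.1.partner (.inr v) = .inl (g v) := by
    intro v hv
    obtain ⟨u, hu⟩ := hc' v hv
    simp [g, hu]
  have hgbar : ∀ v, c v = v → g (bar v) = bar (g v) := by
    intro v hv
    have h1 : P.1.partner (.inr (bar v)) = _ := partner_bar P (.inr v)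
    rw [hg v hv, hg (bar v) (pc.bar_eq_self_iff.2 hv)] at h1
    exact Sum.inl_injective h1
  have hginj : ∀ u v, c u = u → c v = v → g u = g v → u = v := by
    intro u v hu hv h
    have h1 : P.1.partner (.inr u) = P.1.partner (.inr v) := by rw [hg u hu, hg v hv, h]
    exact Sum.inr_injective (hinv.injective h1)
  obtain ⟨w, hw⟩ := exists_signed (I := {k : Fin n // c (k, false) = (k, false)})
    (fun k => (k.1, false)) (fun k => g (k.1, false)) (fun _ _ h => Subtype.ext h) (by
      intro i j h
      apply Subtype.ext
      simp only at h
      rcases fst_eq_iff.1 h with h | h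
      · exact congrArg Prod.fst (hginj _ _ i.2 j.2 h)
      · rw [← hgbar _ j.2] at h
        exact congrArg Prod.fst (hginj _ _ i.2 (pc.bar_eq_self_iff.2 j.2) h))
  have hw' : ∀ v, c v = v → w v = g v := by
    rintro ⟨k, b⟩ hv
    cases b
    · exact hw ⟨k, hv⟩
    · have hv' : c (k, false) = (k, false) := pc.bar_eq_self_iff.1 hv
      have h1 := congrArg bar (hw ⟨k, hv'⟩)
      simp only at h1
      rwa [← hgbar _ hv', ← signed_bar] at h1
  have h : IsFormData a w c := by
    refine ⟨pa, pc, fun v => ⟨fun hv => ?_, fun hv => ?_⟩⟩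
    · obtain ⟨u, hu⟩ := ha' _ hv
      have h1 := hinv (.inl (w v))
      rw [hu] at h1
      have h2 : c u = u := by
        change Sum.elim (fun _ => u) id (P.1.partner (.inr u)) = u
        rw [h1]; rfl
      have h3 : w u = w v := by
        rw [hw' u h2]
        rw [hg u h2] at h1
        exact Sum.inl_injective h1
      rw [signed_inj] at h3
      rw [← h3, h2]
    · have h1 := hinv (.inr v)
      rw [hg v hv, ← hw' v hv] at h1
      change Sum.elim id (fun _ => w v) (P.1.partner (.inl (w v))) = w v
      rw [h1]; rfl
  have rel : ∀ {u v}, P.1.partner u = v → drel P u v := fun e => e ▸ P.1.rel_partner _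
  refine ⟨a, w, c, h, typeB_ext (fun k => ⟨(k, false), rfl, ?_⟩) fun k => ⟨(k, false), rfl, ?_⟩⟩
  · by_cases hv : a (k, false) = (k, false)
    · have hv' : c (w⁻¹ (k, false)) = w⁻¹ (k, false) := by
        rw [← h.free_iff, signed_apply_inv_self, hv]
      have h1 := rel (hg _ hv')
      have h2 := normalForm_through h hv'
      rw [← hw' _ hv', signed_apply_inv_self] at h1
      rw [signed_apply_inv_self] at h2
      exact ⟨_, by simp, drel_symm h1, h2⟩
    · exact ⟨_, by simpa using hv, rel (ha _ hv), normalForm_top h hv⟩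
  · by_cases hv : c (k, false) = (k, false)
    · have h1 := rel (hg _ hv)
      rw [← hw' _ hv] at h1
      exact ⟨_, by simp, h1, drel_symm (normalForm_through h hv)⟩
    · exact ⟨_, by simpa using hv, rel (hc _ hv), normalForm_bot h hv⟩

end diagrams

/-! ### The isomorphism -/

section presentation

variable {n : ℕ}

variable (n) in
/-- The homomorphism from the presented monoid to the monoid of diagrams. -/
def toDiagram : Pres n →* typeB n :=
  PresentedMonoid.lift (diagramCapSystem n).gen fun _ _ h => (diagramCapSystem n).lift_gen_eq h

theorem toDiagram_ps (i : Fin n) : toDiagram n (ps i) = permDiagram (simple i) := rfl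

theorem toDiagram_pt (i : Fin n) : toDiagram n (pt i) = capDiagram (lo i) (hi i) := rfl

theorem toDiagram_pperm (w : signed n) : toDiagram n (pperm n w) = permDiagram w := by
  have : (toDiagram n).comp (pperm n) = (diagramCapSystem n).perm :=
    signed_hom_ext fun i => by
      rw [MonoidHom.comp_apply, pperm_simple, toDiagram_ps]; rfl
  exact DFunLike.congr_fun this w

theorem toDiagram_pcap (u v : Vertex n) : toDiagram n (pcap u v) = capDiagram u v := by
  rcases eq_or_ne u v with rfl | h
  · rw [pcap_self, map_one, capDiagram_self]
  · obtain ⟨w, i, rfl, rfl⟩ := exists_apply_lo_hi h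
    rw [pcap_apply, map_mul, map_mul, toDiagram_pperm, toDiagram_pperm, toDiagram_pt,
      permDiagram_mul_capDiagram, mul_assoc, ← permDiagram_mul, mul_inv_cancel, permDiagram_one,
      mul_one]

theorem toDiagram_normalForm (a : Vertex n → Vertex n) (w : signed n) (c : Vertex n → Vertex n) :
    toDiagram n ((presCapSystem n).normalForm a w c)
      = (diagramCapSystem n).normalForm a w c := by
  have h : ∀ c, toDiagram n ((presCapSystem n).capProd c) = (diagramCapSystem n).capProd c := by
    intro c
    rw [CapSystem.capProd, CapSystem.capProd, map_list_prod, List.map_map]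
    exact congrArg List.prod (List.map_congr_left fun v _ => toDiagram_pcap _ _)
  have hp : toDiagram n ((presCapSystem n).perm w) = (diagramCapSystem n).perm w :=
    toDiagram_pperm w
  rw [CapSystem.normalForm, CapSystem.normalForm, CapSystem.fullProd, CapSystem.fullProd, map_mul,
    map_mul, map_mul, h, h, h, hp]

/-- The elements with a normal form contain `1` and are closed under right multiplication by the
generators. -/
theorem hasForm_pres (x : Pres n) : (presCapSystem n).HasForm x := by
  have hx : x ∈ Submonoid.closure (Set.range (PresentedMonoid.of (Rel n))) := by
    rw [PresentedMonoid.closure_range_of]; trivial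
  induction hx using Submonoid.closure_induction_right with
  | one => exact (presCapSystem n).hasForm_one
  | mul_right x _ y hy ih =>
    obtain ⟨i | i, rfl⟩ := hy
    · have : PresentedMonoid.of (Rel n) (.s i) = (presCapSystem n).perm (simple i) :=
        (pperm_simple i).symm
      rw [this]
      exact (presCapSystem n).hasForm_mul_perm ih _
    · have : PresentedMonoid.of (Rel n) (.t i) = (presCapSystem n).cap (lo i) (hi i) :=
        (pcap_lo_hi i).symm
      rw [this]
      exact (presCapSystem n).hasForm_mul_cap ih _ _

theorem toDiagram_injective : Function.Injective (toDiagram n) := by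
  intro x y e
  obtain ⟨a, w, c, h, rfl⟩ := hasForm_pres x
  obtain ⟨a', w', c', h', rfl⟩ := hasForm_pres y
  rw [toDiagram_normalForm, toDiagram_normalForm] at e
  obtain ⟨rfl, rfl, hw⟩ := normalForm_injective h h' e
  exact (presCapSystem n).normalForm_eq h hw

theorem toDiagram_surjective : Function.Surjective (toDiagram n) := by
  intro P
  obtain ⟨a, w, c, -, rfl⟩ := exists_normalForm P
  exact ⟨_, toDiagram_normalForm a w c⟩

end presentation

end BrauerB

/-- For `n ≥ 1`, sending the abstract generators to the diagrams `sGen i` and `tGen i` induces an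
isomorphism from the monoid presented by the relations `BrauerB.Rel n` onto the type B Brauer
monoid. -/
theorem theorem4p4 (n : ℕ) (hn : 0 < n) :
    ∃ φ : PresentedMonoid (BrauerB.Rel n) ≃* BrauerB.typeB n,
      (∀ i : Fin n, φ (PresentedMonoid.of (BrauerB.Rel n) (SingularArtin.Gen.s i))
        = BrauerB.sGen i) ∧
      (∀ i : Fin n, φ (PresentedMonoid.of (BrauerB.Rel n) (SingularArtin.Gen.t i))
        = BrauerB.tGen i) :=
  ⟨MulEquiv.ofBijective (BrauerB.toDiagram n)
      ⟨BrauerB.toDiagram_injective, BrauerB.toDiagram_surjective⟩,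
    BrauerB.diagramCapSystem_gen_s, BrauerB.diagramCapSystem_gen_t⟩
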